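/- **Setting.** All manifolds are smooth, Hausdorff and second countable. For a Euclidean space $U$, a complex subspace $S\subseteq U^{\mathbb C}$ is *coisotropic* if $S^{\perp}\subseteq S$, where $\perp$ is taken with respect to the complex bilinear extension of the inner product. A *conjugation* of a complex manifold is an involutive antiholomorphic diffeomorphism. If $N$ is a compact complex manifold with a conjugation, a *Euclidean $N$-structure* on $U$ is a holomorphic embedding of $N$ into a Grassmannian $\mathrm{Gr}_k(U^{\mathbb C})$ which intertwines the conjugations and whose values are coisotropic. Let $M$ and $Y$ be Riemannian manifolds and $Z$ a complex manifold endowed with a conjugation. Let $\pi:Y\to M$ and $\varphi:Y\to Z$ be surjective submersions, and write $Y_x=\pi^{-1}(x)$, $\mathcal H=(\ker d\pi)^{\perp}$, $\mathcal K=(\ker d\varphi)^{\perp}$. Let $E$ be a Riemannian vector bundle over $M$ with a metric connection $\nabla$, let $\rho:E\to TM$ be a morphism of vector bundles which is an orthogonal projection at each point, let $\iota:TM\to E$ be the inclusion of $TM$ as $(\ker\rho)^{\perp}$, and let $\sigma:Y\to\mathrm{Gr}(E^{\mathbb C})$ be a smooth map over $M$. We say that $(E,\rho,\sigma,\nabla)$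 is a *Riemannian twistorial structure on $M$ given by $\varphi$ and $\pi$* if: 1. $\pi$ is a proper Riemannian submersion with totally geodesic fibres; 2. each fibre $Y_x$ is a complex manifold with a conjugation, these conjugations together form a smooth map of $Y$, and $\varphi|_{Y_x}$ is a holomorphic embedding intertwining the conjugations; 3. for each $x$, $\sigma|_{Y_x}$ is a Euclidean $Y_x$-structure on $E_x$, $\sigma(y)\cap(\ker\rho)^{\mathbb C}=0$ for all $y\in Y_x$, and $y\mapsto\rho(\sigma(y))$ is smooth on $Y$ and, on $Y_x$, is a Euclidean $Y_x$-structure on $T_xM$; 4. on each $Y_x$ the metric induced from $Y$ is the Kähler metric induced, through $y\mapsto\rho(\sigma(y))$, from the canonical Kähler metric (with any fixed normalization) of the Grassmannian of $T_x^{\mathbb C}M$; 5. $\mathcal H$ is the connection on $Y\subseteq\mathrm{Gr}(E^{\mathbb C})$ induced by $\nabla$ (that is, $\sigma$ is $\nabla$-parallel in the directions of $\mathcal H$); 6. the $\iota$-torsion $d^{\nabla}\iota$ is totally antisymmetric, that is, $(u,v,w)\mapsto\langle d^{\nabla}\iota(u,v),\iota w\rangle$ is a $3$-form on $M$; 7.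 $\mathcal C=(d\varphi)^{-1}(T^{0,1}Z)$ is coisotropic and equal to $\mathcal B\oplus(\ker d\pi)^{0,1}$, where $\mathcal B\subseteq\mathcal H^{\mathbb C}$ is the horizontal lift of $\rho(\sigma)$. Then $\mathcal K$ has an orthogonal complex structure $J$ for which $d\varphi|_{\mathcal K}$ is complex linear, and $J$ preserves $\mathcal H\cap\mathcal K$. Denote by $P_{\mathcal H\cap\mathcal K}$ the orthogonal projection onto $\mathcal H\cap\mathcal K$, by $I^{\mathcal H}$ the integrability tensor of $\mathcal H$ ($I^{\mathcal H}(X,X')$ is the component of $[X,X']$ in $\ker d\pi$, for sections $X,X'$ of $\mathcal H$), by $T$ the section of $\mathcal H\otimes\Lambda^2\mathcal H^*$ corresponding to the torsion of the connection $\rho\nabla$ induced by $\nabla$ on $M$, and by $\omega$ the Kähler form of $(\mathcal H\cap\mathcal K,J)$; thus $\mathrm{trace}_\omega B=\sum_i B(e_i,Je_i)$ for any orthonormal basis $(e_i)$ of $\mathcal H\cap\mathcal K$. **Theorem 3.4.** Let $M$ be endowed with a Riemannian twistorial structure given by $\varphi:Y\to Z$ and $\pi:Y\to M$, and suppose that the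 fibres of $\varphi$ are minimal. Then the following assertions are equivalent: (i) for any holomorphic function $f$ defined on an open subset $U$ of $Z$, the function $f\circ\varphi$ is harmonic on $\varphi^{-1}(U)$; (ii) $\mathrm{trace}_\omega\bigl(I^{\mathcal H}+P_{\mathcal H\cap\mathcal K}T\bigr)=0$ at each point of $Y$. Consequently, if (ii) holds then, for any Kähler metric on the complex manifold $Z$, $\varphi$ is a harmonic map. -/

import Mathlib

open Bundle
open scoped Manifold ContDiff TensorProduct

noncomputable section

namespace Twistorial

/-! ### Complexified vector spaces and their Grassmannians -/

section Complexification

variable {V : Type*} [AddCommGroup V] [Module ℝ V]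

/-- The real part `ℂ ⊗ V → V`. -/
def re : ℂ ⊗[ℝ] V →ₗ[ℝ] V :=
  TensorProduct.lift ((LinearMap.lsmul ℝ V).comp Complex.reLm)

/-- The imaginary part `ℂ ⊗ V → V`. -/
def im : ℂ ⊗[ℝ] V →ₗ[ℝ] V :=
  TensorProduct.lift ((LinearMap.lsmul ℝ V).comp Complex.imLm)

/-- The complex vector `a + i b`. -/
def mkC (a b : V) : ℂ ⊗[ℝ] V := (1 : ℂ) ⊗ₜ[ℝ] a + Complex.I ⊗ₜ[ℝ] b

theorem re_mkC (a b : V) : re (mkC a b) = a := by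
  simp [re, mkC]

theorem im_mkC (a b : V) : im (mkC a b) = b := by
  simp [im, mkC]

theorem mkC_re_im (w : ℂ ⊗[ℝ] V) : mkC (re w) (im w) = w := by
  induction w using TensorProduct.induction_on with
  | zero => simp [mkC]
  | tmul z v =>
    have h : (z : ℂ) = z.re • (1 : ℂ) + z.im • Complex.I := by
      simp
    have h1 : mkC (re (z ⊗ₜ[ℝ] v)) (im (z ⊗ₜ[ℝ] v))
        = (z.re • (1 : ℂ) + z.im • Complex.I) ⊗ₜ[ℝ] v := by
      simp only [mkC, re, im, TensorProduct.add_tmul, ← TensorProduct.smul_tmul',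
        TensorProduct.lift.tmul, LinearMap.comp_apply, LinearMap.lsmul_apply,
        TensorProduct.tmul_smul, Complex.reLm_coe, Complex.imLm_coe]
    rw [h1, ← h]
  | add x y hx hy =>
    conv_rhs => rw [← hx, ← hy]
    simp only [mkC, map_add, TensorProduct.tmul_add]
    abel

/-- Complex conjugation on `ℂ ⊗ V`. -/
def conjC : ℂ ⊗[ℝ] V →ₗ[ℝ] ℂ ⊗[ℝ] V :=
  TensorProduct.map Complex.conjAe.toLinearMap LinearMap.id

theorem conjC_smul (z : ℂ) (w : ℂ ⊗[ℝ] V) :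
    conjC (z • w) = (starRingEnd ℂ z) • conjC w := by
  induction w using TensorProduct.induction_on with
  | zero => simp
  | tmul c v => simp [conjC, TensorProduct.smul_tmul']
  | add x y hx hy => simp [hx, hy]

/-- The conjugate of a complex subspace of `ℂ ⊗ V`. -/
def conjSub (S : Submodule ℂ (ℂ ⊗[ℝ] V)) : Submodule ℂ (ℂ ⊗[ℝ] V) where
  carrier := {w | conjC w ∈ S}
  add_mem' := fun ha hb => by
    simp only [Set.mem_ofPred_eq, map_add] at *
    exact S.add_mem ha hb
  zero_mem' := by simp
  smul_mem' := fun z w hw => by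
    simp only [Set.mem_ofPred_eq, conjC_smul] at *
    exact S.smul_mem _ hw

end Complexification

section Euclidean

variable {V : Type*} [NormedAddCommGroup V] [InnerProductSpace ℝ V]

/-- The complex bilinear extension to `ℂ ⊗ V` of the inner product of `V`. -/
def bilC (V : Type*) [NormedAddCommGroup V] [InnerProductSpace ℝ V] :
    LinearMap.BilinForm ℂ (ℂ ⊗[ℝ] V) :=
  LinearMap.BilinForm.baseChange ℂ (innerₗ V)

/-- A complex subspace of `ℂ ⊗ V` is coisotropic if it contains its orthogonal complement
with respect to the complex bilinear inner product. -/
def IsCoisotropic (S : Submodule ℂ (ℂ ⊗[ℝ] V)) : Prop :=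
  (bilC V).orthogonal S ≤ S

/-- The Hermitian orthogonal projection of `ℂ ⊗ V` onto the complex subspace `S`.  The real inner
product of `ℂ ⊗ V` is the real part of the Hermitian one, hence both have the same orthogonal
projections onto complex subspaces.  The Grassmannian of `ℂ ⊗ V` is regarded, as usual, as a
submanifold of the space of endomorphisms of `ℂ ⊗ V` through `S ↦ projC S`. -/
def projC [FiniteDimensional ℝ V] (S : Submodule ℂ (ℂ ⊗[ℝ] V)) : ℂ ⊗[ℝ] V →L[ℝ] ℂ ⊗[ℝ] V :=
  haveI : FiniteDimensional ℝ (S.restrictScalars ℝ) := inferInstance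
  haveI : CompleteSpace (S.restrictScalars ℝ) := FiniteDimensional.complete ℝ _
  (S.restrictScalars ℝ).starProjection

end Euclidean

/-! ### Riemannian manifolds -/

section Riemannian

variable {E : Type*} [NormedAddCommGroup E] [NormedSpace ℝ E] [FiniteDimensional ℝ E]
  {M : Type*} [TopologicalSpace M] [ChartedSpace E M]

instance finiteDimensional_tangentSpace (x : M) : FiniteDimensional ℝ (TangentSpace 𝓘(ℝ, E) x) :=
  inferInstanceAs (FiniteDimensional ℝ E)

variable [IsManifold 𝓘(ℝ, E) ∞ M] [RiemannianBundle (fun x : M => TangentSpace 𝓘(ℝ, E) x)]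

/-- The Koszul expression, equal to `2 ⟨∇_X Y, Z⟩` for the Levi-Civita connection `∇`. -/
def koszul (X Y Z : ∀ x : M, TangentSpace 𝓘(ℝ, E) x) (x : M) : ℝ :=
  mvfderiv 𝓘(ℝ, E) (fun x' : M => inner ℝ (Y x') (Z x')) x (X x)
  + mvfderiv 𝓘(ℝ, E) (fun x' : M => inner ℝ (X x') (Z x')) x (Y x)
  - mvfderiv 𝓘(ℝ, E) (fun x' : M => inner ℝ (X x') (Y x')) x (Z x)
  + inner ℝ (VectorField.mlieBracket 𝓘(ℝ, E) X Y x) (Z x)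
  - inner ℝ (VectorField.mlieBracket 𝓘(ℝ, E) X Z x) (Y x)
  - inner ℝ (VectorField.mlieBracket 𝓘(ℝ, E) Y Z x) (X x)

/-- The Levi-Civita connection: `leviCivita Y x v` is `∇_v Y`, for `v` tangent at `x`.  It is the
vector whose inner product with any `z` is half the Koszul expression; the vectors `v` and `z` are
extended arbitrarily to smooth vector fields near `x`. -/
def leviCivita (Y : ∀ x : M, TangentSpace 𝓘(ℝ, E) x) (x : M) (v : TangentSpace 𝓘(ℝ, E) x) :
    TangentSpace 𝓘(ℝ, E) x :=
  ∑ i, ((1 / 2 : ℝ) * koszul (FiberBundle.extend E v) Y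
      (FiberBundle.extend E (stdOrthonormalBasis ℝ (TangentSpace 𝓘(ℝ, E) x) i)) x) •
    stdOrthonormalBasis ℝ (TangentSpace 𝓘(ℝ, E) x) i

/-- The orthogonal projection of tangent vectors at `x` onto a subspace. -/
def projT {x : M} (D : Submodule ℝ (TangentSpace 𝓘(ℝ, E) x)) (v : TangentSpace 𝓘(ℝ, E) x) :
    TangentSpace 𝓘(ℝ, E) x :=
  haveI : CompleteSpace D := FiniteDimensional.complete ℝ D
  D.starProjection v

/-- The extension of a vector `v ∈ D_x` to a local section of the distribution `D`. -/
def extendIn (D : ∀ x : M, Submodule ℝ (TangentSpace 𝓘(ℝ, E) x)) {x : M}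
    (v : TangentSpace 𝓘(ℝ, E) x) (x' : M) : TangentSpace 𝓘(ℝ, E) x' :=
  projT (D x') (FiberBundle.extend E v x')

/-- The second fundamental form of a distribution, `(u, v) ↦ (∇_u v)^⊥` on sections of `D`.
If `D` is integrable it restricts to the second fundamental form of each of its leaves. -/
def secondFund (D : ∀ x : M, Submodule ℝ (TangentSpace 𝓘(ℝ, E) x)) (x : M)
    (u v : TangentSpace 𝓘(ℝ, E) x) : TangentSpace 𝓘(ℝ, E) x :=
  projT (D x)ᗮ (leviCivita (extendIn D v) x u)

/-- The integrability tensor of a distribution, `(u, v) ↦ [u, v]^⊥` on sections of `D`. -/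
def integrabilityTensor (D : ∀ x : M, Submodule ℝ (TangentSpace 𝓘(ℝ, E) x)) (x : M)
    (u v : TangentSpace 𝓘(ℝ, E) x) : TangentSpace 𝓘(ℝ, E) x :=
  projT (D x)ᗮ (VectorField.mlieBracket 𝓘(ℝ, E) (extendIn D u) (extendIn D v) x)

/-- The Laplacian (trace of the Hessian `(u, v) ↦ u (v f) - (∇_u v) f`) of a complex function. -/
def laplacian (f : M → ℂ) (x : M) : ℂ :=
  ∑ i, (mvfderiv 𝓘(ℝ, E) (fun x' : M => mvfderiv 𝓘(ℝ, E) f x'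
        (FiberBundle.extend E (stdOrthonormalBasis ℝ (TangentSpace 𝓘(ℝ, E) x) i) x')) x
        (stdOrthonormalBasis ℝ (TangentSpace 𝓘(ℝ, E) x) i)
    - mvfderiv 𝓘(ℝ, E) f x
        (leviCivita (FiberBundle.extend E (stdOrthonormalBasis ℝ (TangentSpace 𝓘(ℝ, E) x) i)) x
          (stdOrthonormalBasis ℝ (TangentSpace 𝓘(ℝ, E) x) i)))

end Riemannian

/-! ### Derivatives of sections along maps, and maps into Grassmannian bundles -/

section Along

variable {EY : Type*} [NormedAddCommGroup EY] [NormedSpace ℝ EY]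
  {Y : Type*} [TopologicalSpace Y] [ChartedSpace EY Y]
  {EM : Type*} [NormedAddCommGroup EM] [NormedSpace ℝ EM]
  {M : Type*} [TopologicalSpace M] [ChartedSpace EM M]
  (F : Type*) [NormedAddCommGroup F] [NormedSpace ℝ F]
  {E : M → Type*} [TopologicalSpace (TotalSpace F E)]

section Real

variable [∀ x, AddCommGroup (E x)] [∀ x, Module ℝ (E x)] [∀ x, TopologicalSpace (E x)]
  [FiberBundle F E]

/-- The derivative in the direction `v` of a section `s` of `E` along `f : Y → M`, computed in the
preferred trivialization of `E` at `f y`.  If `v` is tangent to a fibre `f ⁻¹ {x}` it does not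
depend on the trivialization: it is the derivative of the restriction of `s` to the fibre, which is
a map into the fixed vector space `E x`. -/
def trivDeriv (f : Y → M) (s : ∀ y, E (f y)) (y : Y) (v : TangentSpace 𝓘(ℝ, EY) y) : E (f y) :=
  (trivializationAt F E (f y)).symm (f y)
    (mvfderiv 𝓘(ℝ, EY) (fun y' : Y => (trivializationAt F E (f y) ⟨f y', s y'⟩).2) y v)

/-- The pull back along `f : Y → M` of the connection `D` on `E`, applied to a section `s` of `E`
along `f`: in terms of a local frame `e` of `E` and of `s = ∑ sᵢ (eᵢ ∘ f)`, it is
`∑ (v sᵢ) eᵢ + sᵢ D_{df(v)} eᵢ`. -/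
def pullbackConn (D : (∀ x, E x) → ∀ x : M, TangentSpace 𝓘(ℝ, EM) x → E x) (f : Y → M)
    (s : ∀ y, E (f y)) (y : Y) (v : TangentSpace 𝓘(ℝ, EY) y) : E (f y) :=
  trivDeriv F f s y v +
    D (FiberBundle.extend F (s y)) (f y) (mfderiv 𝓘(ℝ, EY) 𝓘(ℝ, EM) f y v)

/-- The extension to complex sections of a derivation of sections of `E` along `f`. -/
def derivC {f : Y → M}
    (D : (∀ y, E (f y)) → ∀ y : Y, TangentSpace 𝓘(ℝ, EY) y → E (f y))
    (s : ∀ y, ℂ ⊗[ℝ] E (f y)) (y : Y) (v : TangentSpace 𝓘(ℝ, EY) y) : ℂ ⊗[ℝ] E (f y) :=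
  mkC (D (fun y' => re (s y')) y v) (D (fun y' => im (s y')) y v)

/-- A local section of the complexification of `E` which extends the vector `w`. -/
def extendC {x : M} (w : ℂ ⊗[ℝ] E x) (x' : M) : ℂ ⊗[ℝ] E x' :=
  mkC (FiberBundle.extend F (re w) x') (FiberBundle.extend F (im w) x')

end Real

variable [∀ x, NormedAddCommGroup (E x)] [∀ x, InnerProductSpace ℝ (E x)]
  [∀ x, FiniteDimensional ℝ (E x)] [FiberBundle F E]

/-- The differential at `y`, in the direction `v`, of `S : Y → Gr(E^ℂ)` (covering `f : Y → M`),
computed with the derivation `D` of the sections of `E` along `f`.  It is the endomorphism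
`w ↦ (D_v P) w = D_v (P w) - P (D_v w)`, where `P y` is the Hermitian orthogonal projection onto
`S y`.  On restricting to `S y` we obtain the usual description of the differential as an element of
`Hom (S y, (S y)^⊥)`. -/
def grDeriv {f : Y → M}
    (D : (∀ y, E (f y)) → ∀ y : Y, TangentSpace 𝓘(ℝ, EY) y → E (f y))
    (S : ∀ y, Submodule ℂ (ℂ ⊗[ℝ] E (f y))) (y : Y) (v : TangentSpace 𝓘(ℝ, EY) y)
    (w : ℂ ⊗[ℝ] E (f y)) : ℂ ⊗[ℝ] E (f y) :=
  derivC D (fun y' => projC (S y') (extendC F w (f y'))) y v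
    - projC (S y) (derivC D (fun y' => extendC F w (f y')) y v)

/-- The (real) inner product, at `S y`, of the differentials of `S` in the directions `u` and `v`
tangent to a fibre of `f`, with respect to the metric `⟨P', Q'⟩ = Re tr (P' Q')` of the Grassmannian
of `ℂ ⊗ E (f y)`.  This is the canonical (unitary invariant) Kähler metric up to a constant
factor. -/
def grMetric {f : Y → M} (S : ∀ y, Submodule ℂ (ℂ ⊗[ℝ] E (f y))) (y : Y)
    (u v : TangentSpace 𝓘(ℝ, EY) y) : ℝ :=
  ∑ i, inner ℝ
    (grDeriv F (trivDeriv F f) S y u ((1 : ℂ) ⊗ₜ[ℝ] stdOrthonormalBasis ℝ (E (f y)) i))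
    (grDeriv F (trivDeriv F f) S y v ((1 : ℂ) ⊗ₜ[ℝ] stdOrthonormalBasis ℝ (E (f y)) i))

/-- Smoothness of `S : Y → Gr(E^ℂ)`: the corresponding orthogonal projection maps smooth sections
of `E` to smooth complex sections along `f`. -/
def IsSmoothGr {f : Y → M} (S : ∀ y, Submodule ℂ (ℂ ⊗[ℝ] E (f y))) : Prop :=
  ∀ s : ∀ x, E x,
    ContMDiff 𝓘(ℝ, EM) (𝓘(ℝ, EM).prod 𝓘(ℝ, F)) ∞ (fun x => TotalSpace.mk' F x (s x)) →
    ContMDiff 𝓘(ℝ, EY) (𝓘(ℝ, EM).prod 𝓘(ℝ, F)) ∞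
      (fun y => TotalSpace.mk' F (f y) (re (projC (S y) ((1 : ℂ) ⊗ₜ[ℝ] s (f y))))) ∧
    ContMDiff 𝓘(ℝ, EY) (𝓘(ℝ, EM).prod 𝓘(ℝ, F)) ∞
      (fun y => TotalSpace.mk' F (f y) (im (projC (S y) ((1 : ℂ) ⊗ₜ[ℝ] s (f y)))))

end Along

/-! ### Submersions and complex manifolds -/

section Submersion

variable {EY : Type*} [NormedAddCommGroup EY] [NormedSpace ℝ EY]
  {Y : Type*} [TopologicalSpace Y] [ChartedSpace EY Y]
  {EM : Type*} [NormedAddCommGroup EM] [NormedSpace ℝ EM]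
  {M : Type*} [TopologicalSpace M] [ChartedSpace EM M]

/-- The kernel of the differential. -/
def vert (EY EM : Type*) [NormedAddCommGroup EY] [NormedSpace ℝ EY] [NormedAddCommGroup EM]
    [NormedSpace ℝ EM] {Y : Type*} [TopologicalSpace Y] [ChartedSpace EY Y]
    {M : Type*} [TopologicalSpace M] [ChartedSpace EM M]
    (f : Y → M) (y : Y) : Submodule ℝ (TangentSpace 𝓘(ℝ, EY) y) :=
  LinearMap.ker (mfderiv 𝓘(ℝ, EY) 𝓘(ℝ, EM) f y).toLinearMap

/-- A smooth surjective submersion. -/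
structure IsSurjSubmersion (EY EM : Type*) [NormedAddCommGroup EY] [NormedSpace ℝ EY]
    [NormedAddCommGroup EM] [NormedSpace ℝ EM] {Y : Type*} [TopologicalSpace Y] [ChartedSpace EY Y]
    {M : Type*} [TopologicalSpace M] [ChartedSpace EM M] (f : Y → M) : Prop where
  smooth : ContMDiff 𝓘(ℝ, EY) 𝓘(ℝ, EM) ∞ f
  surjective : Function.Surjective f
  submersion : ∀ y, Function.Surjective (mfderiv 𝓘(ℝ, EY) 𝓘(ℝ, EM) f y)

variable [FiniteDimensional ℝ EY] [IsManifold 𝓘(ℝ, EY) ∞ Y]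
  [RiemannianBundle (fun y : Y => TangentSpace 𝓘(ℝ, EY) y)]

/-- The orthogonal complement of the kernel of the differential. -/
def hor (EY EM : Type*) [NormedAddCommGroup EY] [NormedSpace ℝ EY] [NormedAddCommGroup EM]
    [NormedSpace ℝ EM] {Y : Type*} [TopologicalSpace Y] [ChartedSpace EY Y]
    [RiemannianBundle (fun y : Y => TangentSpace 𝓘(ℝ, EY) y)]
    {M : Type*} [TopologicalSpace M] [ChartedSpace EM M]
    (f : Y → M) (y : Y) : Submodule ℝ (TangentSpace 𝓘(ℝ, EY) y) :=
  (vert EY EM f y)ᗮ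

/-- The horizontal lift with respect to a submersion `f`: the vector orthogonal to `ker df` which is
mapped by `df` to the given vector. -/
def horLift (f : Y → M) (y : Y) (w : TangentSpace 𝓘(ℝ, EM) (f y)) : TangentSpace 𝓘(ℝ, EY) y :=
  projT (hor EY EM f y) (Function.invFun (mfderiv 𝓘(ℝ, EY) 𝓘(ℝ, EM) f y) w)

/-- The fibres of the submersion `f` are minimal: their mean curvature is zero. -/
def HasMinimalFibres (EY EM : Type*) [NormedAddCommGroup EY] [NormedSpace ℝ EY]
    [FiniteDimensional ℝ EY] [NormedAddCommGroup EM] [NormedSpace ℝ EM]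
    {Y : Type*} [TopologicalSpace Y] [ChartedSpace EY Y] [IsManifold 𝓘(ℝ, EY) ∞ Y]
    [RiemannianBundle (fun y : Y => TangentSpace 𝓘(ℝ, EY) y)]
    {M : Type*} [TopologicalSpace M] [ChartedSpace EM M] (f : Y → M) : Prop :=
  ∀ y : Y, ∑ i, secondFund (vert EY EM f) y
    (stdOrthonormalBasis ℝ (vert EY EM f y) i : TangentSpace 𝓘(ℝ, EY) y)
    (stdOrthonormalBasis ℝ (vert EY EM f y) i : TangentSpace 𝓘(ℝ, EY) y) = 0

/-- The tension field `trace ∇df` of a map between Riemannian manifolds. -/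
def tension [FiniteDimensional ℝ EM] [IsManifold 𝓘(ℝ, EM) ∞ M]
    [RiemannianBundle (fun x : M => TangentSpace 𝓘(ℝ, EM) x)] (f : Y → M) (y : Y) :
    TangentSpace 𝓘(ℝ, EM) (f y) :=
  ∑ i, (pullbackConn EM (leviCivita (M := M)) f
      (fun y' : Y => mfderiv 𝓘(ℝ, EY) 𝓘(ℝ, EM) f y'
        (FiberBundle.extend EY (stdOrthonormalBasis ℝ (TangentSpace 𝓘(ℝ, EY) y) i) y')) y
      (stdOrthonormalBasis ℝ (TangentSpace 𝓘(ℝ, EY) y) i)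
    - mfderiv 𝓘(ℝ, EY) 𝓘(ℝ, EM) f y
      (leviCivita (FiberBundle.extend EY (stdOrthonormalBasis ℝ (TangentSpace 𝓘(ℝ, EY) y) i)) y
        (stdOrthonormalBasis ℝ (TangentSpace 𝓘(ℝ, EY) y) i)))

end Submersion

section Complex

variable {EZ : Type*} [NormedAddCommGroup EZ] [NormedSpace ℂ EZ]
  {Z : Type*} [TopologicalSpace Z] [ChartedSpace EZ Z]

/-- The smooth manifold underlying a complex manifold. -/
instance isManifold_real [h : IsManifold 𝓘(ℂ, EZ) ω Z] : IsManifold 𝓘(ℝ, EZ) ∞ Z := by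
  refine isManifold_of_contDiffOn _ _ _ fun e e' he he' => ?_
  have h1 := ((contDiffGroupoid ω 𝓘(ℂ, EZ)).compatible he he')
  have h2 := ((mem_groupoid_of_pregroupoid.1 h1).1)
  have h3 : ContDiffOn ℂ ω (e.symm ≫ₕ e') (e.symm ≫ₕ e').source := by
    simpa [contDiffPregroupoid] using h2
  have h4 := (h3.restrict_scalars ℝ).of_le (le_top : (∞ : ℕ∞ω) ≤ ω)
  simpa using h4

/-- The complex structure (multiplication by `i`) of the real tangent spaces of a complex
manifold. -/
def mulI (z : Z) : TangentSpace 𝓘(ℝ, EZ) z →ₗ[ℝ] TangentSpace 𝓘(ℝ, EZ) z :=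
  ((Complex.I • LinearMap.id : EZ →ₗ[ℂ] EZ).restrictScalars ℝ : EZ →ₗ[ℝ] EZ)

/-- The antiholomorphic tangent space: the `-i` eigenspace of the complex structure. -/
def T01 (z : Z) : Submodule ℂ (ℂ ⊗[ℝ] TangentSpace 𝓘(ℝ, EZ) z) :=
  LinearMap.ker ((mulI z).baseChange ℂ + Complex.I • LinearMap.id)

/-- A conjugation on a complex manifold: an involutive antiholomorphic diffeomorphism. -/
structure IsConjugation (c : Z → Z) : Prop where
  smooth : ContMDiff 𝓘(ℝ, EZ) 𝓘(ℝ, EZ) ∞ c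
  involutive : Function.Involutive c
  antiholomorphic : ∀ (z : Z) (v : TangentSpace 𝓘(ℝ, EZ) z),
    mfderiv 𝓘(ℝ, EZ) 𝓘(ℝ, EZ) c z (mulI z v) = -mulI (c z) (mfderiv 𝓘(ℝ, EZ) 𝓘(ℝ, EZ) c z v)

/-- The Riemannian metric of the complex manifold `Z` is Kähler: it is Hermitian and the complex
structure is parallel with respect to the Levi-Civita connection. -/
structure IsKaehler (EZ Z : Type*) [NormedAddCommGroup EZ] [NormedSpace ℂ EZ]
    [FiniteDimensional ℝ EZ] [TopologicalSpace Z] [ChartedSpace EZ Z] [IsManifold 𝓘(ℂ, EZ) ω Z]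
    [RiemannianBundle (fun z : Z => TangentSpace 𝓘(ℝ, EZ) z)] : Prop where
  hermitian : ∀ (z : Z) (u v : TangentSpace 𝓘(ℝ, EZ) z), inner ℝ (mulI z u) (mulI z v) = inner ℝ u v
  parallel : ∀ (X : ∀ z : Z, TangentSpace 𝓘(ℝ, EZ) z) (z : Z),
    ContMDiffAt 𝓘(ℝ, EZ) (𝓘(ℝ, EZ).prod 𝓘(ℝ, EZ)) ∞ (fun z' => TotalSpace.mk' EZ z' (X z')) z →
    ∀ v : TangentSpace 𝓘(ℝ, EZ) z,
      leviCivita (fun z' => mulI z' (X z')) z v = mulI z (leviCivita X z v)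

end Complex

/-! ### Riemannian twistorial structures -/

section Twistor

variable {EM : Type*} [NormedAddCommGroup EM] [NormedSpace ℝ EM] [FiniteDimensional ℝ EM]
  {M : Type*} [TopologicalSpace M] [ChartedSpace EM M] [IsManifold 𝓘(ℝ, EM) ∞ M]
  {EY : Type*} [NormedAddCommGroup EY] [NormedSpace ℝ EY] [FiniteDimensional ℝ EY]
  {Y : Type*} [TopologicalSpace Y] [ChartedSpace EY Y] [IsManifold 𝓘(ℝ, EY) ∞ Y]
  [RiemannianBundle (fun y : Y => TangentSpace 𝓘(ℝ, EY) y)]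
  {EZ : Type*} [NormedAddCommGroup EZ] [NormedSpace ℂ EZ]
  {Z : Type*} [TopologicalSpace Z] [ChartedSpace EZ Z]

/-- The distribution `(dφ)⁻¹ (T^{0,1} Z)` in `T^ℂ Y`. -/
def pullT01 (EY : Type*) [NormedAddCommGroup EY] [NormedSpace ℝ EY] {EZ : Type*}
    [NormedAddCommGroup EZ] [NormedSpace ℂ EZ] {Y : Type*} [TopologicalSpace Y] [ChartedSpace EY Y]
    {Z : Type*} [TopologicalSpace Z] [ChartedSpace EZ Z] (φ : Y → Z) (y : Y) :
    Submodule ℂ (ℂ ⊗[ℝ] TangentSpace 𝓘(ℝ, EY) y) :=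
  (T01 (EZ := EZ) (φ y)).comap
    ((mfderiv 𝓘(ℝ, EY) 𝓘(ℝ, EZ) φ y).toLinearMap.baseChange ℂ)

/-- The antiholomorphic tangent space `(ker dp)^{0,1}` of the fibre of `p` through `y`, the fibre
being endowed with the complex structure with respect to which the restriction of `φ` to it is
holomorphic: it is spanned by `u + i J u`, with `u` tangent to the fibre and `J` its complex
structure, characterized by `dφ (J u) = i dφ u`. -/
def vert01 (EM EZ : Type*) [NormedAddCommGroup EM] [NormedSpace ℝ EM] [NormedAddCommGroup EZ]
    [NormedSpace ℂ EZ] {M Z : Type*} [TopologicalSpace M] [ChartedSpace EM M]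
    [TopologicalSpace Z] [ChartedSpace EZ Z] (p : Y → M) (φ : Y → Z) (y : Y) :
    Submodule ℂ (ℂ ⊗[ℝ] TangentSpace 𝓘(ℝ, EY) y) :=
  Submodule.span ℂ {w | ∃ u ∈ vert EY EM p y, ∃ v ∈ vert EY EM p y,
    mfderiv 𝓘(ℝ, EY) 𝓘(ℝ, EZ) φ y v = mulI (φ y) (mfderiv 𝓘(ℝ, EY) 𝓘(ℝ, EZ) φ y u) ∧
    w = mkC u v}

/-- `σ : Y → Gr(E^ℂ)`, covering `p : Y → M`, is a Riemannian `Y`-structure on the Riemannian vector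
bundle `E`: it is smooth and, on each fibre `Y_x` of `p`, it is a Euclidean `Y_x`-structure on `E_x`;
that is, a holomorphic embedding of `Y_x` into a Grassmannian of `E_x^ℂ`, intertwining the
conjugations, whose values are coisotropic.  Here `c` is the conjugation of the fibres of `p`, whose
complex structures are those with respect to which the restrictions of `φ` are holomorphic.  The
fibres being compact, an embedding is an injective immersion. -/
structure IsRiemannianYStructure (EY EM EZ F : Type*)
    [NormedAddCommGroup EY] [NormedSpace ℝ EY] [NormedAddCommGroup EM] [NormedSpace ℝ EM]
    [NormedAddCommGroup EZ] [NormedSpace ℂ EZ] [NormedAddCommGroup F] [NormedSpace ℝ F]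
    {Y : Type*} [TopologicalSpace Y] [ChartedSpace EY Y]
    {M : Type*} [TopologicalSpace M] [ChartedSpace EM M]
    {Z : Type*} [TopologicalSpace Z] [ChartedSpace EZ Z]
    (E : M → Type*) [TopologicalSpace (TotalSpace F E)]
    [∀ x, NormedAddCommGroup (E x)] [∀ x, InnerProductSpace ℝ (E x)]
    [∀ x, FiniteDimensional ℝ (E x)] [FiberBundle F E]
    (p : Y → M) (φ : Y → Z) (c : Y → Y)
    (σ : ∀ y, Submodule ℂ (ℂ ⊗[ℝ] E (p y))) : Prop where
  smooth : IsSmoothGr (EY := EY) (EM := EM) F σ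
  rank : ∀ y y', p y = p y' → Module.finrank ℂ (σ y) = Module.finrank ℂ (σ y')
  coisotropic : ∀ y, IsCoisotropic (σ y)
  conj : ∀ y, (⟨p (c y), σ (c y)⟩ : Σ x, Submodule ℂ (ℂ ⊗[ℝ] E x)) = ⟨p y, conjSub (σ y)⟩
  injective : Function.Injective
    (fun y => (⟨p y, σ y⟩ : Σ x, Submodule ℂ (ℂ ⊗[ℝ] E x)))
  immersion : ∀ y, ∀ v ∈ vert EY EM p y,
    (∀ w ∈ σ y, grDeriv F (trivDeriv F p) σ y v w = 0) → v = 0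
  holomorphic : ∀ y, ∀ u ∈ vert EY EM p y, ∀ v ∈ vert EY EM p y,
    mfderiv 𝓘(ℝ, EY) 𝓘(ℝ, EZ) φ y v = mulI (φ y) (mfderiv 𝓘(ℝ, EY) 𝓘(ℝ, EZ) φ y u) →
    ∀ w ∈ σ y, grDeriv F (trivDeriv F p) σ y v w
      = Complex.I • grDeriv F (trivDeriv F p) σ y u w

/-- The `ι`-torsion `(d^∇ ι)(u, v) = ∇_u (ι v) - ∇_v (ι u) - ι [u, v]` of a connection on `E`, where
`ι : TM → E` is a morphism of vector bundles. -/
def iotaTorsion {F : Type*} [NormedAddCommGroup F] [NormedSpace ℝ F]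
    {E : M → Type*} [TopologicalSpace (TotalSpace F E)]
    [∀ x, NormedAddCommGroup (E x)] [∀ x, InnerProductSpace ℝ (E x)] [FiberBundle F E]
    (conn : CovariantDerivative 𝓘(ℝ, EM) F E)
    (ι : ∀ x, TangentSpace 𝓘(ℝ, EM) x →ₗ[ℝ] E x) (x : M) (u v : TangentSpace 𝓘(ℝ, EM) x) : E x :=
  conn (fun x' => ι x' (FiberBundle.extend EM v x')) x u
  - conn (fun x' => ι x' (FiberBundle.extend EM u x')) x v
  - ι x (VectorField.mlieBracket 𝓘(ℝ, EM) (FiberBundle.extend EM u) (FiberBundle.extend EM v) x)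

/-- A Riemannian twistorial structure `(E, ρ, σ, ∇)` on the Riemannian manifold `M` given by the
submersions `p : Y → M` and `φ : Y → Z`, where `Y` is a Riemannian manifold and `Z` is a complex
manifold. -/
structure RiemannianTwistorialStructure (EY EM EZ F : Type*)
    [NormedAddCommGroup EY] [NormedSpace ℝ EY] [FiniteDimensional ℝ EY]
    [NormedAddCommGroup EM] [NormedSpace ℝ EM] [FiniteDimensional ℝ EM]
    [NormedAddCommGroup EZ] [NormedSpace ℂ EZ] [FiniteDimensional ℂ EZ]
    [NormedAddCommGroup F] [NormedSpace ℝ F] [FiniteDimensional ℝ F]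
    {Y : Type*} [TopologicalSpace Y] [ChartedSpace EY Y] [IsManifold 𝓘(ℝ, EY) ∞ Y]
    [RiemannianBundle (fun y : Y => TangentSpace 𝓘(ℝ, EY) y)]
    {M : Type*} [TopologicalSpace M] [ChartedSpace EM M] [IsManifold 𝓘(ℝ, EM) ∞ M]
    [RiemannianBundle (fun x : M => TangentSpace 𝓘(ℝ, EM) x)]
    {Z : Type*} [TopologicalSpace Z] [ChartedSpace EZ Z] [IsManifold 𝓘(ℂ, EZ) ω Z]
    (E : M → Type*) [TopologicalSpace (TotalSpace F E)]
    [∀ x, NormedAddCommGroup (E x)] [∀ x, InnerProductSpace ℝ (E x)]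
    [∀ x, FiniteDimensional ℝ (E x)] [FiberBundle F E] [VectorBundle ℝ F E]
    [ContMDiffVectorBundle ∞ F E 𝓘(ℝ, EM)] [IsContMDiffRiemannianBundle 𝓘(ℝ, EM) ∞ F E]
    (p : Y → M) (φ : Y → Z) where
  /-- The morphism of vector bundles `E → TM`, an orthogonal projection at each point. -/
  ρ : ∀ x, E x →ₗ[ℝ] TangentSpace 𝓘(ℝ, EM) x
  ρ_smooth : ContMDiff (𝓘(ℝ, EM).prod 𝓘(ℝ, F)) (𝓘(ℝ, EM).prod 𝓘(ℝ, EM)) ∞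
    (fun q : TotalSpace F E => (⟨q.1, ρ q.1 q.2⟩ : TangentBundle 𝓘(ℝ, EM) M))
  /-- The inclusion of `TM` into `E` as the orthogonal complement of `ker ρ`. -/
  ι : ∀ x, TangentSpace 𝓘(ℝ, EM) x →ₗ[ℝ] E x
  ι_smooth : ContMDiff (𝓘(ℝ, EM).prod 𝓘(ℝ, EM)) (𝓘(ℝ, EM).prod 𝓘(ℝ, F)) ∞
    (fun q : TangentBundle 𝓘(ℝ, EM) M => (⟨q.1, ι q.1 q.2⟩ : TotalSpace F E))
  ρ_ι : ∀ x u, ρ x (ι x u) = u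
  inner_ι : ∀ x u e, inner ℝ (ι x u) e = inner ℝ u (ρ x e)
  /-- The connection `∇` of `E`. -/
  conn : CovariantDerivative 𝓘(ℝ, EM) F E
  conn_smooth : CovariantDerivative.ContMDiffCovariantDerivative conn ∞
  conn_metric : conn.IsMetricCompatible
  /-- The conjugations of the fibres of `p`. -/
  conjY : Y → Y
  /-- The conjugation of `Z`. -/
  conjZ : Z → Z
  conjZ_isConjugation : IsConjugation (EZ := EZ) conjZ
  conjY_smooth : ContMDiff 𝓘(ℝ, EY) 𝓘(ℝ, EY) ∞ conjY
  conjY_involutive : Function.Involutive conjY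
  p_conjY : ∀ y, p (conjY y) = p y
  conjY_antiholomorphic : ∀ y, ∀ u ∈ vert EY EM p y, ∀ v ∈ vert EY EM p y,
    mfderiv 𝓘(ℝ, EY) 𝓘(ℝ, EZ) φ y v = mulI (φ y) (mfderiv 𝓘(ℝ, EY) 𝓘(ℝ, EZ) φ y u) →
    mfderiv 𝓘(ℝ, EY) 𝓘(ℝ, EZ) φ (conjY y) (mfderiv 𝓘(ℝ, EY) 𝓘(ℝ, EY) conjY y v) =
      -mulI (φ (conjY y))
        (mfderiv 𝓘(ℝ, EY) 𝓘(ℝ, EZ) φ (conjY y) (mfderiv 𝓘(ℝ, EY) 𝓘(ℝ, EY) conjY y u))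
  φ_conjY : ∀ y, φ (conjY y) = conjZ (φ y)
  /-- The embedding of `Y` into the Grassmannian bundle of `E^ℂ`. -/
  σ : ∀ y, Submodule ℂ (ℂ ⊗[ℝ] E (p y))
  /-- `p` is a proper Riemannian submersion with totally geodesic fibres. -/
  p_submersion : IsSurjSubmersion EY EM p
  p_proper : IsProperMap p
  p_riemannian : ∀ y, ∀ u ∈ hor EY EM p y, ‖mfderiv 𝓘(ℝ, EY) 𝓘(ℝ, EM) p y u‖ = ‖u‖
  p_geodesic : ∀ y, ∀ u ∈ vert EY EM p y, ∀ v ∈ vert EY EM p y, secondFund (vert EY EM p) y u v = 0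
  φ_submersion : IsSurjSubmersion EY EZ φ
  /-- The restriction of `φ` to each fibre of `p` is a holomorphic embedding into `Z`. -/
  φ_injective : ∀ y y', p y = p y' → φ y = φ y' → y = y'
  φ_immersion : ∀ y, vert EY EM p y ⊓ vert EY EZ φ y = ⊥
  φ_holomorphic : ∀ y, ∀ u ∈ vert EY EM p y, ∃ v ∈ vert EY EM p y,
    mfderiv 𝓘(ℝ, EY) 𝓘(ℝ, EZ) φ y v = mulI (φ y) (mfderiv 𝓘(ℝ, EY) 𝓘(ℝ, EZ) φ y u)
  /-- `σ` is a Riemannian `Y`-structure on `E`, which induces through `ρ` one on `M`. -/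
  σ_isYStructure : IsRiemannianYStructure EY EM EZ F E p φ conjY σ
  σ_ker : ∀ y, σ y ⊓ (LinearMap.ker (ρ (p y))).baseChange ℂ = ⊥
  ρσ_isYStructure : IsRiemannianYStructure EY EM EZ EM (fun x : M => TangentSpace 𝓘(ℝ, EM) x) p φ
    conjY (fun y => (σ y).map ((ρ (p y)).baseChange ℂ))
  /-- On the fibres of `p` the metric of `Y` is the Kähler metric induced from the Grassmannians of
  the complexified tangent spaces of `M` (the normalization of these is not important). -/
  fibre_metric : ∃ k : ℝ, 0 < k ∧ ∀ y, ∀ u ∈ vert EY EM p y, ∀ v ∈ vert EY EM p y,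
    (inner ℝ u v : ℝ) = k * grMetric EM (E := fun x : M => TangentSpace 𝓘(ℝ, EM) x)
      (fun y => (σ y).map ((ρ (p y)).baseChange ℂ)) y u v
  /-- The orthogonal complement of `ker dp` is the connection on `Y ⊆ Gr(E^ℂ)` induced by `∇`: `σ`
  is covariantly constant in the horizontal directions. -/
  hor_induced : ∀ y, ∀ u ∈ hor EY EM p y, ∀ w,
    grDeriv F (pullbackConn F (fun s x v => conn s x v) p) σ y u w = 0
  /-- The `ι`-torsion `d^∇ ι` of `∇` is totally antisymmetric. -/
  torsion_antisymm : ∀ (x : M) (u v w : TangentSpace 𝓘(ℝ, EM) x),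
    (inner ℝ (iotaTorsion conn ι x u v) (ι x w) : ℝ) = -inner ℝ (iotaTorsion conn ι x u w) (ι x v)
  /-- The almost co-CR structure `ℬ ⊕ (ker dp)^{0,1}`, with `ℬ` the horizontal lift of `ρ(σ)`, is
  `(dφ)⁻¹ (T^{0,1} Z)`; in particular, it is integrable. -/
  coCR : ∀ y, pullT01 EY (EZ := EZ) φ y =
    ((hor EY EM p y).baseChange ℂ ⊓ ((σ y).map ((ρ (p y)).baseChange ℂ)).comap
      ((mfderiv 𝓘(ℝ, EY) 𝓘(ℝ, EM) p y).toLinearMap.baseChange ℂ)) ⊔ vert01 EM EZ p φ y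
  coisotropic : ∀ y, IsCoisotropic (pullT01 EY (EZ := EZ) φ y)

/-- The complex structure `J` on `𝒦 = (ker dφ)^⊥` with respect to which `dφ|_𝒦` is complex linear
(composed with the orthogonal projection onto `𝒦`). -/
def Jφ (EZ : Type*) [NormedAddCommGroup EZ] [NormedSpace ℂ EZ]
    {Z : Type*} [TopologicalSpace Z] [ChartedSpace EZ Z] (φ : Y → Z) (y : Y) (u : TangentSpace 𝓘(ℝ, EY) y) :
    TangentSpace 𝓘(ℝ, EY) y :=
  horLift φ y (mulI (φ y) (mfderiv 𝓘(ℝ, EY) 𝓘(ℝ, EZ) φ y u))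

/-- `φ` pulls back holomorphic functions (defined on open subsets of `Z`) to harmonic functions. -/
def PullsBackHolomorphicToHarmonic (EY EZ : Type*)
    [NormedAddCommGroup EY] [NormedSpace ℝ EY] [FiniteDimensional ℝ EY]
    [NormedAddCommGroup EZ] [NormedSpace ℂ EZ]
    {Y : Type*} [TopologicalSpace Y] [ChartedSpace EY Y] [IsManifold 𝓘(ℝ, EY) ∞ Y]
    [RiemannianBundle (fun y : Y => TangentSpace 𝓘(ℝ, EY) y)]
    {Z : Type*} [TopologicalSpace Z] [ChartedSpace EZ Z] (φ : Y → Z) : Prop :=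
  ∀ (U : Set Z) (f : Z → ℂ), IsOpen U → MDifferentiableOn 𝓘(ℂ, EZ) 𝓘(ℂ, ℂ) f U →
    ∀ y : Y, φ y ∈ U → laplacian (E := EY) (fun y' => f (φ y')) y = 0

namespace RiemannianTwistorialStructure

variable [RiemannianBundle (fun x : M => TangentSpace 𝓘(ℝ, EM) x)]
  [FiniteDimensional ℂ EZ] [IsManifold 𝓘(ℂ, EZ) ω Z]
  {F : Type*} [NormedAddCommGroup F] [NormedSpace ℝ F] [FiniteDimensional ℝ F]
  {E : M → Type*} [TopologicalSpace (TotalSpace F E)]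
  [∀ x, NormedAddCommGroup (E x)] [∀ x, InnerProductSpace ℝ (E x)]
  [∀ x, FiniteDimensional ℝ (E x)] [FiberBundle F E] [VectorBundle ℝ F E]
  [ContMDiffVectorBundle ∞ F E 𝓘(ℝ, EM)] [IsContMDiffRiemannianBundle 𝓘(ℝ, EM) ∞ F E]
  {p : Y → M} {φ : Y → Z}

/-- The torsion `T` of the connection `ρ ∇` induced by `∇` on `M`, seen as a section of `ℋ ⊗ Λ² ℋ^*`
by means of the isomorphisms `dp : ℋ_y → T_{p(y)} M`. -/
def torsionH (S : RiemannianTwistorialStructure EY EM EZ F E p φ) (y : Y)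
    (u v : TangentSpace 𝓘(ℝ, EY) y) : TangentSpace 𝓘(ℝ, EY) y :=
  horLift p y (S.ρ (p y) (iotaTorsion S.conn S.ι (p y)
    (mfderiv 𝓘(ℝ, EY) 𝓘(ℝ, EM) p y u) (mfderiv 𝓘(ℝ, EY) 𝓘(ℝ, EM) p y v)))

/-- The trace, with respect to the Kähler form `ω` of `(ℋ ∩ 𝒦, J)`, of `I^ℋ + P_{ℋ ∩ 𝒦} T`; that
is, `∑ (I^ℋ + P_{ℋ ∩ 𝒦} T)(eᵢ, J eᵢ)`, with `(eᵢ)` an orthonormal basis of `ℋ ∩ 𝒦`. -/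
def traceω (S : RiemannianTwistorialStructure EY EM EZ F E p φ) (y : Y) :
    TangentSpace 𝓘(ℝ, EY) y :=
  ∑ i, (integrabilityTensor (hor EY EM p) y
      (stdOrthonormalBasis ℝ (hor EY EM p y ⊓ hor EY EZ φ y : Submodule ℝ _) i)
      (Jφ EZ φ y (stdOrthonormalBasis ℝ (hor EY EM p y ⊓ hor EY EZ φ y : Submodule ℝ _) i))
    + projT (hor EY EM p y ⊓ hor EY EZ φ y) (S.torsionH y
      (stdOrthonormalBasis ℝ (hor EY EM p y ⊓ hor EY EZ φ y : Submodule ℝ _) i)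
      (Jφ EZ φ y (stdOrthonormalBasis ℝ (hor EY EM p y ⊓ hor EY EZ φ y : Submodule ℝ _) i))))

end RiemannianTwistorialStructure

end Twistor

end Twistorial

/-! Let `g = f ∘ φ` with `f` holomorphic, so that `dg (J u) = i dg u`. Since 𝒞 = ℬ ⊕ (ker dp)^{0,1},
the space ker dφ is contained in ℋ, and coisotropy of 𝒞 makes `J` orthogonal on 𝒦 (`CoCRData`).
Hence TY is the orthogonal sum of ker dφ, ker dp and ℋ ∩ 𝒦, the last two being `J`-invariant, and
the trace of the Hessian of `g` is computed on each summand.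

The basic identity is `hess_add_hess`: Hess g(U,U) + Hess g(JU,JU) = -i dg[U,JU] - dg(∇_U U + ∇_{JU}
JU), with ∇ the Levi-Civita connection of Y.

On ker dφ, `dg` vanishes and only the mean curvature of the fibres of `φ` contributes, which is zero
(`sum_hess_ker`).

On ker dp, the fibres are totally geodesic and carry the metric induced by a holomorphic map into a
Grassmannian. They are therefore Kähler, in the form [U,JU] = J(∇_U U + ∇_{JU} JU), and the identity
gives zero (`mlieBracket_vert`, `hess_add_hess_vert`).

On ℋ ∩ 𝒦, coisotropy of `σ` puts the section s = ι dp(U) + i ι dp(JU) inside `σ`. As `σ` is parallel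
along ℋ, the derivative of s along U - iJU is again in `σ`. Its real part α lifts to ∇_U U + ∇_{JU}
JU, because total antisymmetry of the torsion removes it from the diagonal. Its imaginary part β
lifts to [U,JU] up to I^ℋ and T. Since lifts of vectors of `ρ(σ)` lie in 𝒞, dg(lift β) = i dg(lift
α), and what is left is -i dg((I^ℋ - T)(U,JU)) (`hess_add_hess_hor`).

Altogether Δ(f ∘ φ) = -(i/2) df(dφ(trace_ω(I^ℋ - T))) (`sum_hess_comp`). Functions of the form
"linear functional of a holomorphic chart" separate tangent vectors of Z, so (i) says that
dφ(trace_ω(I^ℋ - T)) = 0. As I^ℋ is vertical, P_{ℋ∩𝒦}T lies in ℋ ∩ 𝒦 and `dφ` is injective on 𝒦,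
both parts vanish separately, and the sign in front of T is immaterial: this is (ii)
(`mfderiv_traceIT_eq_zero_iff`).

For the last assertion, the tension of `φ` in a holomorphic chart is the same Laplacian, for the
vector valued chart, plus the trace of the Christoffel form on dφ. For a Kähler metric this form is
complex bilinear, so it cancels on each pair u, Ju. -/

namespace Twistorial

set_option linter.unusedSectionVars false

/-! ### Real and imaginary parts in complexified vector spaces -/

section ComplexLinear

variable {V W : Type*} [AddCommGroup V] [Module ℝ V] [AddCommGroup W] [Module ℝ W]

theorem exists_mkC (w : ℂ ⊗[ℝ] V) : ∃ a b, w = mkC a b := ⟨re w, im w, (mkC_re_im w).symm⟩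

theorem mkC_inj {a b c d : V} : mkC a b = mkC c d ↔ a = c ∧ b = d := by
  constructor
  · intro h
    have h1 := congrArg re h
    have h2 := congrArg im h
    rw [re_mkC, re_mkC] at h1
    rw [im_mkC, im_mkC] at h2
    exact ⟨h1, h2⟩
  · rintro ⟨rfl, rfl⟩
    rfl

theorem mkC_add (a b c d : V) : mkC a b + mkC c d = mkC (a + c) (b + d) := by
  simp only [mkC, TensorProduct.tmul_add]
  abel

theorem mkC_sub (a b c d : V) : mkC a b - mkC c d = mkC (a - c) (b - d) := by
  simp only [mkC, TensorProduct.tmul_sub]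
  abel

theorem mkC_zero : mkC (0 : V) 0 = 0 := by simp [mkC]

theorem mkC_eq_zero {a b : V} : mkC a b = 0 ↔ a = 0 ∧ b = 0 := by
  rw [← mkC_zero, mkC_inj]

theorem I_smul_mkC (a b : V) : Complex.I • mkC a b = mkC (-b) a := by
  simp only [mkC, smul_add, TensorProduct.smul_tmul', smul_eq_mul, mul_one, Complex.I_mul_I,
    TensorProduct.neg_tmul, TensorProduct.tmul_neg]
  abel

theorem real_smul_mkC (r : ℝ) (a b : V) : r • mkC a b = mkC (r • a) (r • b) := by
  simp only [mkC, smul_add, TensorProduct.tmul_smul]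

theorem one_tmul_eq_mkC (a : V) : (1 : ℂ) ⊗ₜ[ℝ] a = mkC a 0 := by simp [mkC]

theorem smul_mkC (z : ℂ) (a b : V) :
    z • mkC a b = mkC (z.re • a - z.im • b) (z.re • b + z.im • a) := by
  have h : z • mkC a b = z.re • mkC a b + z.im • (Complex.I • mkC a b) := by
    conv_lhs => rw [← Complex.re_add_im z, add_smul, mul_smul]
    exact congrArg₂ (· + ·) (algebraMap_smul ℂ z.re _) (algebraMap_smul ℂ z.im _)
  rw [h, I_smul_mkC, real_smul_mkC, real_smul_mkC, mkC_add]
  congr 1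
  rw [smul_neg, sub_eq_add_neg]

theorem baseChange_mkC (f : V →ₗ[ℝ] W) (a b : V) : f.baseChange ℂ (mkC a b) = mkC (f a) (f b) := by
  simp [mkC]

/-- The vectors whose real and imaginary parts lie in `S` form a complex subspace containing the
generators `1 ⊗ s`. -/
theorem mkC_mem_baseChange {S : Submodule ℝ V} {a b : V} :
    mkC a b ∈ S.baseChange ℂ ↔ a ∈ S ∧ b ∈ S := by
  constructor
  · intro h
    have key : ∀ w ∈ S.baseChange ℂ, re w ∈ S ∧ im w ∈ S := by
      intro w hw
      rw [Submodule.baseChange_eq_span] at hw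
      induction hw using Submodule.span_induction with
      | mem x hx =>
        obtain ⟨s, hs, rfl⟩ := hx
        change re ((1 : ℂ) ⊗ₜ[ℝ] s) ∈ S ∧ im ((1 : ℂ) ⊗ₜ[ℝ] s) ∈ S
        rw [one_tmul_eq_mkC, re_mkC, im_mkC]
        exact ⟨hs, S.zero_mem⟩
      | zero => simp
      | add x y _ _ hx hy =>
        rw [map_add, map_add]
        exact ⟨S.add_mem hx.1 hy.1, S.add_mem hx.2 hy.2⟩
      | smul z x _ hx =>
        rw [← mkC_re_im x, smul_mkC, re_mkC, im_mkC]
        exact ⟨S.sub_mem (S.smul_mem _ hx.1) (S.smul_mem _ hx.2),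
          S.add_mem (S.smul_mem _ hx.2) (S.smul_mem _ hx.1)⟩
    have := key _ h
    rwa [re_mkC, im_mkC] at this
  · rintro ⟨ha, hb⟩
    exact add_mem (Submodule.tmul_mem_baseChange_of_mem _ ha)
      (Submodule.tmul_mem_baseChange_of_mem _ hb)

end ComplexLinear

/-! ### The complex bilinear form in terms of real inner products -/

section ComplexEuclidean

variable {V : Type*} [NormedAddCommGroup V] [InnerProductSpace ℝ V]

theorem bilC_mkC (a b c d : V) : bilC V (mkC a b) (mkC c d) =
    ((inner ℝ a c - inner ℝ b d : ℝ) : ℂ) + ((inner ℝ a d + inner ℝ b c : ℝ) : ℂ) * Complex.I := by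
  simp only [bilC, mkC, map_add, LinearMap.add_apply, LinearMap.BilinForm.baseChange_tmul,
    innerₗ_apply_apply]
  push_cast
  simp
  ring

theorem bilC_mkC_eq_zero {a b c d : V} : bilC V (mkC a b) (mkC c d) = 0 ↔
    inner ℝ a c = inner ℝ b d ∧ (inner ℝ a d : ℝ) = - inner ℝ b c := by
  rw [bilC_mkC, Complex.ext_iff]
  simp [sub_eq_zero, add_eq_zero_iff_eq_neg]

/-- This is the form in which coisotropy is used: membership in the orthogonal is tested by two real
equations. -/
theorem mkC_mem_orthogonal {S : Submodule ℂ (ℂ ⊗[ℝ] V)} {a b : V} :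
    mkC a b ∈ (bilC V).orthogonal S ↔ ∀ c d, mkC c d ∈ S →
      inner ℝ a c = inner ℝ b d ∧ (inner ℝ a d : ℝ) = - inner ℝ b c := by
  rw [LinearMap.BilinForm.mem_orthogonal_iff]
  constructor
  · intro h c d hcd
    have := bilC_mkC_eq_zero.1 (h _ hcd)
    exact ⟨by rw [real_inner_comm, this.1, real_inner_comm],
      by rw [real_inner_comm, real_inner_comm c b, this.2, neg_neg]⟩
  · intro h n hn
    obtain ⟨c, d, rfl⟩ := exists_mkC n
    have := h c d hn
    refine bilC_mkC_eq_zero.2 ⟨?_, ?_⟩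
    · rw [real_inner_comm, real_inner_comm b d, this.1]
    · rw [real_inner_comm, real_inner_comm a d, this.2, neg_neg]

theorem inner_mkC (a b c d : V) :
    (inner ℝ (mkC a b) (mkC c d) : ℝ) = inner ℝ a c + inner ℝ b d := by
  simp [mkC, inner_add_left, inner_add_right]

end ComplexEuclidean

/-! ### Co-CR structures on Euclidean vector spaces -/

section CoCR

variable {T W : Type*} [NormedAddCommGroup T] [InnerProductSpace ℝ T] [FiniteDimensional ℝ T]
  [AddCommGroup W] [Module ℝ W]

/-- The linear data underlying a twistorial structure at a point: `A` is the differential of the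
submersion onto the complex manifold, `V` the vertical space, `B` the horizontal part of the
co-CR structure. -/
structure CoCRData (A : T →ₗ[ℝ] W) (j : W →ₗ[ℝ] W) (V : Submodule ℝ T)
    (C B N : Submodule ℂ (ℂ ⊗[ℝ] T)) (J : T → T) : Prop where
  j_sq : ∀ w, j (j w) = -w
  mem_C : ∀ a b, mkC a b ∈ C ↔ A b = j (A a)
  C_eq : C = B ⊔ N
  B_le : B ≤ Vᗮ.baseChange ℂ
  N_eq : N = Submodule.span ℂ {w | ∃ u ∈ V, ∃ v ∈ V, A v = j (A u) ∧ w = mkC u v}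
  inf_ker : V ⊓ LinearMap.ker A = ⊥
  j_mem : ∀ u ∈ V, ∃ v ∈ V, A v = j (A u)
  coisotropic : IsCoisotropic C
  J_mem : ∀ u, J u ∈ (LinearMap.ker A)ᗮ
  A_J : ∀ u, A (J u) = j (A u)

namespace CoCRData

variable {A : T →ₗ[ℝ] W} {j : W →ₗ[ℝ] W} {V : Submodule ℝ T}
    {C B N : Submodule ℂ (ℂ ⊗[ℝ] T)} {J : T → T} (h : CoCRData A j V C B N J)

include h

theorem N_le : N ≤ V.baseChange ℂ ⊓ C := by
  rw [h.N_eq, Submodule.span_le]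
  rintro w ⟨u, hu, v, hv, huv, rfl⟩
  exact ⟨mkC_mem_baseChange.2 ⟨hu, hv⟩, (h.mem_C _ _).2 huv⟩

theorem decomp {a b : T} (hab : A b = j (A a)) : ∃ u ∈ V, ∃ v ∈ V, ∃ c ∈ Vᗮ, ∃ d ∈ Vᗮ,
    mkC c d ∈ B ∧ A v = j (A u) ∧ a = c + u ∧ b = d + v := by
  have h1 : mkC a b ∈ B ⊔ N := by
    rw [← h.C_eq]
    exact (h.mem_C _ _).2 hab
  obtain ⟨β, hβ, ν, hν, hβν⟩ := Submodule.mem_sup.1 h1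
  obtain ⟨c, d, rfl⟩ := exists_mkC β
  obtain ⟨u, v, rfl⟩ := exists_mkC ν
  have h2 := mkC_mem_baseChange.1 (h.B_le hβ)
  have h3 := h.N_le hν
  have h4 := mkC_mem_baseChange.1 h3.1
  have h5 := (h.mem_C _ _).1 h3.2
  rw [mkC_add, mkC_inj] at hβν
  exact ⟨u, h4.1, v, h4.2, c, h2.1, d, h2.2, hβ, h5, hβν.1.symm, hβν.2.symm⟩

/-- A real `n` in the kernel is an element `n + i0` of `C`. Its imaginary part has zero vertical
component `v`, so the vertical component `u` of the real part satisfies `j (A u) = A v = 0`, whence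
`u ∈ V ⊓ ker A = 0`. -/
theorem ker_le : LinearMap.ker A ≤ Vᗮ := by
  intro n hn
  have hn' : A n = 0 := hn
  obtain ⟨u, hu, v, hv, c, hc, d, hd, -, huv, hna, hnb⟩ := h.decomp (a := n) (b := 0) (by
    rw [hn']; simp)
  have hv0 : v = 0 := by
    have : v ∈ V ⊓ Vᗮ := Submodule.mem_inf.2 ⟨hv, by
      rw [← neg_mem_iff]
      convert hd using 1
      exact neg_eq_of_add_eq_zero_left hnb.symm⟩
    simpa [Submodule.inf_orthogonal_eq_bot] using this
  have hu0 : u = 0 := by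
    have : u ∈ V ⊓ LinearMap.ker A := Submodule.mem_inf.2 ⟨hu, by
      have h6 : j (j (A u)) = 0 := by rw [← huv, hv0]; simp
      rw [h.j_sq] at h6
      simpa using h6⟩
    rw [h.inf_ker] at this
    simpa using this
  rw [hna, hu0, add_zero]
  exact hc

theorem le_orthogonal_ker : V ≤ (LinearMap.ker A)ᗮ := by
  rw [← V.orthogonal_orthogonal]
  exact Submodule.orthogonal_le h.ker_le

/-- `A` is injective on the orthogonal of its kernel. All the algebraic properties of `J` follow
from this characterization. -/
theorem eq_J {u k : T} (hk : k ∈ (LinearMap.ker A)ᗮ) (hu : A k = j (A u)) : k = J u := by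
  have h1 : k - J u ∈ LinearMap.ker A ⊓ (LinearMap.ker A)ᗮ :=
    ⟨by simp [hu, h.A_J], sub_mem hk (h.J_mem u)⟩
  rw [Submodule.inf_orthogonal_eq_bot] at h1
  exact sub_eq_zero.1 (by simpa using h1)

theorem J_add (u v : T) : J (u + v) = J u + J v :=
  (h.eq_J (add_mem (h.J_mem u) (h.J_mem v)) (by simp [h.A_J])).symm

theorem J_smul (r : ℝ) (u : T) : J (r • u) = r • J u :=
  (h.eq_J (Submodule.smul_mem _ r (h.J_mem u)) (by simp [h.A_J])).symm

theorem J_J {k : T} (hk : k ∈ (LinearMap.ker A)ᗮ) : J (J k) = -k :=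
  (h.eq_J (neg_mem hk) (by simp [h.A_J, h.j_sq])).symm

theorem J_ker {k : T} (hk : A k = 0) : J k = 0 :=
  (h.eq_J (zero_mem _) (by simp [hk])).symm

theorem J_vert {u : T} (hu : u ∈ V) : J u ∈ V := by
  obtain ⟨v, hv, hv'⟩ := h.j_mem u hu
  rwa [← h.eq_J (h.le_orthogonal_ker hv) hv']

omit h in
theorem exists_ker_add_orthogonal (A : T →ₗ[ℝ] W) (u : T) :
    ∃ n ∈ LinearMap.ker A, ∃ k ∈ (LinearMap.ker A)ᗮ, u = n + k :=
  Submodule.exists_add_mem_mem_orthogonal (K := LinearMap.ker A) u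

/-- Coisotropy forces `J J* = 1` on the orthogonal of the kernel. As `J² = -1` there, also `J* J =
1`. -/
theorem inner_J_J {k l : T} (hk : k ∈ (LinearMap.ker A)ᗮ) (_hl : l ∈ (LinearMap.ker A)ᗮ) :
    inner ℝ (J k) (J l) = (inner ℝ k l : ℝ) := by
  let Jl : T →ₗ[ℝ] T := ⟨⟨J, h.J_add⟩, h.J_smul⟩
  have hJl : ∀ u, Jl u = J u := fun _ => rfl
  have key : ∀ b ∈ (LinearMap.ker A)ᗮ, J (Jl.adjoint b) = b := by
    intro b hb
    have hs : Jl.adjoint b ∈ (LinearMap.ker A)ᗮ := by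
      intro n hn
      rw [LinearMap.adjoint_inner_right, hJl, h.J_ker hn, inner_zero_left]
    -- For `c + id` in `C` the component of `d` orthogonal to ker A is `J c`, so `⟨J* b, c⟩ = ⟨b, J
    -- c⟩ = ⟨b, d⟩`, and similarly for the other equation. Thus `J* b + ib` is orthogonal to `C`,
    -- hence in `C`, which reads `b = J (J* b)`.
    have h1 : mkC (Jl.adjoint b) b ∈ C := by
      apply h.coisotropic
      rw [mkC_mem_orthogonal]
      intro c d hcd
      have hcd' := (h.mem_C _ _).1 hcd
      obtain ⟨n, hn, k, hk, rfl⟩ := exists_ker_add_orthogonal A c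
      obtain ⟨m, hm, l, hl, rfl⟩ := exists_ker_add_orthogonal A d
      have hn' : A n = 0 := hn
      have hm' : A m = 0 := hm
      have hlk : l = J k := h.eq_J hl (by simpa [hn', hm'] using hcd')
      have e1 : J (n + k) = l := by rw [h.J_add, h.J_ker hn', zero_add, hlk]
      have e2 : J (m + l) = -k := by rw [h.J_add, h.J_ker hm', zero_add, hlk, h.J_J hk]
      rw [LinearMap.adjoint_inner_left, LinearMap.adjoint_inner_left, hJl, hJl, e1, e2,
        inner_add_right, inner_add_right, Submodule.inner_left_of_mem_orthogonal hm hb,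
        Submodule.inner_left_of_mem_orthogonal hn hb]
      simp
    exact (h.eq_J hb ((h.mem_C _ _).1 h1)).symm
  have h2 : Jl.adjoint (J k) = k := by
    have hs : Jl.adjoint (J k) ∈ (LinearMap.ker A)ᗮ := by
      intro n hn
      rw [LinearMap.adjoint_inner_right, hJl, h.J_ker hn, inner_zero_left]
    have h3 := congrArg J (key _ (h.J_mem k))
    rw [h.J_J hs, h.J_J hk] at h3
    exact neg_injective h3
  rw [← hJl l, ← LinearMap.adjoint_inner_left, h2]

theorem inner_J_left {k l : T} (hk : k ∈ (LinearMap.ker A)ᗮ) (hl : l ∈ (LinearMap.ker A)ᗮ) :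
    inner ℝ (J k) l = -(inner ℝ k (J l) : ℝ) := by
  rw [← h.inner_J_J hk (h.J_mem l), h.J_J hl, inner_neg_right, neg_neg]

/-- `J` is skew on the orthogonal of the kernel and preserves `V`, so it preserves the orthogonal of
`V` there. -/
theorem J_hor {u : T} (hu : u ∈ Vᗮ ⊓ (LinearMap.ker A)ᗮ) :
    J u ∈ Vᗮ ⊓ (LinearMap.ker A)ᗮ := by
  refine ⟨fun v hv => ?_, h.J_mem u⟩
  have h1 := h.inner_J_left (h.le_orthogonal_ker hv) hu.2
  rw [hu.1 _ (h.J_vert hv)] at h1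
  exact neg_eq_zero.1 h1.symm

theorem A_of_mem_B {a b : T} (hab : mkC a b ∈ B) : A b = j (A a) :=
  (h.mem_C _ _).1 (h.C_eq ▸ Submodule.mem_sup_left hab)

/-- The `(0,1)`-vectors of `(ker A)ᗮ` are orthogonal to the co-CR structure. -/
theorem mkC_J_mem_orthogonal {u : T} (hu : u ∈ (LinearMap.ker A)ᗮ) :
    mkC u (J u) ∈ (bilC T).orthogonal C := by
  rw [mkC_mem_orthogonal]
  intro c d hcd
  have hcd' := (h.mem_C _ _).1 hcd
  obtain ⟨n, hn, k, hk, rfl⟩ := exists_ker_add_orthogonal A c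
  obtain ⟨m, hm, l, hl, rfl⟩ := exists_ker_add_orthogonal A d
  have hn' : A n = 0 := hn
  have hm' : A m = 0 := hm
  have hlk : l = J k := h.eq_J hl (by simpa [hn', hm'] using hcd')
  rw [inner_add_right, inner_add_right, inner_add_right, inner_add_right,
    Submodule.inner_left_of_mem_orthogonal hm hu, Submodule.inner_left_of_mem_orthogonal hn hu,
    Submodule.inner_left_of_mem_orthogonal hn (h.J_mem u),
    Submodule.inner_left_of_mem_orthogonal hm (h.J_mem u), hlk, h.inner_J_J hu hk,
    h.inner_J_left hu hk]
  simp

end CoCRData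

end CoCR

open VectorField Filter Topology

/-! ### Chain and product rules for vector valued functions on manifolds -/

section MFDerivCalculus

variable {E : Type*} [NormedAddCommGroup E] [NormedSpace ℝ E]
  {M : Type*} [TopologicalSpace M] [ChartedSpace E M]
  {E' : Type*} [NormedAddCommGroup E'] [NormedSpace ℝ E']
  {M' : Type*} [TopologicalSpace M'] [ChartedSpace E' M']
  {G : Type*} [NormedAddCommGroup G] [NormedSpace ℝ G]
  {G' : Type*} [NormedAddCommGroup G'] [NormedSpace ℝ G']
  {G'' : Type*} [NormedAddCommGroup G''] [NormedSpace ℝ G'']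

theorem mvfderiv_congr {x : M} {f g : M → G} (h : f =ᶠ[𝓝 x] g) :
    mvfderiv 𝓘(ℝ, E) f x = mvfderiv 𝓘(ℝ, E) g x := by
  have h1 : mfderiv 𝓘(ℝ, E) 𝓘(ℝ, G) f x = mfderiv 𝓘(ℝ, E) 𝓘(ℝ, G) g x := h.mfderiv_eq
  exact h1

theorem mvfderiv_comp_mfderiv {x : M} {f : M → M'} {g : M' → G}
    (hg : MDifferentiableAt 𝓘(ℝ, E') 𝓘(ℝ, G) g (f x))
    (hf : MDifferentiableAt 𝓘(ℝ, E) 𝓘(ℝ, E') f x) (v : TangentSpace 𝓘(ℝ, E) x) :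
    mvfderiv 𝓘(ℝ, E) (fun x' => g (f x')) x v =
      mvfderiv 𝓘(ℝ, E') g (f x) (mfderiv 𝓘(ℝ, E) 𝓘(ℝ, E') f x v) :=
  mfderiv_comp_apply x hg hf v

theorem mvfderiv_comp_fderiv {x : M} {f : M → G} {g : G → G'} (hg : DifferentiableAt ℝ g (f x))
    (hf : MDifferentiableAt 𝓘(ℝ, E) 𝓘(ℝ, G) f x) (v : TangentSpace 𝓘(ℝ, E) x) :
    mvfderiv 𝓘(ℝ, E) (fun x' => g (f x')) x v = fderiv ℝ g (f x) (mvfderiv 𝓘(ℝ, E) f x v) := by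
  have h1 : mvfderiv 𝓘(ℝ, E) (fun x' => g (f x')) x v
      = mfderiv 𝓘(ℝ, G) 𝓘(ℝ, G') g (f x) (mfderiv 𝓘(ℝ, E) 𝓘(ℝ, G) f x v) :=
    mfderiv_comp_apply x hg.mdifferentiableAt hf v
  exact h1.trans (congrArg (fun L : G →L[ℝ] G' => L (mvfderiv 𝓘(ℝ, E) f x v))
    (mfderiv_eq_fderiv (f := g) (x := f x)))

theorem mvfderiv_clm {x : M} {f : M → G} (L : G →L[ℝ] G')
    (hf : MDifferentiableAt 𝓘(ℝ, E) 𝓘(ℝ, G) f x) (v : TangentSpace 𝓘(ℝ, E) x) :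
    mvfderiv 𝓘(ℝ, E) (fun x' => L (f x')) x v = L (mvfderiv 𝓘(ℝ, E) f x v) := by
  rw [mvfderiv_comp_fderiv L.differentiableAt hf, L.fderiv]

theorem mvfderiv_prodMk {x : M} {f : M → G} {g : M → G'}
    (hf : MDifferentiableAt 𝓘(ℝ, E) 𝓘(ℝ, G) f x) (hg : MDifferentiableAt 𝓘(ℝ, E) 𝓘(ℝ, G') g x)
    (v : TangentSpace 𝓘(ℝ, E) x) :
    mvfderiv 𝓘(ℝ, E) (fun x' => (f x', g x')) x v =
      (mvfderiv 𝓘(ℝ, E) f x v, mvfderiv 𝓘(ℝ, E) g x v) := by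
  have h := hf.prodMk_space hg
  have h1 := mvfderiv_clm (ContinuousLinearMap.fst ℝ G G') h v
  have h2 := mvfderiv_clm (ContinuousLinearMap.snd ℝ G G') h v
  exact Prod.ext h1.symm h2.symm

theorem mdifferentiableAt_bilin {x : M} {f : M → G} {g : M → G'} (B : G →L[ℝ] G' →L[ℝ] G'')
    (hf : MDifferentiableAt 𝓘(ℝ, E) 𝓘(ℝ, G) f x) (hg : MDifferentiableAt 𝓘(ℝ, E) 𝓘(ℝ, G') g x) :
    MDifferentiableAt 𝓘(ℝ, E) 𝓘(ℝ, G'') (fun x' => B (f x') (g x')) x := by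
  have h1 : DifferentiableAt ℝ (fun q : G × G' => B q.1 q.2) (f x, g x) :=
    (B.isBoundedBilinearMap).differentiableAt _
  exact h1.comp_mdifferentiableAt (f := fun x' => (f x', g x')) (x := x) (hf.prodMk_space hg)

theorem mvfderiv_bilin {x : M} {f : M → G} {g : M → G'} (B : G →L[ℝ] G' →L[ℝ] G'')
    (hf : MDifferentiableAt 𝓘(ℝ, E) 𝓘(ℝ, G) f x) (hg : MDifferentiableAt 𝓘(ℝ, E) 𝓘(ℝ, G') g x)
    (v : TangentSpace 𝓘(ℝ, E) x) :
    mvfderiv 𝓘(ℝ, E) (fun x' => B (f x') (g x')) x v =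
      B (mvfderiv 𝓘(ℝ, E) f x v) (g x) + B (f x) (mvfderiv 𝓘(ℝ, E) g x v) := by
  have h := hf.prodMk_space hg
  rw [mvfderiv_comp_fderiv (f := fun x' => (f x', g x')) (g := fun q : G × G' => B q.1 q.2)
    (B.isBoundedBilinearMap.differentiableAt _) h, mvfderiv_prodMk hf hg,
    B.isBoundedBilinearMap.fderiv]
  simp [add_comm]

end MFDerivCalculus

/-! ### Second derivatives and Lie brackets in a chart -/

section Calculus

variable {E : Type*} [NormedAddCommGroup E] [NormedSpace ℝ E] [FiniteDimensional ℝ E]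
  {M : Type*} [TopologicalSpace M] [ChartedSpace E M] [IsManifold 𝓘(ℝ, E) ∞ M]
  {G : Type*} [NormedAddCommGroup G] [NormedSpace ℝ G]

/-- The components of a vector field in the preferred chart at `x`. -/
def comps (x : M) (V : ∀ x : M, TangentSpace 𝓘(ℝ, E) x) (x' : M) : E :=
  (trivializationAt E (TangentSpace 𝓘(ℝ, E)) x ⟨x', V x'⟩).2

theorem mdifferentiableAt_comps {x : M} {V : ∀ x : M, TangentSpace 𝓘(ℝ, E) x}
    (hV : MDiffAt (T% V) x) : MDifferentiableAt 𝓘(ℝ, E) 𝓘(ℝ, E) (comps x V) x :=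
  (mdifferentiableAt_section _ _).1 hV

theorem comps_eq_mvfderiv {x x' : M} (V : ∀ x : M, TangentSpace 𝓘(ℝ, E) x)
    (hx : x' ∈ (chartAt E x).source) :
    comps x V x' = mvfderiv 𝓘(ℝ, E) (extChartAt 𝓘(ℝ, E) x) x' (V x') := by
  have h1 := TangentBundle.continuousLinearMapAt_trivializationAt (I := 𝓘(ℝ, E)) hx
  have h2 : (trivializationAt E (TangentSpace 𝓘(ℝ, E)) x).continuousLinearMapAt ℝ x' (V x') =
      mvfderiv 𝓘(ℝ, E) (extChartAt 𝓘(ℝ, E) x) x' (V x') := congrArg (fun L => L (V x')) h1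
  rw [← h2, Trivialization.continuousLinearMapAt_apply, Trivialization.linearMapAt_apply, if_pos]
  · rfl
  · simpa using hx

theorem mvfderiv_extChartAt_self (x : M) (v : TangentSpace 𝓘(ℝ, E) x) :
    mvfderiv 𝓘(ℝ, E) (extChartAt 𝓘(ℝ, E) x) x v = v :=
  congrArg (fun L => L v) (mfderiv_extChartAt_self (I := 𝓘(ℝ, E)) (x := x))

theorem comps_self (x : M) (V : ∀ x : M, TangentSpace 𝓘(ℝ, E) x) : comps x V x = V x := by
  rw [comps_eq_mvfderiv V (mem_chart_source E x)]
  exact mvfderiv_extChartAt_self x (V x)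

theorem mdifferentiableAt_extChartAt' {x x' : M} (hx : x' ∈ (chartAt E x).source) :
    MDifferentiableAt 𝓘(ℝ, E) 𝓘(ℝ, E) (extChartAt 𝓘(ℝ, E) x) x' :=
  mdifferentiableAt_extChartAt (I := 𝓘(ℝ, E)) (𝕜 := ℝ) (H := E) (E := E) hx

theorem mdifferentiableAt_extChartAt_symm {x x' : M} (hx : x' ∈ (chartAt E x).source) :
    MDifferentiableAt 𝓘(ℝ, E) 𝓘(ℝ, E) (extChartAt 𝓘(ℝ, E) x).symm (extChartAt 𝓘(ℝ, E) x x') := by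
  have := mdifferentiableWithinAt_extChartAt_symm (I := 𝓘(ℝ, E)) (x := x)
    ((extChartAt 𝓘(ℝ, E) x).map_source (by simpa using hx))
  rwa [modelWithCornersSelf_coe, Set.range_id, mdifferentiableWithinAt_univ] at this

theorem differentiableAt_chart {x x' : M} {f : M → G} (hx : x' ∈ (chartAt E x).source)
    (hf : MDifferentiableAt 𝓘(ℝ, E) 𝓘(ℝ, G) f x') :
    DifferentiableAt ℝ (f ∘ (extChartAt 𝓘(ℝ, E) x).symm) (extChartAt 𝓘(ℝ, E) x x') := by
  rw [← mdifferentiableAt_iff_differentiableAt]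
  refine MDifferentiableAt.comp _ ?_ (mdifferentiableAt_extChartAt_symm hx)
  rwa [(extChartAt 𝓘(ℝ, E) x).left_inv (by simpa using hx)]

theorem eventuallyEq_chart {x x' : M} (f : M → G) (hx : x' ∈ (chartAt E x).source) :
    f =ᶠ[𝓝 x'] fun z => (f ∘ (extChartAt 𝓘(ℝ, E) x).symm) (extChartAt 𝓘(ℝ, E) x z) := by
  filter_upwards [(isOpen_extChartAt_source (I := 𝓘(ℝ, E)) x).mem_nhds (by simpa using hx)]
    with z hz
  exact congrArg f ((extChartAt 𝓘(ℝ, E) x).left_inv hz).symm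

theorem mvfderiv_eq_fderiv_chart {x x' : M} {f : M → G} (hx : x' ∈ (chartAt E x).source)
    (hf : MDifferentiableAt 𝓘(ℝ, E) 𝓘(ℝ, G) f x') (V : ∀ x : M, TangentSpace 𝓘(ℝ, E) x) :
    mvfderiv 𝓘(ℝ, E) f x' (V x') =
      fderiv ℝ (f ∘ (extChartAt 𝓘(ℝ, E) x).symm) (extChartAt 𝓘(ℝ, E) x x') (comps x V x') := by
  rw [mvfderiv_congr (eventuallyEq_chart f hx),
    mvfderiv_comp_fderiv (differentiableAt_chart hx hf) (mdifferentiableAt_extChartAt' hx),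
    comps_eq_mvfderiv V hx]

theorem contDiffAt_chart {x : M} {f : M → G} {n : ℕ∞ω} (hf : ContMDiffAt 𝓘(ℝ, E) 𝓘(ℝ, G) n f x) :
    ContDiffAt ℝ n (f ∘ (extChartAt 𝓘(ℝ, E) x).symm) (extChartAt 𝓘(ℝ, E) x x) := by
  have := (contMDiffAt_iff.1 hf).2
  rwa [modelWithCornersSelf_coe, Set.range_id, contDiffWithinAt_univ] at this

theorem eventually_mdifferentiableAt {x : M} {f : M → G}
    (hf : ContMDiffAt 𝓘(ℝ, E) 𝓘(ℝ, G) 2 f x) :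
    ∀ᶠ x' in 𝓝 x, MDifferentiableAt 𝓘(ℝ, E) 𝓘(ℝ, G) f x' := by
  filter_upwards [(contMDiffAt_iff_contMDiffAt_nhds (by simp)).1 hf] with x' h
  exact h.mdifferentiableAt (by simp)

theorem mvfderiv_field_eventuallyEq {x : M} {f : M → G}
    (hf : ContMDiffAt 𝓘(ℝ, E) 𝓘(ℝ, G) 2 f x) (V : ∀ x : M, TangentSpace 𝓘(ℝ, E) x) :
    (fun x' => mvfderiv 𝓘(ℝ, E) f x' (V x')) =ᶠ[𝓝 x] fun x' =>
      fderiv ℝ (f ∘ (extChartAt 𝓘(ℝ, E) x).symm) (extChartAt 𝓘(ℝ, E) x x') (comps x V x') := by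
  filter_upwards [eventually_mdifferentiableAt hf, chart_source_mem_nhds E x] with x' h1 h2
  exact mvfderiv_eq_fderiv_chart h2 h1 V

theorem differentiableAt_fderiv_chart {x : M} {f : M → G}
    (hf : ContMDiffAt 𝓘(ℝ, E) 𝓘(ℝ, G) 2 f x) :
    DifferentiableAt ℝ (fderiv ℝ (f ∘ (extChartAt 𝓘(ℝ, E) x).symm)) (extChartAt 𝓘(ℝ, E) x x) :=
  ((contDiffAt_chart hf).fderiv_right (m := 1) (by norm_num)).differentiableAt (by simp)

theorem mdifferentiableAt_fderiv_chart {x : M} {f : M → G}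
    (hf : ContMDiffAt 𝓘(ℝ, E) 𝓘(ℝ, G) 2 f x) :
    MDifferentiableAt 𝓘(ℝ, E) 𝓘(ℝ, E →L[ℝ] G) (fun x' =>
      fderiv ℝ (f ∘ (extChartAt 𝓘(ℝ, E) x).symm) (extChartAt 𝓘(ℝ, E) x x')) x :=
  (differentiableAt_fderiv_chart hf).comp_mdifferentiableAt (f := extChartAt 𝓘(ℝ, E) x) (x := x)
    (mdifferentiableAt_extChartAt' (mem_chart_source E x))

theorem mdifferentiableAt_mvfderiv_field {x : M} {f : M → G}
    (hf : ContMDiffAt 𝓘(ℝ, E) 𝓘(ℝ, G) 2 f x) {V : ∀ x : M, TangentSpace 𝓘(ℝ, E) x}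
    (hV : MDiffAt (T% V) x) :
    MDifferentiableAt 𝓘(ℝ, E) 𝓘(ℝ, G) (fun x' => mvfderiv 𝓘(ℝ, E) f x' (V x')) x :=
  ((mdifferentiableAt_fderiv_chart hf).clm_apply (mdifferentiableAt_comps hV)).congr_of_eventuallyEq
    (mvfderiv_field_eventuallyEq hf V)

/-- In the chart at `x` the inner derivative is the Fréchet derivative of `f` applied to the
components of `V`. The Leibniz rule separates the second derivative, which is symmetric, from a
first order term. -/
theorem mvfderiv_mvfderiv_field {x : M} {f : M → G}
    (hf : ContMDiffAt 𝓘(ℝ, E) 𝓘(ℝ, G) 2 f x) {V : ∀ x : M, TangentSpace 𝓘(ℝ, E) x}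
    (hV : MDiffAt (T% V) x) (v : TangentSpace 𝓘(ℝ, E) x) :
    mvfderiv 𝓘(ℝ, E) (fun x' => mvfderiv 𝓘(ℝ, E) f x' (V x')) x v =
      fderiv ℝ (fderiv ℝ (f ∘ (extChartAt 𝓘(ℝ, E) x).symm)) (extChartAt 𝓘(ℝ, E) x x)
        v (V x) + mvfderiv 𝓘(ℝ, E) f x (mvfderiv 𝓘(ℝ, E) (comps x V) x v) := by
  rw [mvfderiv_congr (mvfderiv_field_eventuallyEq hf V)]
  have h1 := mvfderiv_bilin (ContinuousLinearMap.id ℝ (E →L[ℝ] G))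
    (mdifferentiableAt_fderiv_chart hf) (mdifferentiableAt_comps hV) v
  have h2 := mvfderiv_eq_fderiv_chart (mem_chart_source E x) (hf.mdifferentiableAt (by simp))
    (fun x' => (mvfderiv 𝓘(ℝ, E) (comps x V) x v : E))
  refine h1.trans ?_
  rw [h2]
  erw [comps_self, comps_self]
  rw [mvfderiv_comp_fderiv (differentiableAt_fderiv_chart hf)
    (mdifferentiableAt_extChartAt' (mem_chart_source E x)), mvfderiv_extChartAt_self]
  rfl

/-- The bracket is defined by pulling fields back through the inverse chart. These pull backs are
the component functions, and the chart has identity differential at its own base point. -/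
theorem mlieBracket_eq {x : M} {U V : ∀ x : M, TangentSpace 𝓘(ℝ, E) x}
    (hU : MDiffAt (T% U) x) (hV : MDiffAt (T% V) x) :
    mlieBracket 𝓘(ℝ, E) U V x =
      mvfderiv 𝓘(ℝ, E) (comps x V) x (U x) - mvfderiv 𝓘(ℝ, E) (comps x U) x (V x) := by
  let P : (∀ x : M, TangentSpace 𝓘(ℝ, E) x) → E → E := fun W =>
    mpullbackWithin 𝓘(ℝ, E) 𝓘(ℝ, E) (extChartAt 𝓘(ℝ, E) x).symm W (Set.range 𝓘(ℝ, E))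
  have key : ∀ W : ∀ x : M, TangentSpace 𝓘(ℝ, E) x,
      P W =ᶠ[𝓝 (extChartAt 𝓘(ℝ, E) x x)] comps x W ∘ (extChartAt 𝓘(ℝ, E) x).symm := by
    intro W
    filter_upwards [extChartAt_target_mem_nhds (I := 𝓘(ℝ, E)) x] with e he
    have hs : (extChartAt 𝓘(ℝ, E) x).symm e ∈ (chartAt E x).source := by
      simpa using (extChartAt 𝓘(ℝ, E) x).map_target he
    rw [Function.comp_apply, comps_eq_mvfderiv W hs]
    have h1 := ContinuousLinearMap.inverse_eq (mfderivWithin_extChartAt_symm_comp_mfderiv_extChartAt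
      (I := 𝓘(ℝ, E)) he) (mfderiv_extChartAt_comp_mfderivWithin_extChartAt_symm (I := 𝓘(ℝ, E)) he)
    exact congrArg (fun L : E →L[ℝ] E => L (W ((extChartAt 𝓘(ℝ, E) x).symm e))) h1
  have hd : ∀ W : ∀ x : M, TangentSpace 𝓘(ℝ, E) x, MDiffAt (T% W) x → ∀ v : E,
      fderiv ℝ (P W) (extChartAt 𝓘(ℝ, E) x x) v = mvfderiv 𝓘(ℝ, E) (comps x W) x v := by
    intro W hW v
    have h2 := mvfderiv_eq_fderiv_chart (mem_chart_source E x) (mdifferentiableAt_comps hW)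
      (fun x' => v)
    rw [h2]
    erw [comps_self]
    exact congrArg (fun L : E →L[ℝ] E => L v) (key W).fderiv_eq
  have h0 : (mfderiv 𝓘(ℝ, E) 𝓘(ℝ, E) (extChartAt 𝓘(ℝ, E) x) x).inverse =
      ContinuousLinearMap.id ℝ E := by
    rw [mfderiv_extChartAt_self]
    exact ContinuousLinearMap.inverse_id
  have hv : ∀ W : ∀ x : M, TangentSpace 𝓘(ℝ, E) x, P W (extChartAt 𝓘(ℝ, E) x x) = W x := by
    intro W
    refine (key W).self_of_nhds.trans ?_
    rw [Function.comp_apply, extChartAt_to_inv, comps_self]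
  have h1 : mlieBracket 𝓘(ℝ, E) U V x = lieBracketWithin ℝ (P U) (P V)
      ((extChartAt 𝓘(ℝ, E) x).symm ⁻¹' Set.univ ∩ Set.range 𝓘(ℝ, E))
      (extChartAt 𝓘(ℝ, E) x x) := by
    rw [← mlieBracketWithin_univ, mlieBracketWithin_apply]
    exact congrArg (fun L : E →L[ℝ] E => L _) h0
  rw [h1, modelWithCornersSelf_coe, Set.range_id, Set.inter_univ, Set.preimage_univ,
    lieBracketWithin_univ, lieBracket]
  erw [hv, hv, hd V hV, hd U hU]

/-- The symmetric second derivatives cancel. Only differentiability of the fields at the point is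
needed, which matters because projected and rotated fields are known to be no better. -/
theorem mvfderiv_mlieBracket {x : M} {f : M → G} (hf : ContMDiffAt 𝓘(ℝ, E) 𝓘(ℝ, G) 2 f x)
    {U V : ∀ x : M, TangentSpace 𝓘(ℝ, E) x} (hU : MDiffAt (T% U) x) (hV : MDiffAt (T% V) x) :
    mvfderiv 𝓘(ℝ, E) f x (mlieBracket 𝓘(ℝ, E) U V x) =
      mvfderiv 𝓘(ℝ, E) (fun x' => mvfderiv 𝓘(ℝ, E) f x' (V x')) x (U x)
      - mvfderiv 𝓘(ℝ, E) (fun x' => mvfderiv 𝓘(ℝ, E) f x' (U x')) x (V x) := by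
  have hs : IsSymmSndFDerivAt ℝ (f ∘ (extChartAt 𝓘(ℝ, E) x).symm) (extChartAt 𝓘(ℝ, E) x x) :=
    (contDiffAt_chart hf).isSymmSndFDerivAt (by simp)
  have hs' := hs.eq (U x) (V x)
  rw [mvfderiv_mvfderiv_field hf hU, mvfderiv_mvfderiv_field hf hV]
  erw [hs', mlieBracket_eq hU hV]
  refine (map_sub (mvfderiv 𝓘(ℝ, E) f x) _ _).trans ?_
  abel

end Calculus

/-! ### Traces and Parseval frames -/

section Parseval

variable {T : Type*} [NormedAddCommGroup T] [InnerProductSpace ℝ T]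
  {G : Type*} [AddCommGroup G] [Module ℝ G]

/-- A finite family of vectors of `N` which reproduces the elements of `N` in the same way as an
orthonormal basis does. -/
structure IsParseval {κ : Type*} [Fintype κ] (N : Submodule ℝ T) (w : κ → T) : Prop where
  mem : ∀ k, w k ∈ N
  sum_eq : ∀ u ∈ N, u = ∑ k, (inner ℝ (w k) u : ℝ) • w k

theorem OrthonormalBasis.isParseval {κ : Type*} [Fintype κ] (b : OrthonormalBasis κ ℝ T) :
    IsParseval ⊤ b :=
  ⟨fun _ => trivial, fun u _ => (b.sum_repr' u).symm⟩

theorem OrthonormalBasis.isParseval_coe {κ : Type*} [Fintype κ] {N : Submodule ℝ T}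
    (b : OrthonormalBasis κ ℝ N) : IsParseval N (fun k => (b k : T)) :=
  ⟨fun k => (b k).2, fun u hu => by
    have h := congrArg (Subtype.val) (b.sum_repr' ⟨u, hu⟩).symm
    rw [Submodule.coe_sum] at h
    exact h⟩

/-- Expand `w` in `e`, exchange the sums and resum. The two families may have different index types,
so no dimension count is needed when frames of subspaces are glued. -/
theorem IsParseval.sum_diag_eq {κ κ' : Type*} [Fintype κ] [Fintype κ'] {N : Submodule ℝ T}
    {w : κ → T} {e : κ' → T} (hw : IsParseval N w) (he : IsParseval N e) (B : T →ₗ[ℝ] T →ₗ[ℝ] G) :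
    ∑ k, B (w k) (w k) = ∑ i, B (e i) (e i) := by
  calc ∑ k, B (w k) (w k) = ∑ k, ∑ i, (inner ℝ (e i) (w k) : ℝ) • B (e i) (w k) := by
        refine Finset.sum_congr rfl fun k _ => ?_
        refine (congrArg (fun u => B u (w k)) (he.sum_eq _ (hw.mem k))).trans ?_
        simp only [map_sum, LinearMap.sum_apply, map_smul, LinearMap.smul_apply]
    _ = ∑ i, ∑ k, (inner ℝ (w k) (e i) : ℝ) • B (e i) (w k) := by
        rw [Finset.sum_comm]
        simp only [real_inner_comm]
    _ = ∑ i, B (e i) (e i) := by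
        refine Finset.sum_congr rfl fun i _ => ?_
        refine Eq.trans ?_ (congrArg (fun u => B (e i) u) (hw.sum_eq _ (he.mem i))).symm
        simp only [map_sum, map_smul]

theorem IsParseval.sumElim {κ κ' : Type*} [Fintype κ] [Fintype κ'] {N N' : Submodule ℝ T}
    {w : κ → T} {e : κ' → T} (hw : IsParseval N w) (he : IsParseval N' e) (hN : N ⟂ N') :
    IsParseval (N ⊔ N') (Sum.elim w e) := by
  refine ⟨fun k => ?_, fun u hu => ?_⟩
  · rcases k with k | k
    · exact Submodule.mem_sup_left (hw.mem k)
    · exact Submodule.mem_sup_right (he.mem k)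
  · obtain ⟨a, ha, b, hb, rfl⟩ := Submodule.mem_sup.1 hu
    have h1 : ∀ k, (inner ℝ (w k) b : ℝ) = 0 := fun k => hN.inner_eq (hw.mem k) hb
    have h2 : ∀ k, (inner ℝ (e k) a : ℝ) = 0 := fun k => hN.symm.inner_eq (he.mem k) ha
    simp only [Fintype.sum_sum_type, Sum.elim_inl, Sum.elim_inr, inner_add_right, h1, h2, add_zero,
      zero_add]
    rw [← hw.sum_eq a ha, ← he.sum_eq b hb]

/-- The image of a Parseval frame by an orthogonal complex structure. -/
theorem IsParseval.rotate {κ : Type*} [Fintype κ] {N : Submodule ℝ T} {w : κ → T}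
    (hw : IsParseval N w) (J : T →ₗ[ℝ] T) (hJ : ∀ u ∈ N, J u ∈ N) (hJJ : ∀ u ∈ N, J (J u) = -u)
    (hskew : ∀ u ∈ N, ∀ v ∈ N, (inner ℝ (J u) v : ℝ) = -inner ℝ u (J v)) :
    IsParseval N (fun k => J (w k)) := by
  refine ⟨fun k => hJ _ (hw.mem k), fun u hu => ?_⟩
  have h1 := congrArg J (hw.sum_eq _ (hJ u hu))
  rw [hJJ u hu, map_sum] at h1
  rw [← neg_inj, h1, ← Finset.sum_neg_distrib]
  refine Finset.sum_congr rfl fun k _ => ?_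
  rw [map_smul, hskew _ (hw.mem k) _ hu, neg_smul, neg_neg]

end Parseval

/-! ### The Levi-Civita connection -/

section LeviCivita

variable {E : Type*} [NormedAddCommGroup E] [NormedSpace ℝ E] [FiniteDimensional ℝ E]
  {M : Type*} [TopologicalSpace M] [ChartedSpace E M] [IsManifold 𝓘(ℝ, E) ∞ M]
  [RiemannianBundle (fun x : M => TangentSpace 𝓘(ℝ, E) x)]
  [IsContMDiffRiemannianBundle 𝓘(ℝ, E) ∞ E (fun x : M => TangentSpace 𝓘(ℝ, E) x)]
  {G : Type*} [NormedAddCommGroup G] [NormedSpace ℝ G]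

theorem mdifferentiableAt_inner {x : M} {X Y : ∀ x : M, TangentSpace 𝓘(ℝ, E) x}
    (hX : MDiffAt (T% X) x) (hY : MDiffAt (T% Y) x) :
    MDifferentiableAt 𝓘(ℝ, E) 𝓘(ℝ, ℝ) (fun x' => (inner ℝ (X x') (Y x') : ℝ)) x :=
  MDifferentiableAt.inner_bundle (E := fun x : M => TangentSpace 𝓘(ℝ, E) x) hX hY

theorem mvfderiv_inner_smul {x : M} {f : M → ℝ} {X Y : ∀ x : M, TangentSpace 𝓘(ℝ, E) x}
    (hf : MDifferentiableAt 𝓘(ℝ, E) 𝓘(ℝ, ℝ) f x)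
    (hX : MDiffAt (T% X) x) (hY : MDiffAt (T% Y) x) (v : TangentSpace 𝓘(ℝ, E) x) :
    mvfderiv 𝓘(ℝ, E) (fun x' => (inner ℝ ((f • X) x') (Y x') : ℝ)) x v =
      mvfderiv 𝓘(ℝ, E) f x v * inner ℝ (X x) (Y x)
        + f x * mvfderiv 𝓘(ℝ, E) (fun x' => (inner ℝ (X x') (Y x') : ℝ)) x v := by
  have h := mvfderiv_bilin (ContinuousLinearMap.mul ℝ ℝ) hf (mdifferentiableAt_inner hX hY) v
  simp only [ContinuousLinearMap.mul_apply'] at h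
  rw [← h]
  congr 2
  ext x'
  exact real_inner_smul_left _ _ _

theorem mvfderiv_inner_add {x : M} {X X' Y : ∀ x : M, TangentSpace 𝓘(ℝ, E) x}
    (hX : MDiffAt (T% X) x) (hX' : MDiffAt (T% X') x) (hY : MDiffAt (T% Y) x)
    (v : TangentSpace 𝓘(ℝ, E) x) :
    mvfderiv 𝓘(ℝ, E) (fun x' => (inner ℝ ((X + X') x') (Y x') : ℝ)) x v =
      mvfderiv 𝓘(ℝ, E) (fun x' => (inner ℝ (X x') (Y x') : ℝ)) x v
        + mvfderiv 𝓘(ℝ, E) (fun x' => (inner ℝ (X' x') (Y x') : ℝ)) x v := by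
  have h := congrArg (fun L => L v) (mvfderiv_add (I := 𝓘(ℝ, E)) (mdifferentiableAt_inner hX hY)
    (mdifferentiableAt_inner hX' hY))
  refine Eq.trans ?_ h
  congr 2
  ext x'
  exact inner_add_left _ _ _

theorem mvfderiv_inner_comm {x : M} (X Y : ∀ x : M, TangentSpace 𝓘(ℝ, E) x) :
    mvfderiv 𝓘(ℝ, E) (fun x' => (inner ℝ (X x') (Y x') : ℝ)) x =
      mvfderiv 𝓘(ℝ, E) (fun x' => (inner ℝ (Y x') (X x') : ℝ)) x := by
  simp only [real_inner_comm]

/-- The terms with derivatives of the factor `f` cancel: those of `Y⟨fX,Z⟩` against `[fX,Y]`, those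
of `Z⟨fX,Y⟩` against `[fX,Z]`. -/
theorem tensorialAt_koszul_left {x : M} {Y Z : ∀ x : M, TangentSpace 𝓘(ℝ, E) x}
    (hY : MDiffAt (T% Y) x) (hZ : MDiffAt (T% Z) x) :
    TensorialAt 𝓘(ℝ, E) E (fun X => koszul X Y Z x) x where
  smul {f X} hf hX := by
    simp only [koszul]
    rw [mvfderiv_inner_smul hf hX hZ, mvfderiv_inner_smul hf hX hY, mlieBracket_smul_left hf hX,
      mlieBracket_smul_left hf hX]
    simp only [Pi.smul_apply', map_smul, inner_add_left, inner_smul_left, inner_smul_right,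
      smul_eq_mul, conj_trivial, neg_smul, inner_neg_left]
    ring
  add {X X'} hX hX' := by
    simp only [koszul]
    rw [mvfderiv_inner_add hX hX' hZ, mvfderiv_inner_add hX hX' hY, mlieBracket_add_left hX hX',
      mlieBracket_add_left hX hX']
    simp only [Pi.add_apply, map_add, inner_add_left, inner_add_right]
    ring

theorem tensorialAt_koszul_right {x : M} {X Y : ∀ x : M, TangentSpace 𝓘(ℝ, E) x}
    (hX : MDiffAt (T% X) x) (hY : MDiffAt (T% Y) x) :
    TensorialAt 𝓘(ℝ, E) E (fun Z => koszul X Y Z x) x where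
  smul {f Z} hf hZ := by
    simp only [koszul]
    rw [mvfderiv_inner_comm Y, mvfderiv_inner_comm X (f • Z), mvfderiv_inner_smul hf hZ hY,
      mvfderiv_inner_smul hf hZ hX, mlieBracket_smul_right hf hZ, mlieBracket_smul_right hf hZ,
      mvfderiv_inner_comm Y Z, mvfderiv_inner_comm X Z]
    simp only [Pi.smul_apply', map_smul, inner_add_left, inner_smul_left, inner_smul_right,
      smul_eq_mul, conj_trivial, real_inner_comm]
    ring
  add {Z Z'} hZ hZ' := by
    simp only [koszul]
    rw [mvfderiv_inner_comm Y, mvfderiv_inner_comm X (Z + Z'), mvfderiv_inner_add hZ hZ' hY,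
      mvfderiv_inner_add hZ hZ' hX, mlieBracket_add_right hZ hZ', mlieBracket_add_right hZ hZ',
      mvfderiv_inner_comm Y Z, mvfderiv_inner_comm X Z, mvfderiv_inner_comm Y Z',
      mvfderiv_inner_comm X Z']
    simp only [Pi.add_apply, map_add, inner_add_left, inner_add_right]
    ring


variable {x : M} {X Y Z : ∀ x : M, TangentSpace 𝓘(ℝ, E) x}

theorem exists_koszul_form (hY : MDiffAt (T% Y) x) :
    ∃ K : TangentSpace 𝓘(ℝ, E) x →ₗ[ℝ] TangentSpace 𝓘(ℝ, E) x →ₗ[ℝ] ℝ,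
      ∀ X Z : ∀ x : M, TangentSpace 𝓘(ℝ, E) x, MDiffAt (T% X) x → MDiffAt (T% Z) x →
        K (X x) (Z x) = koszul X Y Z x := by
  let K := TensorialAt.mkHom₂ (I := 𝓘(ℝ, E)) (F := E) (F' := E) (fun X Z => koszul X Y Z x) x
    (fun Z hZ => tensorialAt_koszul_left hY hZ) (fun X hX => tensorialAt_koszul_right hX hY)
  refine ⟨(ContinuousLinearMap.coeLM ℝ).comp K.toLinearMap, fun X Z hX hZ => ?_⟩
  exact TensorialAt.mkHom₂_apply (I := 𝓘(ℝ, E)) (F := E) (F' := E) (fun Z hZ =>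
      tensorialAt_koszul_left hY hZ)
    (fun X hX => tensorialAt_koszul_right hX hY) hX hZ

/-- Tensoriality removes the arbitrary extensions from the definition of `leviCivita`, and
bilinearity replaces the orthonormal basis by any test vector. -/
theorem exists_koszul_form' (hY : MDiffAt (T% Y) x) :
    ∃ K : TangentSpace 𝓘(ℝ, E) x →ₗ[ℝ] TangentSpace 𝓘(ℝ, E) x →ₗ[ℝ] ℝ,
      (∀ X Z : ∀ x : M, TangentSpace 𝓘(ℝ, E) x, MDiffAt (T% X) x → MDiffAt (T% Z) x →
        K (X x) (Z x) = koszul X Y Z x) ∧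
      ∀ v z, inner ℝ (leviCivita Y x v) z = 1 / 2 * K v z := by
  obtain ⟨K, hK⟩ := exists_koszul_form hY
  refine ⟨K, hK, fun v z => ?_⟩
  have h1 : ∀ i, koszul (FiberBundle.extend E v) Y
      (FiberBundle.extend E (stdOrthonormalBasis ℝ (TangentSpace 𝓘(ℝ, E) x) i)) x =
      K v (stdOrthonormalBasis ℝ (TangentSpace 𝓘(ℝ, E) x) i) := by
    intro i
    rw [← hK _ _ (FiberBundle.mdifferentiableAt_extend ..) (FiberBundle.mdifferentiableAt_extend
        ..)]
    simp
  rw [leviCivita, sum_inner]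
  simp only [h1, real_inner_smul_left]
  conv_rhs => rw [← (stdOrthonormalBasis ℝ (TangentSpace 𝓘(ℝ, E) x)).sum_repr' z]
  rw [map_sum, Finset.mul_sum]
  refine Finset.sum_congr rfl fun i _ => ?_
  rw [map_smul, smul_eq_mul]
  ring

theorem inner_leviCivita (hX : MDiffAt (T% X) x) (hY : MDiffAt (T% Y) x) (hZ : MDiffAt (T% Z) x) :
    inner ℝ (leviCivita Y x (X x)) (Z x) = 1 / 2 * koszul X Y Z x := by
  obtain ⟨K, hK, h⟩ := exists_koszul_form' hY
  rw [h, hK X Z hX hZ]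

theorem leviCivita_add_dir (hY : MDiffAt (T% Y) x) (v w : TangentSpace 𝓘(ℝ, E) x) :
    leviCivita Y x (v + w) = leviCivita Y x v + leviCivita Y x w := by
  obtain ⟨K, hK, h⟩ := exists_koszul_form' hY
  refine ext_inner_right ℝ fun z => ?_
  rw [inner_add_left, h, h, h, map_add, LinearMap.add_apply, mul_add]

theorem leviCivita_smul_dir (hY : MDiffAt (T% Y) x) (r : ℝ) (v : TangentSpace 𝓘(ℝ, E) x) :
    leviCivita Y x (r • v) = r • leviCivita Y x v := by
  obtain ⟨K, hK, h⟩ := exists_koszul_form' hY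
  refine ext_inner_right ℝ fun z => ?_
  rw [real_inner_smul_left, h, h, map_smul, LinearMap.smul_apply, smul_eq_mul]
  ring

theorem leviCivita_torsion (hX : MDiffAt (T% X) x) (hY : MDiffAt (T% Y) x) :
    leviCivita Y x (X x) - leviCivita X x (Y x) = mlieBracket 𝓘(ℝ, E) X Y x := by
  refine ext_inner_right ℝ fun z => ?_
  have hZ : MDiffAt (T% (FiberBundle.extend E z)) x := FiberBundle.mdifferentiableAt_extend ..
  have hz : FiberBundle.extend E z x = z := by simp
  rw [inner_sub_left, ← hz, inner_leviCivita hX hY hZ, inner_leviCivita hY hX hZ, koszul, koszul,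
    mvfderiv_inner_comm Y X, mlieBracket_swap_apply (V := Y) (W := X), inner_neg_left]
  ring

theorem mvfderiv_inner (hX : MDiffAt (T% X) x) (hY : MDiffAt (T% Y) x)
    (v : TangentSpace 𝓘(ℝ, E) x) :
    mvfderiv 𝓘(ℝ, E) (fun x' => (inner ℝ (X x') (Y x') : ℝ)) x v =
      inner ℝ (leviCivita X x v) (Y x) + inner ℝ (X x) (leviCivita Y x v) := by
  have hV : MDiffAt (T% (FiberBundle.extend E v)) x := FiberBundle.mdifferentiableAt_extend ..
  have hv : FiberBundle.extend E v x = v := by simp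
  rw [← hv, real_inner_comm _ (X x), inner_leviCivita hV hX hY, inner_leviCivita hV hY hX, koszul,
    koszul, mvfderiv_inner_comm Y X, mlieBracket_swap_apply (V := Y) (W := X),
    inner_neg_left]
  ring

/-- Paired with a test field, metric compatibility reduces linearity in the field to that of the
derivative of inner products. -/
theorem leviCivita_add (hY : MDiffAt (T% Y) x) (hZ : MDiffAt (T% Z) x)
    (v : TangentSpace 𝓘(ℝ, E) x) :
    leviCivita (Y + Z) x v = leviCivita Y x v + leviCivita Z x v := by
  refine ext_inner_right ℝ fun z => ?_
  have hW : MDiffAt (T% (FiberBundle.extend E z)) x := FiberBundle.mdifferentiableAt_extend ..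
  have hz : FiberBundle.extend E z x = z := by simp
  have h1 := mvfderiv_inner hY hW v
  have h2 := mvfderiv_inner hZ hW v
  have h3 := mvfderiv_inner (mdifferentiableAt_add_section hY hZ) hW v
  rw [mvfderiv_inner_add hY hZ hW, h1, h2, Pi.add_apply, inner_add_left, hz] at h3
  rw [inner_add_left]
  linarith

theorem leviCivita_smul {f : M → ℝ} (hf : MDifferentiableAt 𝓘(ℝ, E) 𝓘(ℝ, ℝ) f x)
    (hY : MDiffAt (T% Y) x) (v : TangentSpace 𝓘(ℝ, E) x) :
    leviCivita (f • Y) x v = f x • leviCivita Y x v + mvfderiv 𝓘(ℝ, E) f x v • Y x := by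
  refine ext_inner_right ℝ fun z => ?_
  have hW : MDiffAt (T% (FiberBundle.extend E z)) x := FiberBundle.mdifferentiableAt_extend ..
  have hz : FiberBundle.extend E z x = z := by simp
  have h1 := mvfderiv_inner hY hW v
  have h3 := mvfderiv_inner (hf.smul_section hY) hW v
  rw [mvfderiv_inner_smul hf hY hW, h1, Pi.smul_apply', inner_smul_left, hz] at h3
  rw [inner_add_left, real_inner_smul_left, real_inner_smul_left]
  simp only [conj_trivial] at h3
  linarith

theorem leviCivita_congr (h : ∀ᶠ x' in 𝓝 x, Y x' = Z x') (v : TangentSpace 𝓘(ℝ, E) x) :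
    leviCivita Y x v = leviCivita Z x v := by
  have h1 : ∀ A B, koszul A Y B x = koszul A Z B x := by
    intro A B
    have hx := h.self_of_nhds
    have e1 : mvfderiv 𝓘(ℝ, E) (fun x' => (inner ℝ (Y x') (B x') : ℝ)) x =
        mvfderiv 𝓘(ℝ, E) (fun x' => (inner ℝ (Z x') (B x') : ℝ)) x :=
      mvfderiv_congr (h.mono fun x' hx' => by simp only [hx'])
    have e2 : mvfderiv 𝓘(ℝ, E) (fun x' => (inner ℝ (A x') (Y x') : ℝ)) x =
        mvfderiv 𝓘(ℝ, E) (fun x' => (inner ℝ (A x') (Z x') : ℝ)) x :=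
      mvfderiv_congr (h.mono fun x' hx' => by simp only [hx'])
    have e3 : mlieBracket 𝓘(ℝ, E) A Y x = mlieBracket 𝓘(ℝ, E) A Z x :=
      (EventuallyEq.refl _ A).mlieBracket_vectorField_eq h
    have e4 : mlieBracket 𝓘(ℝ, E) Y B x = mlieBracket 𝓘(ℝ, E) Z B x :=
      EventuallyEq.mlieBracket_vectorField_eq h (EventuallyEq.refl _ B)
    rw [koszul, koszul, e1, e2, e3, e4, hx]
  simp only [leviCivita, h1]

/-! ### The Hessian -/

/-- The Hessian of a function in terms of a vector field. -/
def hess (f : M → G) (V : ∀ x : M, TangentSpace 𝓘(ℝ, E) x) (x : M)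
    (u : TangentSpace 𝓘(ℝ, E) x) : G :=
  mvfderiv 𝓘(ℝ, E) (fun x' => mvfderiv 𝓘(ℝ, E) f x' (V x')) x u
    - mvfderiv 𝓘(ℝ, E) f x (leviCivita V x u)

variable {f : M → G}

/-- The Leibniz term of the outer derivative cancels the Leibniz term of the connection. -/
theorem tensorialAt_hess (hf : ContMDiffAt 𝓘(ℝ, E) 𝓘(ℝ, G) 2 f x) (u : TangentSpace 𝓘(ℝ, E) x) :
    TensorialAt 𝓘(ℝ, E) E (fun V => hess f V x u) x where
  smul {g V} hg hV := by
    have h := mvfderiv_bilin (ContinuousLinearMap.lsmul ℝ ℝ) hg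
      (mdifferentiableAt_mvfderiv_field hf hV) u
    simp only [ContinuousLinearMap.lsmul_apply] at h
    have e : (fun x' => mvfderiv 𝓘(ℝ, E) f x' ((g • V) x')) =
        fun x' => g x' • mvfderiv 𝓘(ℝ, E) f x' (V x') := by
      ext x'
      exact map_smul _ _ _
    simp only [hess]
    rw [e, h, leviCivita_smul hg hV, map_add, map_smul, map_smul]
    module
  add {V V'} hV hV' := by
    have h := congrArg (fun L => L u) (mvfderiv_add (I := 𝓘(ℝ, E))
      (mdifferentiableAt_mvfderiv_field hf hV) (mdifferentiableAt_mvfderiv_field hf hV'))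
    have e : (fun x' => mvfderiv 𝓘(ℝ, E) f x' ((V + V') x')) =
        (fun x' => mvfderiv 𝓘(ℝ, E) f x' (V x')) + fun x' => mvfderiv 𝓘(ℝ, E) f x' (V' x') := by
      ext x'
      exact map_add _ _ _
    simp only [hess]
    rw [e, h, leviCivita_add hV hV', map_add, _root_.add_apply]
    abel

/-- Because the Hessian is a bilinear form, its trace may be computed in any frame and each entry
with any convenient field through the given vector. -/
theorem exists_hessian (hf : ContMDiffAt 𝓘(ℝ, E) 𝓘(ℝ, G) 2 f x) :
    ∃ B : TangentSpace 𝓘(ℝ, E) x →ₗ[ℝ] TangentSpace 𝓘(ℝ, E) x →ₗ[ℝ] G,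
      ∀ V : ∀ x : M, TangentSpace 𝓘(ℝ, E) x, MDiffAt (T% V) x → ∀ u, B u (V x) = hess f V x u := by
  refine ⟨LinearMap.mk₂ ℝ (fun u v => hess f (FiberBundle.extend E v) x u) ?_ ?_ ?_ ?_, ?_⟩
  · intro u u' v
    simp only [hess]
    rw [map_add, leviCivita_add_dir (FiberBundle.mdifferentiableAt_extend ..), map_add]
    abel
  · intro r u v
    simp only [hess]
    rw [map_smul, leviCivita_smul_dir (FiberBundle.mdifferentiableAt_extend ..), map_smul, smul_sub]
  · intro u v v'
    have h := tensorialAt_hess hf u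
    rw [← h.add (FiberBundle.mdifferentiableAt_extend ..) (FiberBundle.mdifferentiableAt_extend ..)]
    exact h.pointwise (FiberBundle.mdifferentiableAt_extend ..)
      (mdifferentiableAt_add_section (FiberBundle.mdifferentiableAt_extend ..)
          (FiberBundle.mdifferentiableAt_extend ..))
      (by simp)
  · intro r u v
    have h := tensorialAt_hess hf u
    rw [← h.smul (f := fun _ => r) mdifferentiableAt_const (FiberBundle.mdifferentiableAt_extend
        ..)]
    exact h.pointwise (FiberBundle.mdifferentiableAt_extend ..)
      (mdifferentiableAt_const.smul_section (FiberBundle.mdifferentiableAt_extend ..)) (by simp)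
  · intro V hV u
    exact (tensorialAt_hess hf u).pointwise (FiberBundle.mdifferentiableAt_extend ..) hV (by simp)

end LeviCivita

/-! ### Differentiability of solutions of linear systems -/

section LinearSystem

variable {EY : Type*} [NormedAddCommGroup EY] [NormedSpace ℝ EY]
  {Y : Type*} [TopologicalSpace Y] [ChartedSpace EY Y]
  {G : Type*} [NormedAddCommGroup G] [NormedSpace ℝ G] [FiniteDimensional ℝ G]
  {G' : Type*} [NormedAddCommGroup G'] [NormedSpace ℝ G'] [FiniteDimensional ℝ G']

theorem mdifferentiableAt_clm_of_apply {y₀ : Y} {L : Y → G →L[ℝ] G'}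
    (hL : ∀ b, MDifferentiableAt 𝓘(ℝ, EY) 𝓘(ℝ, G') (fun y => L y b) y₀) :
    MDifferentiableAt 𝓘(ℝ, EY) 𝓘(ℝ, G →L[ℝ] G') L y₀ := by
  let b := Module.finBasis ℝ G
  have h : L = fun y => ∑ i, ContinuousLinearMap.smulRightL ℝ G G'
      (LinearMap.toContinuousLinearMap (b.coord i)) (L y (b i)) := by
    ext y v
    conv_lhs => rw [← b.sum_repr v, map_sum]
    simp [_root_.sum_apply, map_smul, Module.Basis.coord_apply]
  rw [h]
  have : ∀ s : Finset (Fin (Module.finrank ℝ G)),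
      MDifferentiableAt 𝓘(ℝ, EY) 𝓘(ℝ, G →L[ℝ] G') (fun y => ∑ i ∈ s,
        ContinuousLinearMap.smulRightL ℝ G G'
          (LinearMap.toContinuousLinearMap (b.coord i)) (L y (b i))) y₀ := by
    intro s
    induction s using Finset.induction_on with
    | empty => simpa using mdifferentiableAt_const
    | insert i s hi ih =>
      simp only [Finset.sum_insert hi]
      exact ((ContinuousLinearMap.differentiableAt _).comp_mdifferentiableAt (hL (b i))).add ih
  exact this Finset.univ

theorem mdifferentiableAt_pi_of_apply {κ : Type*} [Fintype κ] {y₀ : Y} {x : Y → κ → ℝ}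
    (h : ∀ i, MDifferentiableAt 𝓘(ℝ, EY) 𝓘(ℝ, ℝ) (fun y => x y i) y₀) :
    MDifferentiableAt 𝓘(ℝ, EY) 𝓘(ℝ, κ → ℝ) x y₀ := by
  classical
  have h1 : x = fun y => ∑ i, ContinuousLinearMap.single ℝ (fun _ : κ => ℝ) i (x y i) := by
    funext y
    exact (LinearMap.sum_single_apply (fun _ : κ => ℝ) (x y)).symm
  rw [h1]
  have : ∀ s : Finset κ, MDifferentiableAt 𝓘(ℝ, EY) 𝓘(ℝ, κ → ℝ)
      (fun y => ∑ i ∈ s, ContinuousLinearMap.single ℝ (fun _ : κ => ℝ) i (x y i)) y₀ := by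
    intro s
    induction s using Finset.induction_on with
    | empty => simpa using mdifferentiableAt_const
    | insert i s hi ih =>
      simp only [Finset.sum_insert hi]
      exact ((ContinuousLinearMap.differentiableAt _).comp_mdifferentiableAt (h i)).add ih
  exact this Finset.univ

/-- `L y₀` is invertible by the dimension count, hence so is `L y` for nearby `y`. There `x = L⁻¹
r`, and operator inversion is differentiable. -/
theorem mdifferentiableAt_of_linear_system {y₀ : Y} {L : Y → G →ₗ[ℝ] G'} {x : Y → G}
    (hL : ∀ b, MDifferentiableAt 𝓘(ℝ, EY) 𝓘(ℝ, G') (fun y => L y b) y₀)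
    (hdim : Module.finrank ℝ G = Module.finrank ℝ G') (hinj : ∀ a, L y₀ a = 0 → a = 0)
    {r : Y → G'} (hr : MDifferentiableAt 𝓘(ℝ, EY) 𝓘(ℝ, G') r y₀)
    (hx : ∀ᶠ y in 𝓝 y₀, L y (x y) = r y) :
    MDifferentiableAt 𝓘(ℝ, EY) 𝓘(ℝ, G) x y₀ := by
  let Λ : Y → G →L[ℝ] G' := fun y => LinearMap.toContinuousLinearMap (L y)
  have hΛ : MDifferentiableAt 𝓘(ℝ, EY) 𝓘(ℝ, G →L[ℝ] G') Λ y₀ :=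
    mdifferentiableAt_clm_of_apply hL
  let e : G ≃L[ℝ] G' := (LinearEquiv.ofInjectiveOfFinrankEq (L y₀)
    ((injective_iff_map_eq_zero _).2 hinj) hdim).toContinuousLinearEquiv
  have he : Λ y₀ = (e : G →L[ℝ] G') := by
    ext a
    rfl
  have : CompleteSpace G := FiniteDimensional.complete ℝ G
  have hinv : DifferentiableAt ℝ (ContinuousLinearMap.inverse : (G →L[ℝ] G') → _) (Λ y₀) := by
    rw [he]
    exact ((contDiffAt_map_inverse (n := 1) e).differentiableAt (by simp))
  have h1 : MDifferentiableAt 𝓘(ℝ, EY) 𝓘(ℝ, G' →L[ℝ] G) (fun y => (Λ y).inverse) y₀ :=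
    hinv.comp_mdifferentiableAt hΛ
  refine (h1.clm_apply hr).congr_of_eventuallyEq ?_
  have h2 : ∀ᶠ y in 𝓝 y₀, Λ y ∈ Set.range ((↑) : (G ≃L[ℝ] G') → G →L[ℝ] G') := by
    refine hΛ.continuousAt.eventually (p := fun l => l ∈ Set.range ((↑) : (G ≃L[ℝ] G') → G →L[ℝ]
        G')) ?_
    rw [he]
    exact ContinuousLinearEquiv.nhds e
  filter_upwards [h2, hx] with y ⟨e', he'⟩ hy
  rw [← he', ContinuousLinearMap.inverse_equiv, ← hy]
  have : L y (x y) = e' (x y) := by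
    have := congrArg (fun l : G →L[ℝ] G' => l (x y)) he'
    exact this.symm
  rw [this]
  simp

end LinearSystem

section TangentFrame

variable {EY : Type*} [NormedAddCommGroup EY] [NormedSpace ℝ EY] [FiniteDimensional ℝ EY]
  {Y : Type*} [TopologicalSpace Y] [ChartedSpace EY Y] [IsManifold 𝓘(ℝ, EY) ∞ Y]

/-- The trivialization at `y₀` is the identity on the tangent space at `y₀`, so the extension has
constant components `v`. -/
theorem extend_eq_symm {y₀ : Y} (v : TangentSpace 𝓘(ℝ, EY) y₀) :
    FiberBundle.extend EY v =
      fun y => (trivializationAt EY (TangentSpace 𝓘(ℝ, EY)) y₀).symm y v := by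
  funext y
  have h1 : (trivializationAt EY (TangentSpace 𝓘(ℝ, EY)) y₀ ⟨y₀, v⟩).2 = v := by
    have h2 := comps_self y₀ (FiberBundle.extend EY v)
    rw [comps, FiberBundle.extend_apply_self] at h2
    exact h2
  exact congrArg ((trivializationAt EY (TangentSpace 𝓘(ℝ, EY)) y₀).symm y) h1

end TangentFrame

/-! ### Differentiability of orthogonal projections and horizontal lifts -/

section Horizontal

variable {EY : Type*} [NormedAddCommGroup EY] [NormedSpace ℝ EY] [FiniteDimensional ℝ EY]
  {Y : Type*} [TopologicalSpace Y] [ChartedSpace EY Y] [IsManifold 𝓘(ℝ, EY) ∞ Y]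
  [RiemannianBundle (fun y : Y => TangentSpace 𝓘(ℝ, EY) y)]
  [IsContMDiffRiemannianBundle 𝓘(ℝ, EY) ∞ EY (fun y : Y => TangentSpace 𝓘(ℝ, EY) y)]
  {G : Type*} [NormedAddCommGroup G] [NormedSpace ℝ G] [FiniteDimensional ℝ G]

/-- Lagrange multipliers: orthogonality to ker dq means `⟨X, ·⟩ = -l ∘ dq` for some `l`. With `dq X`
prescribed, the pair `(X, l)` solves a linear system with differentiable coefficients that is
nondegenerate at `y₀`. -/
theorem mdifferentiableAt_of_mem_ker_orthogonal {y₀ : Y} {q : Y → G}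
    (hq : ContMDiffAt 𝓘(ℝ, EY) 𝓘(ℝ, G) 2 q y₀)
    (hsurj : Function.Surjective (mvfderiv 𝓘(ℝ, EY) q y₀))
    {X : ∀ y : Y, TangentSpace 𝓘(ℝ, EY) y}
    (hX : ∀ᶠ y in 𝓝 y₀, ∀ u, mvfderiv 𝓘(ℝ, EY) q y u = 0 → (inner ℝ (X y) u : ℝ) = 0)
    (hqX : MDifferentiableAt 𝓘(ℝ, EY) 𝓘(ℝ, G) (fun y => mvfderiv 𝓘(ℝ, EY) q y (X y)) y₀) :
    MDiffAt (T% X) y₀ := by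
  let e := trivializationAt EY (TangentSpace 𝓘(ℝ, EY)) y₀
  let b := Module.finBasis ℝ EY
  let fr : ∀ y : Y, EY →ₗ[ℝ] TangentSpace 𝓘(ℝ, EY) y := fun y => e.symmₗ ℝ y
  have hbase : ∀ᶠ y in 𝓝 y₀, y ∈ e.baseSet :=
    e.open_baseSet.mem_nhds (FiberBundle.mem_baseSet_trivializationAt' y₀)
  have hfr : ∀ c : EY, MDiffAt (T% (fun y => fr y c)) y₀ := by
    intro c
    have h1 := FiberBundle.mdifferentiableAt_extend 𝓘(ℝ, EY) EY
      (show TangentSpace 𝓘(ℝ, EY) y₀ from c)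
    refine h1.congr_of_eventuallyEq (hbase.mono fun y hy => ?_)
    have h2 : fr y c = FiberBundle.extend EY (show TangentSpace 𝓘(ℝ, EY) y₀ from c) y := by
      rw [extend_eq_symm]
      exact congrFun (e.coe_symmₗ hy) c
    exact congrArg (fun w => TotalSpace.mk' EY y w) h2
  have hfrX : ∀ y ∈ e.baseSet, fr y (comps y₀ X y) = X y := by
    intro y hy
    exact (congrFun (e.coe_symmₗ hy) _).trans (e.symm_apply_apply_mk hy (X y))
  -- The unknowns are the components `a` of the field and the multiplier `l`. The first block tests
  -- the multiplier equation on a frame, the second is `dq`.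
  let L : Y → (EY × (G →L[ℝ] ℝ)) →ₗ[ℝ] ((Fin (Module.finrank ℝ EY) → ℝ) × G) := fun y =>
    LinearMap.prod
      (LinearMap.pi fun i =>
        (((innerₗ (TangentSpace 𝓘(ℝ, EY) y)).flip (fr y (b i))).comp (fr y)).coprod
        ((ContinuousLinearMap.apply ℝ ℝ (mvfderiv 𝓘(ℝ, EY) q y (fr y (b i)))).toLinearMap))
      (((mvfderiv 𝓘(ℝ, EY) q y).toLinearMap.comp (fr y)).comp (LinearMap.fst ℝ _ _))
  have hL1 : ∀ y a l i, (L y (a, l)).1 i =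
      (inner ℝ (fr y a) (fr y (b i)) : ℝ) + l (mvfderiv 𝓘(ℝ, EY) q y (fr y (b i))) :=
    fun y a l i => rfl
  have hL2 : ∀ y a l, (L y (a, l)).2 = mvfderiv 𝓘(ℝ, EY) q y (fr y a) := fun y a l => rfl
  have hdq : ∀ c, MDifferentiableAt 𝓘(ℝ, EY) 𝓘(ℝ, G)
      (fun y => mvfderiv 𝓘(ℝ, EY) q y (fr y c)) y₀ :=
    fun c => mdifferentiableAt_mvfderiv_field hq (hfr c)
  have hlam : ∀ᶠ y in 𝓝 y₀, ∃ l : G →L[ℝ] ℝ, ∀ u,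
      (inner ℝ (X y) u : ℝ) = -l (mvfderiv 𝓘(ℝ, EY) q y u) := by
    filter_upwards [hX] with y hy
    have h1 : innerₗ (TangentSpace 𝓘(ℝ, EY) y) (X y) ∈
        (LinearMap.ker (mvfderiv 𝓘(ℝ, EY) q y).toLinearMap).dualAnnihilator := by
      rw [Submodule.mem_dualAnnihilator]
      exact fun u hu => hy u hu
    rw [← LinearMap.range_dualMap_eq_dualAnnihilator_ker] at h1
    obtain ⟨l, hl⟩ := h1
    refine ⟨-LinearMap.toContinuousLinearMap l, fun u => ?_⟩
    have h2 := congrArg (fun k => k u) hl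
    refine h2.symm.trans ?_
    simp
  -- The multiplier is chosen pointwise, with no regularity; its differentiability is part of the
  -- conclusion about the linear system.
  let lam : Y → (G →L[ℝ] ℝ) := fun y => by
    classical
    exact if h : ∃ l : G →L[ℝ] ℝ, ∀ u, (inner ℝ (X y) u : ℝ) = -l (mvfderiv 𝓘(ℝ, EY) q y u)
      then h.choose else 0
  have hlam' : ∀ᶠ y in 𝓝 y₀, ∀ u, (inner ℝ (X y) u : ℝ) = -lam y (mvfderiv 𝓘(ℝ, EY) q y u) := by
    filter_upwards [hlam] with y hy
    simp only [lam, dif_pos hy]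
    exact hy.choose_spec
  suffices key : MDifferentiableAt 𝓘(ℝ, EY) 𝓘(ℝ, EY × (G →L[ℝ] ℝ))
      (fun y => (comps y₀ X y, lam y)) y₀ from
    (mdifferentiableAt_section _ _).2 (DifferentiableAt.comp_mdifferentiableAt
      (g := Prod.fst) (f := fun y => (comps y₀ X y, lam y)) (x := y₀) differentiableAt_fst key)
  refine mdifferentiableAt_of_linear_system (L := L)
    (r := fun y => (0, mvfderiv 𝓘(ℝ, EY) q y (X y))) ?_ ?_ ?_ ?_ ?_
  · rintro ⟨a, l⟩
    refine MDifferentiableAt.prodMk_space (mdifferentiableAt_pi_of_apply fun i => ?_) ?_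
    · exact (mdifferentiableAt_inner (hfr a) (hfr (b i))).add
        (l.differentiableAt.comp_mdifferentiableAt (hdq (b i)))
    · exact hdq a
  · rw [Module.finrank_prod, Module.finrank_prod, Module.finrank_fin_fun,
      ← (LinearMap.toContinuousLinearMap (𝕜 := ℝ) (E := G) (F' := ℝ)).finrank_eq]
    have := Subspace.dual_finrank_eq (K := ℝ) (V := G)
    exact congrArg _ this
  · rintro ⟨a, l⟩ h
    have hb0 := FiberBundle.mem_baseSet_trivializationAt' (F := EY) (E := TangentSpace 𝓘(ℝ, EY)) y₀
    have h1 : ∀ i, (inner ℝ (fr y₀ a) (fr y₀ (b i)) : ℝ)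
        + l (mvfderiv 𝓘(ℝ, EY) q y₀ (fr y₀ (b i))) = 0 := fun i => by
      rw [← hL1, h]; rfl
    have h2 : mvfderiv 𝓘(ℝ, EY) q y₀ (fr y₀ a) = 0 := by
      rw [← hL2 y₀ a l, h]; rfl
    have hfs : ∀ u : TangentSpace 𝓘(ℝ, EY) y₀, ∃ c, fr y₀ c = u := fun u =>
      ⟨_, (congrFun (e.coe_symmₗ hb0) _).trans (e.symm_apply_apply_mk hb0 u)⟩
    have h3 : ∀ c, (inner ℝ (fr y₀ a) (fr y₀ c) : ℝ)
        + l (mvfderiv 𝓘(ℝ, EY) q y₀ (fr y₀ c)) = 0 := by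
      let Φ : EY →ₗ[ℝ] ℝ := (innerₗ (TangentSpace 𝓘(ℝ, EY) y₀) (fr y₀ a)).comp (fr y₀)
        + l.toLinearMap.comp ((mvfderiv 𝓘(ℝ, EY) q y₀).toLinearMap.comp (fr y₀))
      have hΦ : Φ = 0 := b.ext fun i => h1 i
      exact fun c => congrArg (fun k => k c) hΦ
    -- Tested on the vector itself, which is in the kernel of `dq`, the multiplier equation says
    -- that its norm is zero.
    have h4 : fr y₀ a = 0 := by
      have := h3 a
      rw [h2, map_zero, add_zero] at this
      exact inner_self_eq_zero.1 this
    have h5 : l = 0 := by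
      ext g
      obtain ⟨u, rfl⟩ := hsurj g
      obtain ⟨c, rfl⟩ := hfs u
      have := h3 c
      rw [h4, inner_zero_left, zero_add] at this
      simpa using this
    have h6 : a = 0 := by
      have h7 : (e ⟨y₀, fr y₀ a⟩).2 = a := by
        have := e.apply_mk_symm hb0 a
        rw [← e.coe_symmₗ (R := ℝ) hb0] at this
        exact congrArg Prod.snd this
      rw [← h7, h4]
      exact comps_self y₀ (fun _ => 0)
    rw [h5, h6]; rfl
  · exact mdifferentiableAt_const.prodMk_space hqX
  · filter_upwards [hlam', hbase] with y hy hb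
    refine Prod.ext (funext fun i => ?_) ?_
    · rw [hL1, hfrX y hb, hy]
      simp
    · rw [hL2, hfrX y hb]


variable {EM : Type*} [NormedAddCommGroup EM] [NormedSpace ℝ EM]
  {M : Type*} [TopologicalSpace M] [ChartedSpace EM M]

theorem projT_mem {y : Y} (D : Submodule ℝ (TangentSpace 𝓘(ℝ, EY) y))
    (v : TangentSpace 𝓘(ℝ, EY) y) : projT D v ∈ D := by
  have : CompleteSpace D := FiniteDimensional.complete ℝ D
  exact D.starProjection_apply_mem v

theorem sub_projT_mem {y : Y} (D : Submodule ℝ (TangentSpace 𝓘(ℝ, EY) y))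
    (v : TangentSpace 𝓘(ℝ, EY) y) : v - projT D v ∈ Dᗮ := by
  have : CompleteSpace D := FiniteDimensional.complete ℝ D
  exact D.sub_starProjection_mem_orthogonal v

theorem projT_eq_of_mem {y : Y} {D : Submodule ℝ (TangentSpace 𝓘(ℝ, EY) y)}
    {v w : TangentSpace 𝓘(ℝ, EY) y} (hw : w ∈ D) (hvw : v - w ∈ Dᗮ) : projT D v = w := by
  have : CompleteSpace D := FiniteDimensional.complete ℝ D
  exact Submodule.eq_starProjection_of_mem_of_inner_eq_zero hw
    (fun u hu => by rw [real_inner_comm]; exact hvw u hu)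

theorem projT_eq_self {y : Y} {D : Submodule ℝ (TangentSpace 𝓘(ℝ, EY) y)}
    {v : TangentSpace 𝓘(ℝ, EY) y} (hv : v ∈ D) : projT D v = v :=
  projT_eq_of_mem hv (by simp)

theorem projT_eq_zero {y : Y} {D : Submodule ℝ (TangentSpace 𝓘(ℝ, EY) y)}
    {v : TangentSpace 𝓘(ℝ, EY) y} (hv : v ∈ Dᗮ) : projT D v = 0 :=
  projT_eq_of_mem D.zero_mem (by simpa using hv)

theorem projT_eq_zero_iff {y : Y} {D : Submodule ℝ (TangentSpace 𝓘(ℝ, EY) y)}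
    {v : TangentSpace 𝓘(ℝ, EY) y} : projT D v = 0 ↔ v ∈ Dᗮ :=
  ⟨fun h => by simpa [h] using sub_projT_mem D v, projT_eq_zero⟩

theorem hor_orthogonal (p : Y → M) (y : Y) : (hor EY EM p y)ᗮ = vert EY EM p y :=
  Submodule.orthogonal_orthogonal _

theorem mem_vert {p : Y → M} {y : Y} {u : TangentSpace 𝓘(ℝ, EY) y} :
    u ∈ vert EY EM p y ↔ mfderiv 𝓘(ℝ, EY) 𝓘(ℝ, EM) p y u = 0 := Iff.rfl

theorem mfderiv_projT_hor (p : Y → M) (y : Y) (u : TangentSpace 𝓘(ℝ, EY) y) :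
    mfderiv 𝓘(ℝ, EY) 𝓘(ℝ, EM) p y (projT (hor EY EM p y) u) =
      mfderiv 𝓘(ℝ, EY) 𝓘(ℝ, EM) p y u := by
  have h := sub_projT_mem (hor EY EM p y) u
  rw [hor_orthogonal, mem_vert, map_sub, sub_eq_zero] at h
  exact h.symm

theorem projT_vert (p : Y → M) (y : Y) (u : TangentSpace 𝓘(ℝ, EY) y) :
    projT (vert EY EM p y) u = u - projT (hor EY EM p y) u := by
  refine projT_eq_of_mem ?_ ?_
  · rw [← hor_orthogonal]
    exact sub_projT_mem _ _
  · rw [sub_sub_cancel]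
    exact projT_mem _ _

theorem horLift_mem (p : Y → M) (y : Y) (w : TangentSpace 𝓘(ℝ, EM) (p y)) :
    horLift p y w ∈ hor EY EM p y := projT_mem _ _

variable {p : Y → M}

theorem mfderiv_horLift (hp : IsSurjSubmersion EY EM p) (y : Y) (w : TangentSpace 𝓘(ℝ, EM) (p y)) :
    mfderiv 𝓘(ℝ, EY) 𝓘(ℝ, EM) p y (horLift p y w) = w := by
  rw [horLift, mfderiv_projT_hor]
  exact Function.rightInverse_invFun (hp.submersion y) w

theorem eq_of_mem_hor {y : Y} {u v : TangentSpace 𝓘(ℝ, EY) y} (hu : u ∈ hor EY EM p y)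
    (hv : v ∈ hor EY EM p y)
    (h : mfderiv 𝓘(ℝ, EY) 𝓘(ℝ, EM) p y u = mfderiv 𝓘(ℝ, EY) 𝓘(ℝ, EM) p y v) : u = v := by
  have h1 : u - v ∈ vert EY EM p y := by rw [mem_vert, map_sub, h, sub_self]
  have h2 : u - v ∈ hor EY EM p y := sub_mem hu hv
  exact sub_eq_zero.1 (inner_self_eq_zero.1 (h2 _ h1))

variable [IsManifold 𝓘(ℝ, EM) ∞ M] [FiniteDimensional ℝ EM]

theorem mdifferentiableAt_mfderiv_field (hp : ContMDiff 𝓘(ℝ, EY) 𝓘(ℝ, EM) ∞ p) {y₀ : Y}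
    {X : ∀ y : Y, TangentSpace 𝓘(ℝ, EY) y} (hX : MDiffAt (T% X) y₀) :
    MDifferentiableAt 𝓘(ℝ, EY) (𝓘(ℝ, EM).prod 𝓘(ℝ, EM))
      (fun y => TotalSpace.mk' EM (E := fun x : M => TangentSpace 𝓘(ℝ, EM) x) (p y)
        (mfderiv 𝓘(ℝ, EY) 𝓘(ℝ, EM) p y (X y))) y₀ := by
  have h1 : MDifferentiableAt (𝓘(ℝ, EY).prod 𝓘(ℝ, EY)) (𝓘(ℝ, EM).prod 𝓘(ℝ, EM))
      (tangentMap 𝓘(ℝ, EY) 𝓘(ℝ, EM) p) (⟨y₀, X y₀⟩ : TangentBundle 𝓘(ℝ, EY) Y) :=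
    ((hp.contMDiff_tangentMap (m := 1) (by norm_num; norm_cast)).contMDiffAt).mdifferentiableAt (by
        simp)
  exact h1.comp y₀ hX

theorem mvfderiv_chart_comp (hp : ContMDiff 𝓘(ℝ, EY) 𝓘(ℝ, EM) ∞ p) {x : M} {y : Y}
    (hy : p y ∈ (chartAt EM x).source) (u : TangentSpace 𝓘(ℝ, EY) y) :
    mvfderiv 𝓘(ℝ, EY) (fun y => extChartAt 𝓘(ℝ, EM) x (p y)) y u =
      mvfderiv 𝓘(ℝ, EM) (extChartAt 𝓘(ℝ, EM) x) (p y) (mfderiv 𝓘(ℝ, EY) 𝓘(ℝ, EM) p y u) :=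
  mvfderiv_comp_mfderiv (mdifferentiableAt_extChartAt' hy)
    ((hp y).mdifferentiableAt (by simp)) u

theorem contMDiffAt_chart_comp (hp : ContMDiff 𝓘(ℝ, EY) 𝓘(ℝ, EM) ∞ p) {x : M} {y : Y}
    (hy : p y ∈ (chartAt EM x).source) :
    ContMDiffAt 𝓘(ℝ, EY) 𝓘(ℝ, EM) ∞ (fun y => extChartAt 𝓘(ℝ, EM) x (p y)) y :=
  (contMDiffAt_extChartAt' hy).comp y (hp y)

theorem injective_mvfderiv_chart {x z : M} (hz : z ∈ (chartAt EM x).source)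
    {w : TangentSpace 𝓘(ℝ, EM) z} (h : mvfderiv 𝓘(ℝ, EM) (extChartAt 𝓘(ℝ, EM) x) z w = 0) :
    w = 0 := by
  have h1 := mvfderiv_eq_fderiv_chart (G := EM) (f := extChartAt 𝓘(ℝ, EM) z) (x := x) hz
  have h2 : (extChartAt 𝓘(ℝ, EM) x).source ∈ 𝓝 z := extChartAt_source_mem_nhds' (by simpa using hz)
  have h3 : mfderiv 𝓘(ℝ, EM) 𝓘(ℝ, EM) ((extChartAt 𝓘(ℝ, EM) x).symm ∘ extChartAt 𝓘(ℝ, EM) x) z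
      = mfderiv 𝓘(ℝ, EM) 𝓘(ℝ, EM) id z :=
    Filter.EventuallyEq.mfderiv_eq (Filter.mem_of_superset h2 fun a ha =>
      (extChartAt 𝓘(ℝ, EM) x).left_inv ha)
  have h4 := congrArg (fun L => L w) h3
  have h5 := mfderiv_comp_apply z (g := (extChartAt 𝓘(ℝ, EM) x).symm)
    (mdifferentiableAt_extChartAt_symm hz) (mdifferentiableAt_extChartAt' hz) w
  have h6 : mfderiv 𝓘(ℝ, EM) 𝓘(ℝ, EM) (extChartAt 𝓘(ℝ, EM) x) z w = 0 := h
  rw [h6, map_zero] at h5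
  have h7 : mfderiv 𝓘(ℝ, EM) 𝓘(ℝ, EM) (id : M → M) z w = w := by rw [mfderiv_id]; rfl
  exact h7.symm.trans (h4.symm.trans h5)

/-- This is the multiplier lemma for `q` the map `p` read in the chart at `p y₀`. -/
theorem mdifferentiableAt_hor_section (hp : IsSurjSubmersion EY EM p) {y₀ : Y}
    {X : ∀ y : Y, TangentSpace 𝓘(ℝ, EY) y} (hX : ∀ᶠ y in 𝓝 y₀, X y ∈ hor EY EM p y)
    (hpX : MDifferentiableAt 𝓘(ℝ, EY) 𝓘(ℝ, EM) (fun y => mvfderiv 𝓘(ℝ, EM)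
      (extChartAt 𝓘(ℝ, EM) (p y₀)) (p y) (mfderiv 𝓘(ℝ, EY) 𝓘(ℝ, EM) p y (X y))) y₀) :
    MDiffAt (T% X) y₀ := by
  have hnear : ∀ᶠ y in 𝓝 y₀, p y ∈ (chartAt EM (p y₀)).source :=
    hp.smooth.continuous.continuousAt.eventually (chart_source_mem_nhds EM (p y₀))
  refine mdifferentiableAt_of_mem_ker_orthogonal
    (q := fun y => extChartAt 𝓘(ℝ, EM) (p y₀) (p y)) ?_ ?_ ?_ ?_
  · exact (contMDiffAt_chart_comp hp.smooth (mem_chart_source EM (p y₀))).of_le (by norm_cast)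
  · intro w
    obtain ⟨u, hu⟩ := hp.submersion y₀ w
    refine ⟨u, ?_⟩
    rw [mvfderiv_chart_comp hp.smooth (mem_chart_source EM (p y₀)), hu]
    exact mvfderiv_extChartAt_self _ _
  · filter_upwards [hnear, hX] with y hy hXy u hu
    rw [mvfderiv_chart_comp hp.smooth hy] at hu
    rw [real_inner_comm]
    exact hXy u (mem_vert.2 (injective_mvfderiv_chart hy hu))
  · exact hpX.congr_of_eventuallyEq (hnear.mono fun y hy => mvfderiv_chart_comp hp.smooth hy _)

/-- Projecting to the horizontal space does not change the image under `dp`, so the projected field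
is a horizontal field with differentiable image. -/
theorem mdifferentiableAt_projT_hor (hp : IsSurjSubmersion EY EM p) {y₀ : Y}
    {X : ∀ y : Y, TangentSpace 𝓘(ℝ, EY) y} (hX : MDiffAt (T% X) y₀) :
    MDiffAt (T% (fun y => projT (hor EY EM p y) (X y))) y₀ := by
  have hnear : ∀ᶠ y in 𝓝 y₀, p y ∈ (chartAt EM (p y₀)).source :=
    hp.smooth.continuous.continuousAt.eventually (chart_source_mem_nhds EM (p y₀))
  refine mdifferentiableAt_hor_section hp (.of_forall fun y => projT_mem _ _) ?_
  have h := mdifferentiableAt_mvfderiv_field ((contMDiffAt_chart_comp hp.smooth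
    (mem_chart_source EM (p y₀))).of_le (m := 2) (by norm_cast)) hX
  refine h.congr_of_eventuallyEq (hnear.mono fun y hy => ?_)
  simp only [mfderiv_projT_hor]
  rw [mvfderiv_chart_comp hp.smooth hy]

theorem mdifferentiableAt_projT_vert (hp : IsSurjSubmersion EY EM p) {y₀ : Y}
    {X : ∀ y : Y, TangentSpace 𝓘(ℝ, EY) y} (hX : MDiffAt (T% X) y₀) :
    MDiffAt (T% (fun y => projT (vert EY EM p y) (X y))) y₀ := by
  simp only [projT_vert]
  exact mdifferentiableAt_sub_section hX (mdifferentiableAt_projT_hor hp hX)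

end Horizontal

/-! ### Multiplication by `i` and holomorphic functions -/

section Holomorphic

variable {EZ : Type*} [NormedAddCommGroup EZ] [NormedSpace ℂ EZ]
  {Z : Type*} [TopologicalSpace Z] [ChartedSpace EZ Z]
  {G : Type*} [NormedAddCommGroup G] [NormedSpace ℂ G]

theorem mulI_mulI (z : Z) (w : TangentSpace 𝓘(ℝ, EZ) z) : mulI z (mulI z w) = -w := by
  change Complex.I • Complex.I • (show EZ from w) = -(show EZ from w)
  rw [smul_smul, Complex.I_mul_I, neg_one_smul]

theorem hasMFDerivAt_real {f : Z → G} {z : Z} (hf : MDifferentiableAt 𝓘(ℂ, EZ) 𝓘(ℂ, G) f z) :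
    HasMFDerivAt 𝓘(ℝ, EZ) 𝓘(ℝ, G) f z
      ((show EZ →L[ℂ] G from mfderiv 𝓘(ℂ, EZ) 𝓘(ℂ, G) f z).restrictScalars ℝ) := by
  have h := hf.hasMFDerivAt
  exact ⟨h.1, h.2.restrictScalars ℝ⟩

theorem mvfderiv_mulI {f : Z → G} {z : Z} (hf : MDifferentiableAt 𝓘(ℂ, EZ) 𝓘(ℂ, G) f z)
    (w : TangentSpace 𝓘(ℝ, EZ) z) :
    mvfderiv 𝓘(ℝ, EZ) f z (mulI z w) = Complex.I • mvfderiv 𝓘(ℝ, EZ) f z w := by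
  have h : mfderiv 𝓘(ℝ, EZ) 𝓘(ℝ, G) f z = _ := (hasMFDerivAt_real hf).mfderiv
  have h1 : ∀ u : TangentSpace 𝓘(ℝ, EZ) z, mvfderiv 𝓘(ℝ, EZ) f z u =
      (show EZ →L[ℂ] G from mfderiv 𝓘(ℂ, EZ) 𝓘(ℂ, G) f z) u := fun u => congrArg (fun L => L u) h
  rw [h1, h1]
  exact map_smul (show EZ →L[ℂ] G from mfderiv 𝓘(ℂ, EZ) 𝓘(ℂ, G) f z) Complex.I (show EZ from w)

variable [IsManifold 𝓘(ℂ, EZ) ω Z]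

theorem mdifferentiableAt_chart_complex {x z : Z} (hz : z ∈ (chartAt EZ x).source) :
    MDifferentiableAt 𝓘(ℂ, EZ) 𝓘(ℂ, EZ) (extChartAt 𝓘(ℝ, EZ) x) z :=
  mdifferentiableAt_extChartAt (I := 𝓘(ℂ, EZ)) (𝕜 := ℂ) (H := EZ) (E := EZ) hz

theorem mvfderiv_chart_mulI {x z : Z} (hz : z ∈ (chartAt EZ x).source)
    (w : TangentSpace 𝓘(ℝ, EZ) z) :
    mvfderiv 𝓘(ℝ, EZ) (extChartAt 𝓘(ℝ, EZ) x) z (mulI z w) =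
      Complex.I • mvfderiv 𝓘(ℝ, EZ) (extChartAt 𝓘(ℝ, EZ) x) z w :=
  mvfderiv_mulI (mdifferentiableAt_chart_complex hz) w

end Holomorphic

section ComplexStructure

variable {EY : Type*} [NormedAddCommGroup EY] [NormedSpace ℝ EY] [FiniteDimensional ℝ EY]
  {Y : Type*} [TopologicalSpace Y] [ChartedSpace EY Y] [IsManifold 𝓘(ℝ, EY) ∞ Y]
  [RiemannianBundle (fun y : Y => TangentSpace 𝓘(ℝ, EY) y)]
  [IsContMDiffRiemannianBundle 𝓘(ℝ, EY) ∞ EY (fun y : Y => TangentSpace 𝓘(ℝ, EY) y)]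
  {EZ : Type*} [NormedAddCommGroup EZ] [NormedSpace ℂ EZ] [FiniteDimensional ℂ EZ]
  {Z : Type*} [TopologicalSpace Z] [ChartedSpace EZ Z] [IsManifold 𝓘(ℂ, EZ) ω Z]
  {φ : Y → Z}

theorem mfderiv_Jφ (hφ : IsSurjSubmersion EY EZ φ) (y : Y) (u : TangentSpace 𝓘(ℝ, EY) y) :
    mfderiv 𝓘(ℝ, EY) 𝓘(ℝ, EZ) φ y (Jφ EZ φ y u) =
      mulI (φ y) (mfderiv 𝓘(ℝ, EY) 𝓘(ℝ, EZ) φ y u) :=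
  mfderiv_horLift hφ y _

/-- In a holomorphic chart, the image of `JX` is `i` times the image of `X`, and `JX` is horizontal
for `φ`; the criterion for horizontal fields applies. -/
theorem mdifferentiableAt_Jφ (hφ : IsSurjSubmersion EY EZ φ) {y₀ : Y}
    {X : ∀ y : Y, TangentSpace 𝓘(ℝ, EY) y} (hX : MDiffAt (T% X) y₀) :
    MDiffAt (T% (fun y => Jφ EZ φ y (X y))) y₀ := by
  have : FiniteDimensional ℝ EZ := FiniteDimensional.complexToReal EZ
  have hnear : ∀ᶠ y in 𝓝 y₀, φ y ∈ (chartAt EZ (φ y₀)).source :=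
    hφ.smooth.continuous.continuousAt.eventually (chart_source_mem_nhds EZ (φ y₀))
  refine mdifferentiableAt_hor_section hφ (.of_forall fun y => horLift_mem _ _ _) ?_
  have h := mdifferentiableAt_mvfderiv_field ((contMDiffAt_chart_comp hφ.smooth
    (mem_chart_source EZ (φ y₀))).of_le (m := 2) (by norm_cast)) hX
  have h1 := ((Complex.I • ContinuousLinearMap.id ℂ EZ).restrictScalars
    ℝ).differentiableAt.comp_mdifferentiableAt h
  refine h1.congr_of_eventuallyEq (hnear.mono fun y hy => ?_)
  simp only [mfderiv_Jφ hφ]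
  rw [mvfderiv_chart_mulI hy, ← mvfderiv_chart_comp hφ.smooth hy]
  rfl

end ComplexStructure

/-! ### Coordinates of sections along maps -/

theorem mvfderiv_clm_apply {EY : Type*} [NormedAddCommGroup EY] [NormedSpace ℝ EY]
    {Y : Type*} [TopologicalSpace Y] [ChartedSpace EY Y]
    {G : Type*} [NormedAddCommGroup G] [NormedSpace ℝ G]
    {G' : Type*} [NormedAddCommGroup G'] [NormedSpace ℝ G'] {y : Y} {A : Y → G →L[ℝ] G'} {c : Y → G}
    (hA : MDifferentiableAt 𝓘(ℝ, EY) 𝓘(ℝ, G →L[ℝ] G') A y)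
    (hc : MDifferentiableAt 𝓘(ℝ, EY) 𝓘(ℝ, G) c y) (v : TangentSpace 𝓘(ℝ, EY) y) :
    mvfderiv 𝓘(ℝ, EY) (fun y' => A y' (c y')) y v =
      mvfderiv 𝓘(ℝ, EY) A y v (c y) + A y (mvfderiv 𝓘(ℝ, EY) c y v) :=
  mvfderiv_bilin (ContinuousLinearMap.id ℝ (G →L[ℝ] G')) hA hc v


section Coordinates

variable {EY : Type*} [NormedAddCommGroup EY] [NormedSpace ℝ EY]
  {Y : Type*} [TopologicalSpace Y] [ChartedSpace EY Y]
  {EM : Type*} [NormedAddCommGroup EM] [NormedSpace ℝ EM]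
  {M : Type*} [TopologicalSpace M] [ChartedSpace EM M] [IsManifold 𝓘(ℝ, EM) ∞ M]
  (F : Type*) [NormedAddCommGroup F] [NormedSpace ℝ F]
  {E : M → Type*} [TopologicalSpace (TotalSpace F E)]
  [∀ x, NormedAddCommGroup (E x)] [∀ x, InnerProductSpace ℝ (E x)]
  [FiberBundle F E] [VectorBundle ℝ F E]

/-- The frame of `E` given by the preferred trivialization at `x₀`. -/
def fr (x₀ x : M) : F →ₗ[ℝ] E x := (trivializationAt F E x₀).symmₗ ℝ x

/-- The coordinates in the frame given by the preferred trivialization at `x₀`. -/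
def co (x₀ x : M) : E x →ₗ[ℝ] F := (trivializationAt F E x₀).linearMapAt ℝ x

/-- The domain of the preferred trivialization at `x₀`. -/
def base (E : M → Type*) [TopologicalSpace (TotalSpace F E)] [∀ x, NormedAddCommGroup (E x)]
    [FiberBundle F E] (x₀ : M) : Set M := (trivializationAt F E x₀).baseSet

theorem mem_base_self (x₀ : M) : x₀ ∈ base F E x₀ := FiberBundle.mem_baseSet_trivializationAt' x₀

theorem base_mem_nhds {x₀ x : M} (hx : x ∈ base F E x₀) : base F E x₀ ∈ 𝓝 x :=
  (trivializationAt F E x₀).open_baseSet.mem_nhds hx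

theorem fr_co {x₀ x : M} (hx : x ∈ base F E x₀) (v : E x) : fr F x₀ x (co F x₀ x v) = v :=
  (trivializationAt F E x₀).symmₗ_linearMapAt hx v

theorem co_fr {x₀ x : M} (hx : x ∈ base F E x₀) (c : F) : co F x₀ x (fr F x₀ x c : E x) = c :=
  (trivializationAt F E x₀).linearMapAt_symmₗ hx c

theorem co_eq {x₀ x : M} (hx : x ∈ base F E x₀) (v : E x) :
    co F x₀ x v = (trivializationAt F E x₀ ⟨x, v⟩).2 :=
  congrFun ((trivializationAt F E x₀).coe_linearMapAt_of_mem hx) v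

theorem fr_eq {x₀ x : M} (hx : x ∈ base F E x₀) (c : F) :
    (fr F x₀ x c : E x) = (trivializationAt F E x₀).symm x c :=
  congrFun ((trivializationAt F E x₀).coe_symmₗ hx) c

theorem extend_eq_fr {x₀ x : M} (hx : x ∈ base F E x₀) (v : E x₀) :
    FiberBundle.extend F v x = fr F x₀ x (co F x₀ x₀ v) := by
  rw [fr_eq F hx, co_eq F (mem_base_self (E := E) F x₀)]
  rfl

variable {F}

theorem mdifferentiableAt_along_iff {p : Y → M} {s : ∀ y, E (p y)} {x₀ : M} {y : Y}
    [ContMDiffVectorBundle 1 F E 𝓘(ℝ, EM)] (hx : p y ∈ base F E x₀)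
    (hp : MDifferentiableAt 𝓘(ℝ, EY) 𝓘(ℝ, EM) p y) :
    MDifferentiableAt 𝓘(ℝ, EY) (𝓘(ℝ, EM).prod 𝓘(ℝ, F)) (fun y => TotalSpace.mk' F (p y) (s y)) y ↔
      MDifferentiableAt 𝓘(ℝ, EY) 𝓘(ℝ, F) (fun y' => co F x₀ (p y') (s y')) y := by
  rw [(trivializationAt F E x₀).mdifferentiableAt_totalSpace_iff 𝓘(ℝ, EM)
    (fun y => TotalSpace.mk' F (p y) (s y)) (by
      rw [Trivialization.mem_source]
      exact hx)]
  have h : (fun y' => co F x₀ (p y') (s y')) =ᶠ[𝓝 y]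
      fun y' => (trivializationAt F E x₀ (TotalSpace.mk' F (p y') (s y'))).2 :=
    (hp.continuousAt.eventually (base_mem_nhds F hx)).mono fun y' hy' => co_eq F hy' _
  rw [h.mdifferentiableAt_iff]
  exact ⟨fun h => h.2, fun h => ⟨hp, h⟩⟩

theorem trivDeriv_eq {p : Y → M} (s : ∀ y, E (p y)) {y : Y} (hp : ContinuousAt p y)
    (v : TangentSpace 𝓘(ℝ, EY) y) :
    trivDeriv F p s y v =
      fr (E := E) F (p y) (p y) (mvfderiv 𝓘(ℝ, EY) (fun y' => co F (p y) (p y') (s y')) y v) := by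
  rw [fr_eq F (mem_base_self (E := E) F (p y)), trivDeriv]
  congr 1
  exact congrArg (fun L => L v) (mvfderiv_congr
    ((hp.eventually (base_mem_nhds F (mem_base_self (E := E) F (p y)))).mono
      fun y' hy' => (co_eq F hy' _).symm))

/-- Along a vertical vector the derivative of a section does not depend on the trivialization. -/
theorem trivDeriv_eq_of_mem_vert [FiniteDimensional ℝ F] [ContMDiffVectorBundle 1 F E 𝓘(ℝ, EM)]
    {p : Y → M} {s : ∀ y, E (p y)} {x₀ : M} {y : Y} (hx : p y ∈ base F E x₀)
    (hp : MDifferentiableAt 𝓘(ℝ, EY) 𝓘(ℝ, EM) p y)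
    (hs : MDifferentiableAt 𝓘(ℝ, EY) 𝓘(ℝ, F) (fun y' => co F x₀ (p y') (s y')) y)
    {v : TangentSpace 𝓘(ℝ, EY) y} (hv : v ∈ vert EY EM p y) :
    trivDeriv F p s y v =
      fr (E := E) F x₀ (p y) (mvfderiv 𝓘(ℝ, EY) (fun y' => co F x₀ (p y') (s y')) y v) := by
  let e := trivializationAt F E x₀
  let e' := trivializationAt F E (p y)
  have h1 := mdifferentiableAt_coordChangeL (IB := 𝓘(ℝ, EM)) (𝕜 := ℝ) (e := e) (e' := e') hx
    (mem_base_self (E := E) F (p y))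
  have h2 : (fun y' => co F (p y) (p y') (s y')) =ᶠ[𝓝 y] fun y' =>
      (e.coordChangeL ℝ e' (p y') : F →L[ℝ] F) (co F x₀ (p y') (s y')) := by
    filter_upwards [hp.continuousAt.eventually (base_mem_nhds F (mem_base_self (E := E) F (p y))),
      hp.continuousAt.eventually (base_mem_nhds F hx)] with y' h3 h4
    have h5 := e.coordChangeL_apply (R := ℝ) e' ⟨h4, h3⟩ (co F x₀ (p y') (s y'))
    refine Eq.trans ?_ h5.symm
    rw [co_eq F h3, ← fr_eq F h4, fr_co F h4]
  have h3 := mvfderiv_clm_apply (h1.comp y hp) hs v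
  -- The change of frame depends on `y'` only through `p y'`, so it is constant to first order along
  -- vertical vectors.
  have h4 : mvfderiv 𝓘(ℝ, EY) (fun y' => (e.coordChangeL ℝ e' (p y') : F →L[ℝ] F)) y v = 0 := by
    rw [mvfderiv_comp_mfderiv h1 hp, show mfderiv 𝓘(ℝ, EY) 𝓘(ℝ, EM) p y v = 0 from hv, map_zero]
  rw [trivDeriv_eq s hp.continuousAt, mvfderiv_congr h2]
  have h5 : mvfderiv 𝓘(ℝ, EY) (fun y' => (e.coordChangeL ℝ e' (p y') : F →L[ℝ] F)
      (co F x₀ (p y') (s y'))) y v =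
      (e.coordChangeL ℝ e' (p y) : F →L[ℝ] F)
        (mvfderiv 𝓘(ℝ, EY) (fun y' => co F x₀ (p y') (s y')) y v) := by
    refine h3.trans ?_
    erw [h4]
    simp
  rw [h5]
  have h6 := e.coordChangeL_apply (R := ℝ) e' ⟨hx, mem_base_self F (p y)⟩
    (mvfderiv 𝓘(ℝ, EY) (fun y' => co F x₀ (p y') (s y')) y v)
  refine (congrArg (fr F (p y) (p y)) h6).trans ?_
  rw [← co_eq F (mem_base_self (E := E) F (p y)), fr_co F (mem_base_self (E := E) F (p y)), ← fr_eq
      F hx]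

theorem mdifferentiableAt_fr [FiniteDimensional ℝ F] [ContMDiffVectorBundle 1 F E 𝓘(ℝ, EM)]
    {p : Y → M} {x₀ : M} {y : Y} (hx : p y ∈ base F E x₀)
    (hp : MDifferentiableAt 𝓘(ℝ, EY) 𝓘(ℝ, EM) p y) {c : Y → F}
    (hc : MDifferentiableAt 𝓘(ℝ, EY) 𝓘(ℝ, F) c y) :
    MDifferentiableAt 𝓘(ℝ, EY) (𝓘(ℝ, EM).prod 𝓘(ℝ, F))
      (fun y => TotalSpace.mk' F (p y) (fr F x₀ (p y) (c y) : E (p y))) y := by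
  rw [mdifferentiableAt_along_iff hx hp]
  exact hc.congr_of_eventuallyEq ((hp.continuousAt.eventually (base_mem_nhds F hx)).mono
    fun y' hy' => co_fr F hy' _)

end Coordinates

/-! ### Connections and their pull backs in a frame -/

section Connection

variable {EY : Type*} [NormedAddCommGroup EY] [NormedSpace ℝ EY] [FiniteDimensional ℝ EY]
  {Y : Type*} [TopologicalSpace Y] [ChartedSpace EY Y] [IsManifold 𝓘(ℝ, EY) ∞ Y]
  {EM : Type*} [NormedAddCommGroup EM] [NormedSpace ℝ EM] [FiniteDimensional ℝ EM]
  {M : Type*} [TopologicalSpace M] [ChartedSpace EM M] [IsManifold 𝓘(ℝ, EM) ∞ M]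
  {F : Type*} [NormedAddCommGroup F] [NormedSpace ℝ F] [FiniteDimensional ℝ F]
  {E : M → Type*} [TopologicalSpace (TotalSpace F E)]
  [∀ x, NormedAddCommGroup (E x)] [∀ x, InnerProductSpace ℝ (E x)]
  [FiberBundle F E] [VectorBundle ℝ F E] [ContMDiffVectorBundle ∞ F E 𝓘(ℝ, EM)]
  (conn : CovariantDerivative 𝓘(ℝ, EM) F E)

/-- The difference between the connection and the derivative of coordinates is tensorial, so it may
be evaluated on the extension with constant coordinates, where the second term vanishes. -/
theorem conn_eq {t : ∀ x, E x} {x : M}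
    (ht : MDifferentiableAt 𝓘(ℝ, EM) (𝓘(ℝ, EM).prod 𝓘(ℝ, F)) (fun x => TotalSpace.mk' F x (t x)) x)
    (w : TangentSpace 𝓘(ℝ, EM) x) :
    conn t x w = fr F x x (mvfderiv 𝓘(ℝ, EM) (fun x' => co F x x' (t x')) x w)
      + conn (FiberBundle.extend F (t x)) x w := by
  have : ContMDiffVectorBundle 1 F E 𝓘(ℝ, EM) := ContMDiffVectorBundle.of_le (n := ∞) (by norm_cast)
  have hco : ∀ {s : ∀ x, E x}, MDifferentiableAt 𝓘(ℝ, EM) (𝓘(ℝ, EM).prod 𝓘(ℝ, F))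
      (fun x => TotalSpace.mk' F x (s x)) x →
      MDifferentiableAt 𝓘(ℝ, EM) 𝓘(ℝ, F) (fun x' => co F x x' (s x')) x := fun h =>
    (mdifferentiableAt_along_iff (p := fun x : M => x) (mem_base_self (E := E) F x)
      mdifferentiableAt_id).1 h
  have hT : TensorialAt 𝓘(ℝ, EM) F (fun s : ∀ x, E x => conn s x w
      - fr F x x (mvfderiv 𝓘(ℝ, EM) (fun x' => co F x x' (s x')) x w)) x := by
    refine ⟨fun {f s} hf hs => ?_, fun {s s'} hs hs' => ?_⟩
    · have h1 := congrArg (fun L => L w) (conn.isCovariantDerivativeOn.leibniz hs hf)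
      have h2 := mvfderiv_bilin (ContinuousLinearMap.lsmul ℝ ℝ) hf (hco hs) w
      have h3 : (fun x' => co F x x' ((f • s) x')) = fun x' => f x' • co F x x' (s x') := by
        funext x'
        exact map_smul _ _ _
      refine (congrArg₂ (· - ·) h1 ((congrArg (fun k => fr F x x (mvfderiv 𝓘(ℝ, EM) k x w))
        h3).trans (congrArg (fr F x x) h2))).trans ?_
      simp only [ContinuousLinearMap.lsmul_apply, map_add, map_smul, fr_co F (mem_base_self (E := E)
          F x)]
      simp [smul_sub]
      abel
    · have h1 := congrArg (fun L => L w) (conn.isCovariantDerivativeOn.add hs hs')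
      have h2 := congrArg (fun L => L w) (mvfderiv_add (hco hs) (hco hs'))
      have h3 : (fun x' => co F x x' ((s + s') x')) =
          (fun x' => co F x x' (s x')) + fun x' => co F x x' (s' x') := by
        funext x'
        exact map_add _ _ _
      refine (congrArg₂ (· - ·) h1 ((congrArg (fun k => fr F x x (mvfderiv 𝓘(ℝ, EM) k x w))
        h3).trans (congrArg (fr F x x) h2))).trans ?_
      simp only [_root_.add_apply, map_add]
      abel
  have h1 := hT.pointwise ht (FiberBundle.mdifferentiableAt_extend 𝓘(ℝ, EM) F (t x))
    (FiberBundle.extend_apply_self F (t x)).symm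
  have h2 : mvfderiv 𝓘(ℝ, EM) (fun x' => co F x x' (FiberBundle.extend F (t x) x')) x = 0 := by
    rw [mvfderiv_congr (g := fun _ => co F x x (t x)) ?_, mvfderiv_const]
    filter_upwards [base_mem_nhds F (mem_base_self (E := E) F x)] with x' hx'
    rw [extend_eq_fr F hx', co_fr F hx']
  simp only [h2] at h1
  rw [_root_.zero_apply, map_zero, sub_zero, sub_eq_iff_eq_add'] at h1
  exact h1

variable {conn}

set_option synthInstance.maxHeartbeats 200000 in
/-- The pull back of a metric connection is metric. -/
theorem mvfderiv_inner_along [IsContMDiffRiemannianBundle 𝓘(ℝ, EM) ∞ F E]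
    (hconn : conn.IsMetricCompatible) {p : Y → M} {s t : ∀ y, E (p y)} {y : Y}
    (hp : MDifferentiableAt 𝓘(ℝ, EY) 𝓘(ℝ, EM) p y)
    (hs : MDifferentiableAt 𝓘(ℝ, EY) (𝓘(ℝ, EM).prod 𝓘(ℝ, F)) (fun y => TotalSpace.mk' F (p y) (s y))
        y)
    (ht : MDifferentiableAt 𝓘(ℝ, EY) (𝓘(ℝ, EM).prod 𝓘(ℝ, F)) (fun y => TotalSpace.mk' F (p y) (t y))
        y)
    (v : TangentSpace 𝓘(ℝ, EY) y) :
    mvfderiv 𝓘(ℝ, EY) (fun y' => (inner ℝ (s y') (t y') : ℝ)) y v =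
      inner ℝ (pullbackConn F (fun s x v => conn s x v) p s y v) (t y)
        + inner ℝ (s y) (pullbackConn F (fun s x v => conn s x v) p t y v) := by
  have : ContMDiffVectorBundle 1 F E 𝓘(ℝ, EM) := ContMDiffVectorBundle.of_le (n := ∞) (by norm_cast)
  have hb := mem_base_self (E := E) F (p y)
  have hs' := (mdifferentiableAt_along_iff hb hp).1 hs
  have ht' := (mdifferentiableAt_along_iff hb hp).1 ht
  -- Gram form of the frame: the inner product becomes a trilinear expression in the Gram form and
  -- the two coordinate functions.
  let g : M → F →ₗ[ℝ] F →ₗ[ℝ] ℝ := fun x =>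
    (innerₗ (E x)).compl₁₂ (fr F (p y) x) (fr F (p y) x)
  let Γ : M → F →L[ℝ] F →L[ℝ] ℝ := fun x => (g x).toContinuousBilinearMap
  have hΓ : ∀ x a b, Γ x a b = inner ℝ (fr F (p y) x a : E x) (fr F (p y) x b) := fun _ _ _ => rfl
  have hfr : ∀ c : F, MDifferentiableAt 𝓘(ℝ, EM) (𝓘(ℝ, EM).prod 𝓘(ℝ, F))
      (fun x => TotalSpace.mk' F x (fr F (p y) x c : E x)) (p y) := fun c =>
    mdifferentiableAt_fr (p := fun x : M => x) hb mdifferentiableAt_id mdifferentiableAt_const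
  have hΓ1 : ∀ a b, MDifferentiableAt 𝓘(ℝ, EM) 𝓘(ℝ, ℝ) (fun x => Γ x a b) (p y) := fun a b =>
    (hfr a).inner_bundle (hfr b)
  have hΓ2 : MDifferentiableAt 𝓘(ℝ, EM) 𝓘(ℝ, F →L[ℝ] F →L[ℝ] ℝ) Γ (p y) :=
    mdifferentiableAt_clm_of_apply fun a => mdifferentiableAt_clm_of_apply fun b => hΓ1 a b
  have h1 : (fun y' => (inner ℝ (s y') (t y') : ℝ)) =ᶠ[𝓝 y] fun y' =>
      (Γ (p y') (co F (p y) (p y') (s y'))) (co F (p y) (p y') (t y')) := by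
    filter_upwards [hp.continuousAt.eventually (base_mem_nhds F hb)] with y' hy'
    rw [hΓ, fr_co F hy', fr_co F hy']
  have hΓp : MDifferentiableAt 𝓘(ℝ, EY) 𝓘(ℝ, F →L[ℝ] F →L[ℝ] ℝ) (fun y' => Γ (p y')) y :=
    hΓ2.comp y hp
  have h2 := mvfderiv_clm_apply (hΓp.clm_apply hs') ht' v
  have h3 := mvfderiv_clm_apply hΓp hs' v
  set a := co F (p y) (p y) (s y) with ha
  set b := co F (p y) (p y) (t y) with hbdef
  have h4 : (mvfderiv 𝓘(ℝ, EY) (fun y' => Γ (p y')) y v a) b =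
      mvfderiv 𝓘(ℝ, EM) (fun x => Γ x a b) (p y) (mfderiv 𝓘(ℝ, EY) 𝓘(ℝ, EM) p y v) := by
    rw [mvfderiv_comp_mfderiv hΓ2 hp]
    have h5 := mvfderiv_clm ((ContinuousLinearMap.apply ℝ ℝ b).comp
      (ContinuousLinearMap.apply ℝ (F →L[ℝ] ℝ) a)) hΓ2 (mfderiv 𝓘(ℝ, EY) 𝓘(ℝ, EM) p y v)
    exact h5.symm
  -- Metric compatibility enters here only, for the two sections with constant coordinates `a` and
  -- `b`.
  have h5 : mvfderiv 𝓘(ℝ, EM) (fun x => Γ x a b) (p y) (mfderiv 𝓘(ℝ, EY) 𝓘(ℝ, EM) p y v) =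
      inner ℝ (conn (FiberBundle.extend F (s y)) (p y) (mfderiv 𝓘(ℝ, EY) 𝓘(ℝ, EM) p y v)) (t y)
      + inner ℝ (s y) (conn (FiberBundle.extend F (t y)) (p y)
        (mfderiv 𝓘(ℝ, EY) 𝓘(ℝ, EM) p y v)) := by
    have h6 := hconn.mvfderiv_inner_eq (FiberBundle.extend EM (mfderiv 𝓘(ℝ, EY) 𝓘(ℝ, EM) p y v))
      (FiberBundle.mdifferentiableAt_extend 𝓘(ℝ, EM) F (s y))
      (FiberBundle.mdifferentiableAt_extend 𝓘(ℝ, EM) F (t y))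
    simp only [FiberBundle.extend_apply_self] at h6
    rw [← h6]
    have h7 : (fun x => Γ x a b) =ᶠ[𝓝 (p y)] fun x =>
        (inner ℝ (FiberBundle.extend F (s y) x) (FiberBundle.extend F (t y) x) : ℝ) := by
      filter_upwards [base_mem_nhds F hb] with x hx
      rw [hΓ, extend_eq_fr F hx, extend_eq_fr F hx]
    rw [mvfderiv_congr h7]
  rw [mvfderiv_congr h1, h2, h3, _root_.add_apply, h4, h5, hΓ, hΓ, ha, hbdef, fr_co F hb,
    fr_co F hb, pullbackConn, pullbackConn, trivDeriv_eq s hp.continuousAt,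
    trivDeriv_eq t hp.continuousAt, inner_add_left, inner_add_right]
  ring

end Connection

/-! ### The torsion along a map -/

section TangentFrame

variable {EM : Type*} [NormedAddCommGroup EM] [NormedSpace ℝ EM] [FiniteDimensional ℝ EM]
  {M : Type*} [TopologicalSpace M] [ChartedSpace EM M] [IsManifold 𝓘(ℝ, EM) ∞ M]

theorem symm_mvfderiv_chart {x z : M} (hz : z ∈ (chartAt EM x).source)
    (w : TangentSpace 𝓘(ℝ, EM) z) :
    (trivializationAt EM (TangentSpace 𝓘(ℝ, EM)) x).symm z
      (mvfderiv 𝓘(ℝ, EM) (extChartAt 𝓘(ℝ, EM) x) z w) = w := by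
  have h := comps_eq_mvfderiv (FiberBundle.extend EM w) hz
  rw [comps, FiberBundle.extend_apply_self] at h
  rw [← h]
  exact (trivializationAt EM (TangentSpace 𝓘(ℝ, EM)) x).symm_apply_apply_mk (by simpa using hz) w

theorem mvfderiv_comps_extend {x : M} (v : TangentSpace 𝓘(ℝ, EM) x) :
    mvfderiv 𝓘(ℝ, EM) (comps x (FiberBundle.extend EM v)) x = 0 := by
  let c : EM := v
  have h : comps x (FiberBundle.extend EM v) =ᶠ[𝓝 x] fun _ => c := by
    have hb : ∀ᶠ z in 𝓝 x, z ∈ (trivializationAt EM (TangentSpace 𝓘(ℝ, EM)) x).baseSet :=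
      (trivializationAt EM (TangentSpace 𝓘(ℝ, EM)) x).open_baseSet.mem_nhds
        (FiberBundle.mem_baseSet_trivializationAt' x)
    filter_upwards [hb] with z hz
    rw [comps, extend_eq_symm]
    exact congrArg Prod.snd
      ((trivializationAt EM (TangentSpace 𝓘(ℝ, EM)) x).apply_mk_symm hz v)
  rw [mvfderiv_congr h, mvfderiv_const]

/-- Fields with constant components in a chart commute. Hence the bracket term in `iotaTorsion` is
zero. -/
theorem mlieBracket_extend {x : M} (u v : TangentSpace 𝓘(ℝ, EM) x) :
    mlieBracket 𝓘(ℝ, EM) (FiberBundle.extend EM u) (FiberBundle.extend EM v) x = 0 := by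
  rw [mlieBracket_eq (FiberBundle.mdifferentiableAt_extend ..)
    (FiberBundle.mdifferentiableAt_extend ..), mvfderiv_comps_extend,
    mvfderiv_comps_extend]
  simp
  rfl

end TangentFrame

section TorsionAlong

variable {EY : Type*} [NormedAddCommGroup EY] [NormedSpace ℝ EY] [FiniteDimensional ℝ EY]
  {Y : Type*} [TopologicalSpace Y] [ChartedSpace EY Y] [IsManifold 𝓘(ℝ, EY) ∞ Y]
  [RiemannianBundle (fun y : Y => TangentSpace 𝓘(ℝ, EY) y)]
  [IsContMDiffRiemannianBundle 𝓘(ℝ, EY) ∞ EY (fun y : Y => TangentSpace 𝓘(ℝ, EY) y)]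
  {EM : Type*} [NormedAddCommGroup EM] [NormedSpace ℝ EM] [FiniteDimensional ℝ EM]
  {M : Type*} [TopologicalSpace M] [ChartedSpace EM M] [IsManifold 𝓘(ℝ, EM) ∞ M]
  {F : Type*} [NormedAddCommGroup F] [NormedSpace ℝ F] [FiniteDimensional ℝ F]
  {E : M → Type*} [TopologicalSpace (TotalSpace F E)]
  [∀ x, NormedAddCommGroup (E x)] [∀ x, InnerProductSpace ℝ (E x)]
  [FiberBundle F E] [VectorBundle ℝ F E] [ContMDiffVectorBundle ∞ F E 𝓘(ℝ, EM)]
  (conn : CovariantDerivative 𝓘(ℝ, EM) F E)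
  {ι : ∀ x, TangentSpace 𝓘(ℝ, EM) x →ₗ[ℝ] E x}
  (hι : ContMDiff (𝓘(ℝ, EM).prod 𝓘(ℝ, EM)) (𝓘(ℝ, EM).prod 𝓘(ℝ, F)) ∞
    (fun q : TangentBundle 𝓘(ℝ, EM) M => (⟨q.1, ι q.1 q.2⟩ : TotalSpace F E)))
  {p : Y → M} (hp : ContMDiff 𝓘(ℝ, EY) 𝓘(ℝ, EM) ∞ p)

include hι

theorem mdifferentiableAt_bundleMap {f : Y → M} {W : ∀ y, TangentSpace 𝓘(ℝ, EM) (f y)} {y : Y}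
    (hW : MDifferentiableAt 𝓘(ℝ, EY) (𝓘(ℝ, EM).prod 𝓘(ℝ, EM))
      (fun y => TotalSpace.mk' EM (E := fun x : M => TangentSpace 𝓘(ℝ, EM) x) (f y) (W y)) y) :
    MDifferentiableAt 𝓘(ℝ, EY) (𝓘(ℝ, EM).prod 𝓘(ℝ, F))
      (fun y => TotalSpace.mk' F (f y) (ι (f y) (W y))) y :=
  (hι.contMDiffAt.mdifferentiableAt (by simp)).comp y hW

include hp

/-- In frames the section is the matrix of `ι` applied to the components of `dp V`. Differentiating
the matrix gives the first term; differentiating the components gives the second, whose skew part is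
the image of a bracket. -/
theorem pullbackConn_bundleMap_mfderiv {V : ∀ y : Y, TangentSpace 𝓘(ℝ, EY) y} {y : Y}
    (hV : MDiffAt (T% V) y) (v : TangentSpace 𝓘(ℝ, EY) y) :
    pullbackConn F (fun s x v => conn s x v) p
        (fun y' => ι (p y') (mfderiv 𝓘(ℝ, EY) 𝓘(ℝ, EM) p y' (V y'))) y v =
      conn (fun x => ι x (FiberBundle.extend EM (mfderiv 𝓘(ℝ, EY) 𝓘(ℝ, EM) p y (V y)) x)) (p y)
        (mfderiv 𝓘(ℝ, EY) 𝓘(ℝ, EM) p y v)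
      + ι (p y) (mvfderiv 𝓘(ℝ, EY) (fun y' => mvfderiv 𝓘(ℝ, EY)
          (fun y'' => extChartAt 𝓘(ℝ, EM) (p y) (p y'')) y' (V y')) y v) := by
  have : ContMDiffVectorBundle 1 F E 𝓘(ℝ, EM) := ContMDiffVectorBundle.of_le (n := ∞) (by norm_cast)
  let e := trivializationAt EM (TangentSpace 𝓘(ℝ, EM)) (p y)
  let Λ : M → EM →L[ℝ] F := fun x => LinearMap.toContinuousLinearMap
    ((co F (p y) x).comp ((ι x).comp (e.symmₗ ℝ x)))
  have hpy : MDifferentiableAt 𝓘(ℝ, EY) 𝓘(ℝ, EM) p y := (hp y).mdifferentiableAt (by simp)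
  have hbase : ∀ᶠ x in 𝓝 (p y), x ∈ e.baseSet :=
    e.open_baseSet.mem_nhds (FiberBundle.mem_baseSet_trivializationAt' (p y))
  have hbF := mem_base_self (E := E) F (p y)
  have hΛ : ∀ x ∈ e.baseSet, ∀ c, Λ x c = co F (p y) x (ι x (e.symm x c)) := fun x hx c =>
    congrArg (fun w => co F (p y) x (ι x w)) (congrFun (e.coe_symmₗ hx) c)
  have hΛe : ∀ c : TangentSpace 𝓘(ℝ, EM) (p y),
      (fun x => co F (p y) x (ι x (FiberBundle.extend EM c x))) =ᶠ[𝓝 (p y)] fun x => Λ x c := by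
    intro c
    filter_upwards [hbase] with x hx
    exact (congrArg (fun w => co F (p y) x (ι x w)) (congrFun (extend_eq_symm c) x)).trans
      (hΛ x hx c).symm
  have hext : ∀ c : TangentSpace 𝓘(ℝ, EM) (p y), MDifferentiableAt 𝓘(ℝ, EM)
      (𝓘(ℝ, EM).prod 𝓘(ℝ, F))
      (fun x => TotalSpace.mk' F x (ι x (FiberBundle.extend EM c x))) (p y) := fun c =>
    (hι.contMDiffAt.mdifferentiableAt (by simp)).comp (p y)
      (FiberBundle.mdifferentiableAt_extend 𝓘(ℝ, EM) EM c)
  have hΛd : MDifferentiableAt 𝓘(ℝ, EM) 𝓘(ℝ, EM →L[ℝ] F) Λ (p y) := by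
    refine mdifferentiableAt_clm_of_apply fun c => ?_
    exact ((mdifferentiableAt_along_iff (p := fun x : M => x) hbF mdifferentiableAt_id).1
      (hext c)).congr_of_eventuallyEq (hΛe c).symm
  have hnear : ∀ᶠ y' in 𝓝 y, p y' ∈ (chartAt EM (p y)).source :=
    hp.continuous.continuousAt.eventually (chart_source_mem_nhds EM (p y))
  have hq : ContMDiffAt 𝓘(ℝ, EY) 𝓘(ℝ, EM) 2 (fun y'' => extChartAt 𝓘(ℝ, EM) (p y) (p y'')) y :=
    (contMDiffAt_chart_comp hp (mem_chart_source EM (p y))).of_le (by norm_cast)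
  have h1 : (fun y' => co F (p y) (p y') (ι (p y') (mfderiv 𝓘(ℝ, EY) 𝓘(ℝ, EM) p y' (V y'))))
      =ᶠ[𝓝 y] fun y' => Λ (p y') (mvfderiv 𝓘(ℝ, EY)
          (fun y'' => extChartAt 𝓘(ℝ, EM) (p y) (p y'')) y' (V y')) := by
    filter_upwards [hnear] with y' hy'
    rw [hΛ _ (by simpa [e] using hy'), mvfderiv_chart_comp hp hy', symm_mvfderiv_chart hy']
  have h2 := mvfderiv_clm_apply (A := fun y' => Λ (p y')) (hΛd.comp y hpy)
    (mdifferentiableAt_mvfderiv_field hq hV) v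
  have h3 := mvfderiv_comp_mfderiv hΛd hpy v
  have h4 : mvfderiv 𝓘(ℝ, EY) (fun y'' => extChartAt 𝓘(ℝ, EM) (p y) (p y'')) y (V y)
      = mfderiv 𝓘(ℝ, EY) 𝓘(ℝ, EM) p y (V y) := by
    rw [mvfderiv_chart_comp hp (mem_chart_source EM (p y))]
    exact mvfderiv_extChartAt_self _ _
  have h5 := conn_eq conn (hext (mfderiv 𝓘(ℝ, EY) 𝓘(ℝ, EM) p y (V y)))
    (mfderiv 𝓘(ℝ, EY) 𝓘(ℝ, EM) p y v)
  rw [mvfderiv_congr (hΛe _), FiberBundle.extend_apply_self] at h5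
  have h6 := mvfderiv_clm (ContinuousLinearMap.apply ℝ F
    (show EM from mfderiv 𝓘(ℝ, EY) 𝓘(ℝ, EM) p y (V y))) hΛd (mfderiv 𝓘(ℝ, EY) 𝓘(ℝ, EM) p y v)
  rw [pullbackConn, trivDeriv_eq _ hpy.continuousAt, mvfderiv_congr h1, h2, h3, h4, h5, map_add]
  have h7 : ∀ c : TangentSpace 𝓘(ℝ, EM) (p y), fr (E := E) F (p y) (p y) (Λ (p y) c) =
      ι (p y) c := by
    intro c
    have h8 : co F (p y) (p y) (ι (p y) (FiberBundle.extend EM c (p y))) = Λ (p y) c :=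
      (hΛe c).self_of_nhds
    rw [FiberBundle.extend_apply_self] at h8
    rw [← fr_co F hbF (ι (p y) c)]
    exact congrArg _ h8.symm
  rw [add_right_comm]
  refine congrArg₂ (· + ·) (congrArg₂ (· + ·) (congrArg _ h6.symm) rfl) (h7 _)

/-- The structure equation for fields on `Y` that need not be projectable to `M`: the second order
terms of the pulled back derivatives combine into `dp [U, V]`. -/
theorem iotaTorsion_along {U V : ∀ y : Y, TangentSpace 𝓘(ℝ, EY) y} {y : Y}
    (hU : MDiffAt (T% U) y) (hV : MDiffAt (T% V) y) :
    pullbackConn F (fun s x v => conn s x v) p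
        (fun y' => ι (p y') (mfderiv 𝓘(ℝ, EY) 𝓘(ℝ, EM) p y' (V y'))) y (U y)
      - pullbackConn F (fun s x v => conn s x v) p
        (fun y' => ι (p y') (mfderiv 𝓘(ℝ, EY) 𝓘(ℝ, EM) p y' (U y'))) y (V y)
      - ι (p y) (mfderiv 𝓘(ℝ, EY) 𝓘(ℝ, EM) p y (mlieBracket 𝓘(ℝ, EY) U V y)) =
      iotaTorsion conn ι (p y) (mfderiv 𝓘(ℝ, EY) 𝓘(ℝ, EM) p y (U y))
        (mfderiv 𝓘(ℝ, EY) 𝓘(ℝ, EM) p y (V y)) := by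
  have hq : ContMDiffAt 𝓘(ℝ, EY) 𝓘(ℝ, EM) 2 (fun y'' => extChartAt 𝓘(ℝ, EM) (p y) (p y'')) y :=
    (contMDiffAt_chart_comp hp (mem_chart_source EM (p y))).of_le (by norm_cast)
  have h1 := mvfderiv_mlieBracket hq hU hV
  rw [mvfderiv_chart_comp hp (mem_chart_source EM (p y))] at h1
  have h2 := (mvfderiv_extChartAt_self (p y) _).symm.trans h1
  have h3 := congrArg (ι (p y)) h2
  rw [h3, iotaTorsion, mlieBracket_extend, map_zero, sub_zero,
    pullbackConn_bundleMap_mfderiv conn hι hp hU, pullbackConn_bundleMap_mfderiv conn hι hp hV]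
  erw [map_sub]
  abel

end TorsionAlong

/-! ### The horizontal part of the Levi-Civita connection -/

namespace RiemannianTwistorialStructure

section HorizontalConnection

variable {EY EM EZ F : Type*}
  [NormedAddCommGroup EY] [NormedSpace ℝ EY] [FiniteDimensional ℝ EY]
  [NormedAddCommGroup EM] [NormedSpace ℝ EM] [FiniteDimensional ℝ EM]
  [NormedAddCommGroup EZ] [NormedSpace ℂ EZ] [FiniteDimensional ℂ EZ]
  [NormedAddCommGroup F] [NormedSpace ℝ F] [FiniteDimensional ℝ F]
  {Y : Type*} [TopologicalSpace Y]
  [ChartedSpace EY Y] [IsManifold 𝓘(ℝ, EY) ∞ Y]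
  [RiemannianBundle (fun y : Y => TangentSpace 𝓘(ℝ, EY) y)]
  [IsContMDiffRiemannianBundle 𝓘(ℝ, EY) ∞ EY (fun y : Y => TangentSpace 𝓘(ℝ, EY) y)]
  {M : Type*} [TopologicalSpace M] [T2Space M]
  [ChartedSpace EM M] [IsManifold 𝓘(ℝ, EM) ∞ M]
  [RiemannianBundle (fun x : M => TangentSpace 𝓘(ℝ, EM) x)]
  [IsContMDiffRiemannianBundle 𝓘(ℝ, EM) ∞ EM (fun x : M => TangentSpace 𝓘(ℝ, EM) x)]
  {Z : Type*} [TopologicalSpace Z]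
  [ChartedSpace EZ Z] [IsManifold 𝓘(ℂ, EZ) ω Z]
  {E : M → Type*} [TopologicalSpace (TotalSpace F E)]
  [∀ x, NormedAddCommGroup (E x)] [∀ x, InnerProductSpace ℝ (E x)]
  [∀ x, FiniteDimensional ℝ (E x)] [FiberBundle F E] [VectorBundle ℝ F E]
  [ContMDiffVectorBundle ∞ F E 𝓘(ℝ, EM)] [IsContMDiffRiemannianBundle 𝓘(ℝ, EM) ∞ F E]
  {p : Y → M} {φ : Y → Z}
  (S : RiemannianTwistorialStructure EY EM EZ F E p φ)

/-- The section of `E` along `p` corresponding to the vector field `V` on `Y`. -/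
def sec (V : ∀ y : Y, TangentSpace 𝓘(ℝ, EY) y) (y : Y) : E (p y) :=
  S.ι (p y) (mfderiv 𝓘(ℝ, EY) 𝓘(ℝ, EM) p y (V y))

/-- The covariant derivative of the section of `E` along `p` corresponding to `V`. -/
def derivSec (V : ∀ y : Y, TangentSpace 𝓘(ℝ, EY) y) (y : Y) (u : TangentSpace 𝓘(ℝ, EY) y) :
    E (p y) :=
  pullbackConn F (fun s x v => S.conn s x v) p (S.sec V) y u

/-- The torsion of `∇` on vectors tangent to `Y`. -/
def torsionY (y : Y) (u v : TangentSpace 𝓘(ℝ, EY) y) : E (p y) :=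
  iotaTorsion S.conn S.ι (p y) (mfderiv 𝓘(ℝ, EY) 𝓘(ℝ, EM) p y u)
    (mfderiv 𝓘(ℝ, EY) 𝓘(ℝ, EM) p y v)

theorem inner_ι_ι (x : M) (u v : TangentSpace 𝓘(ℝ, EM) x) :
    (inner ℝ (S.ι x u) (S.ι x v) : ℝ) = inner ℝ u v := by
  rw [S.inner_ι, S.ρ_ι]

include S in
-- Only the horizontal part of `w` matters on either side, and on ℋ the isometry property is
-- polarized.
theorem inner_mfderiv (y : Y) (w : TangentSpace 𝓘(ℝ, EY) y) {v : TangentSpace 𝓘(ℝ, EY) y}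
    (hv : v ∈ hor EY EM p y) :
    (inner ℝ (mfderiv 𝓘(ℝ, EY) 𝓘(ℝ, EM) p y w) (mfderiv 𝓘(ℝ, EY) 𝓘(ℝ, EM) p y v) : ℝ) =
      inner ℝ w v := by
  have h1 : (inner ℝ (w - projT (hor EY EM p y) w) v : ℝ) = 0 := by
    rw [real_inner_comm]
    exact sub_projT_mem _ w v hv
  rw [inner_sub_left, sub_eq_zero] at h1
  rw [h1, ← mfderiv_projT_hor p y w]
  set u := projT (hor EY EM p y) w
  have hu : u ∈ hor EY EM p y := projT_mem _ _
  rw [real_inner_eq_norm_add_mul_self_sub_norm_mul_self_sub_norm_mul_self_div_two,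
    real_inner_eq_norm_add_mul_self_sub_norm_mul_self_sub_norm_mul_self_div_two, ← map_add,
    S.p_riemannian y _ hu, S.p_riemannian y _ hv, S.p_riemannian y _ (add_mem hu hv)]

theorem inner_sec (y : Y) (w : TangentSpace 𝓘(ℝ, EY) y) {v : TangentSpace 𝓘(ℝ, EY) y}
    (hv : v ∈ hor EY EM p y) :
    (inner ℝ (S.ι (p y) (mfderiv 𝓘(ℝ, EY) 𝓘(ℝ, EM) p y w))
      (S.ι (p y) (mfderiv 𝓘(ℝ, EY) 𝓘(ℝ, EM) p y v)) : ℝ) = inner ℝ w v := by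
  rw [S.inner_ι_ι, S.inner_mfderiv y w hv]

theorem iotaTorsion_swap (x : M) (u v : TangentSpace 𝓘(ℝ, EM) x) :
    iotaTorsion S.conn S.ι x u v = -iotaTorsion S.conn S.ι x v u := by
  simp only [iotaTorsion, mlieBracket_extend, map_zero]
  abel

theorem torsionY_swap (y : Y) (u v : TangentSpace 𝓘(ℝ, EY) y) :
    S.torsionY y u v = -S.torsionY y v u := S.iotaTorsion_swap _ _ _

theorem mdifferentiableAt_sec {V : ∀ y : Y, TangentSpace 𝓘(ℝ, EY) y} {y : Y}
    (hV : MDiffAt (T% V) y) :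
    MDifferentiableAt 𝓘(ℝ, EY) (𝓘(ℝ, EM).prod 𝓘(ℝ, F))
      (fun y => TotalSpace.mk' F (p y) (S.sec V y)) y :=
  mdifferentiableAt_bundleMap S.ι_smooth
    (mdifferentiableAt_mfderiv_field S.p_submersion.smooth hV)

theorem torsionY_eq {U V : ∀ y : Y, TangentSpace 𝓘(ℝ, EY) y} {y : Y}
    (hU : MDiffAt (T% U) y) (hV : MDiffAt (T% V) y) :
    S.derivSec V y (U y) - S.derivSec U y (V y)
      - S.ι (p y) (mfderiv 𝓘(ℝ, EY) 𝓘(ℝ, EM) p y (mlieBracket 𝓘(ℝ, EY) U V y)) =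
      S.torsionY y (U y) (V y) :=
  iotaTorsion_along S.conn S.ι_smooth S.p_submersion.smooth hU hV

/-- As soon as one field is horizontal, inner products on `Y` are inner products of sections of `E`
along `p`, where the pulled back connection is metric. -/
theorem mvfderiv_inner_sec {U V W : ∀ y : Y, TangentSpace 𝓘(ℝ, EY) y} {y : Y}
    (hV : MDiffAt (T% V) y) (hW : MDiffAt (T% W) y)
    (hV' : ∀ᶠ y' in 𝓝 y, V y' ∈ hor EY EM p y') :
    mvfderiv 𝓘(ℝ, EY) (fun y' => (inner ℝ (W y') (V y') : ℝ)) y (U y) =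
      inner ℝ (S.derivSec W y (U y)) (S.sec V y) + inner ℝ (S.sec W y) (S.derivSec V y (U y)) := by
  have h1 : (fun y' => (inner ℝ (W y') (V y') : ℝ)) =ᶠ[𝓝 y] fun y' =>
      (inner ℝ (S.sec W y') (S.sec V y') : ℝ) :=
    hV'.mono fun y' hy' => (S.inner_sec y' (W y') hy').symm
  rw [mvfderiv_congr h1]
  exact mvfderiv_inner_along S.conn_metric ((S.p_submersion.smooth y).mdifferentiableAt (by simp))
    (S.mdifferentiableAt_sec hW) (S.mdifferentiableAt_sec hV) (U y)

/-- All terms of the Koszul formula are rewritten through the metric connection of `E` and its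
torsion. A totally antisymmetric torsion contributes only the contorsion `-T/2`, which vanishes on
the diagonal. -/
theorem inner_leviCivita_hor {U V W : ∀ y : Y, TangentSpace 𝓘(ℝ, EY) y} {y : Y}
    (hU : MDiffAt (T% U) y) (hV : MDiffAt (T% V) y) (hW : MDiffAt (T% W) y)
    (hU' : ∀ᶠ y' in 𝓝 y, U y' ∈ hor EY EM p y') (hV' : ∀ᶠ y' in 𝓝 y, V y' ∈ hor EY EM p y')
    (hW' : ∀ᶠ y' in 𝓝 y, W y' ∈ hor EY EM p y') :
    (inner ℝ (leviCivita V y (U y)) (W y) : ℝ) = inner ℝ (S.derivSec V y (U y)) (S.sec W y)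
      - 1 / 2 * inner ℝ (S.torsionY y (U y) (V y)) (S.sec W y) := by
  have hb : ∀ {A B C : ∀ y : Y, TangentSpace 𝓘(ℝ, EY) y}, MDiffAt (T% A) y → MDiffAt (T% B) y →
      C y ∈ hor EY EM p y → (inner ℝ (mlieBracket 𝓘(ℝ, EY) A B y) (C y) : ℝ) =
        inner ℝ (S.derivSec B y (A y)) (S.sec C y) - inner ℝ (S.derivSec A y (B y)) (S.sec C y)
        - inner ℝ (S.torsionY y (A y) (B y)) (S.sec C y) := by
    intro A B C hA hB hC
    rw [← S.torsionY_eq hA hB, ← S.inner_sec y _ hC]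
    simp only [inner_sub_left]
    simp only [sec]
    ring
  -- Antisymmetry turns the three torsion terms into multiples of `⟨T(U,V), W⟩`.
  have hT : (inner ℝ (S.torsionY y (U y) (W y)) (S.sec V y) : ℝ) =
      -inner ℝ (S.torsionY y (U y) (V y)) (S.sec W y) := S.torsion_antisymm _ _ _ _
  have hT2 : (inner ℝ (S.torsionY y (V y) (W y)) (S.sec U y) : ℝ) =
      -inner ℝ (S.torsionY y (V y) (U y)) (S.sec W y) := S.torsion_antisymm _ _ _ _
  rw [S.torsionY_swap y (V y) (U y), inner_neg_left, neg_neg] at hT2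
  rw [inner_leviCivita hU hV hW, koszul, S.mvfderiv_inner_sec hW hV hW',
    S.mvfderiv_inner_sec hW hU hW', S.mvfderiv_inner_sec hV hU hV',
    hb hU hV hW'.self_of_nhds, hb hU hW hV'.self_of_nhds, hb hV hW hU'.self_of_nhds, hT, hT2]
  simp only [real_inner_comm (S.sec V y), real_inner_comm (S.sec U y)]
  ring

end HorizontalConnection

end RiemannianTwistorialStructure

/-! ### Hermitian projections onto complex subspaces -/

section Projection

variable {V : Type*} [NormedAddCommGroup V] [InnerProductSpace ℝ V] [FiniteDimensional ℝ V]
  (S : Submodule ℂ (ℂ ⊗[ℝ] V))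

theorem projC_mem (w : ℂ ⊗[ℝ] V) : projC S w ∈ S := by
  have : FiniteDimensional ℝ (S.restrictScalars ℝ) := inferInstance
  have : CompleteSpace (S.restrictScalars ℝ) := FiniteDimensional.complete ℝ _
  exact Submodule.starProjection_apply_mem (S.restrictScalars ℝ) w

variable {S} in
theorem projC_eq_of_mem {w v : ℂ ⊗[ℝ] V} (hv : v ∈ S) (h : ∀ s ∈ S, (inner ℝ (w - v) s : ℝ) = 0) :
    projC S w = v := by
  have : FiniteDimensional ℝ (S.restrictScalars ℝ) := inferInstance
  have : CompleteSpace (S.restrictScalars ℝ) := FiniteDimensional.complete ℝ _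
  exact Submodule.eq_starProjection_of_mem_of_inner_eq_zero (K := S.restrictScalars ℝ) hv h

theorem inner_sub_projC (w : ℂ ⊗[ℝ] V) {s : ℂ ⊗[ℝ] V} (hs : s ∈ S) :
    (inner ℝ (w - projC S w) s : ℝ) = 0 := by
  have : FiniteDimensional ℝ (S.restrictScalars ℝ) := inferInstance
  have : CompleteSpace (S.restrictScalars ℝ) := FiniteDimensional.complete ℝ _
  exact Submodule.starProjection_inner_eq_zero (K := S.restrictScalars ℝ) w s hs

variable {S} in
theorem projC_eq_self {w : ℂ ⊗[ℝ] V} (hw : w ∈ S) : projC S w = w :=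
  projC_eq_of_mem hw fun s _ => by simp

theorem inner_projC_left (a b : ℂ ⊗[ℝ] V) :
    (inner ℝ (projC S a) b : ℝ) = inner ℝ a (projC S b) := by
  have h1 := inner_sub_projC S a (projC_mem S b)
  have h2 := inner_sub_projC S b (projC_mem S a)
  rw [inner_sub_left] at h1 h2
  rw [real_inner_comm (projC S a) (projC S b)] at h2
  rw [real_inner_comm b (projC S a)]
  linarith

theorem inner_I_smul_left (a b : ℂ ⊗[ℝ] V) :
    (inner ℝ (Complex.I • a) b : ℝ) = -inner ℝ a (Complex.I • b) := by
  obtain ⟨a1, a2, rfl⟩ := exists_mkC a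
  obtain ⟨b1, b2, rfl⟩ := exists_mkC b
  rw [I_smul_mkC, I_smul_mkC, inner_mkC, inner_mkC, inner_neg_left, inner_neg_right]
  ring

/-- Multiplication by `i` is skew for the real inner product and preserves `S`, hence also its real
orthogonal. -/
theorem projC_I_smul (w : ℂ ⊗[ℝ] V) : projC S (Complex.I • w) = Complex.I • projC S w := by
  refine projC_eq_of_mem (S.smul_mem _ (projC_mem S w)) fun s hs => ?_
  rw [← smul_sub, inner_I_smul_left, inner_sub_projC S w (S.smul_mem _ hs), neg_zero]

end Projection

/-! ### Coordinates of maps into Grassmannian bundles -/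

section Rotation

variable (F : Type*) [NormedAddCommGroup F] [NormedSpace ℝ F]

/-- Multiplication by `i` on the complexification `F × F` of `F`. -/
def rotF : F × F →L[ℝ] F × F :=
  (-ContinuousLinearMap.snd ℝ F F).prod (ContinuousLinearMap.fst ℝ F F)

variable {F}

theorem rotF_apply (c : F × F) : rotF F c = (-c.2, c.1) := rfl

end Rotation

section Smooth

variable {EY : Type*} [NormedAddCommGroup EY] [NormedSpace ℝ EY]
  {Y : Type*} [TopologicalSpace Y] [ChartedSpace EY Y]
  {G : Type*} [NormedAddCommGroup G] [NormedSpace ℝ G] [FiniteDimensional ℝ G]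
  {G' : Type*} [NormedAddCommGroup G'] [NormedSpace ℝ G'] [FiniteDimensional ℝ G']

theorem contMDiffAt_clm_of_apply {n : ℕ∞ω} {y₀ : Y} {L : Y → G →L[ℝ] G'}
    (hL : ∀ b, ContMDiffAt 𝓘(ℝ, EY) 𝓘(ℝ, G') n (fun y => L y b) y₀) :
    ContMDiffAt 𝓘(ℝ, EY) 𝓘(ℝ, G →L[ℝ] G') n L y₀ := by
  let b := Module.finBasis ℝ G
  have h : L = fun y => ∑ i, ContinuousLinearMap.smulRightL ℝ G G'
      (LinearMap.toContinuousLinearMap (b.coord i)) (L y (b i)) := by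
    ext y v
    conv_lhs => rw [← b.sum_repr v, map_sum]
    simp [_root_.sum_apply, map_smul, Module.Basis.coord_apply]
  rw [h]
  refine ContMDiffAt.sum fun i _ => ?_
  exact (ContinuousLinearMap.contMDiff (n := n) (ContinuousLinearMap.smulRightL ℝ G G'
    (LinearMap.toContinuousLinearMap (b.coord i)))).contMDiffAt.comp y₀ (hL (b i))

end Smooth

section GrassmannCoordinates

variable {EY : Type*} [NormedAddCommGroup EY] [NormedSpace ℝ EY]
  {Y : Type*} [TopologicalSpace Y] [ChartedSpace EY Y]
  {EM : Type*} [NormedAddCommGroup EM] [NormedSpace ℝ EM]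
  {M : Type*} [TopologicalSpace M] [ChartedSpace EM M] [IsManifold 𝓘(ℝ, EM) ∞ M]
  (F : Type*) [NormedAddCommGroup F] [NormedSpace ℝ F] [FiniteDimensional ℝ F]
  {E : M → Type*} [TopologicalSpace (TotalSpace F E)]
  [∀ x, NormedAddCommGroup (E x)] [∀ x, InnerProductSpace ℝ (E x)]
  [∀ x, FiniteDimensional ℝ (E x)]
  [FiberBundle F E] [VectorBundle ℝ F E]

/-- The frame of the complexification of `E` given by the preferred trivialization at `x₀`. -/
def cfr (x₀ x : M) : F × F →ₗ[ℝ] ℂ ⊗[ℝ] E x where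
  toFun c := mkC (fr F x₀ x c.1) (fr F x₀ x c.2)
  map_add' c d := by simp [mkC_add]
  map_smul' r c := by simp [real_smul_mkC]

/-- The coordinates in the frame `cfr`. -/
def cco (x₀ x : M) : ℂ ⊗[ℝ] E x →ₗ[ℝ] F × F :=
  LinearMap.prod (co F x₀ x ∘ₗ re) (co F x₀ x ∘ₗ im)

variable {F}

theorem cfr_apply {x₀ x : M} (c : F × F) :
    (cfr F x₀ x c : ℂ ⊗[ℝ] E x) = mkC (fr F x₀ x c.1) (fr F x₀ x c.2) := rfl

theorem cco_mkC {x₀ x : M} (a b : E x) : cco F x₀ x (mkC a b) = (co F x₀ x a, co F x₀ x b) := by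
  simp [cco, re_mkC, im_mkC]

theorem cco_apply {x₀ x : M} (w : ℂ ⊗[ℝ] E x) :
    cco F x₀ x w = (co F x₀ x (re w), co F x₀ x (im w)) := rfl

theorem cco_cfr {x₀ x : M} (hx : x ∈ base F E x₀) (c : F × F) :
    cco F x₀ x (cfr F x₀ x c : ℂ ⊗[ℝ] E x) = c := by
  rw [cfr_apply, cco_mkC, co_fr F hx, co_fr F hx]

theorem cfr_cco {x₀ x : M} (hx : x ∈ base F E x₀) (w : ℂ ⊗[ℝ] E x) :
    cfr F x₀ x (cco F x₀ x w) = w := by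
  rw [cco_apply, cfr_apply, fr_co F hx, fr_co F hx, mkC_re_im]

theorem cfr_rotF {x₀ x : M} (c : F × F) :
    (cfr F x₀ x (rotF F c) : ℂ ⊗[ℝ] E x) = Complex.I • cfr F x₀ x c := by
  rw [rotF_apply, cfr_apply, cfr_apply, I_smul_mkC, map_neg]

theorem cco_I_smul {x₀ x : M} (w : ℂ ⊗[ℝ] E x) :
    cco F x₀ x (Complex.I • w) = rotF F (cco F x₀ x w) := by
  obtain ⟨a, b, rfl⟩ := exists_mkC w
  rw [I_smul_mkC, cco_mkC, cco_mkC, rotF_apply, map_neg]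

variable {p : Y → M} (S : ∀ y, Submodule ℂ (ℂ ⊗[ℝ] E (p y)))

variable (F) in
/-- The Hermitian projection onto `S y` in the frame given by the preferred trivialization at
`x₀`. -/
def coProj (x₀ : M) (y : Y) : F × F →L[ℝ] F × F :=
  LinearMap.toContinuousLinearMap
    (cco F x₀ (p y) ∘ₗ (projC (S y)).toLinearMap ∘ₗ cfr F x₀ (p y))

variable {S}

theorem coProj_apply {x₀ : M} {y : Y} (c : F × F) :
    coProj F S x₀ y c = cco F x₀ (p y) (projC (S y) (cfr F x₀ (p y) c)) := rfl

theorem cfr_coProj {x₀ : M} {y : Y} (hx : p y ∈ base F E x₀) (c : F × F) :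
    cfr F x₀ (p y) (coProj F S x₀ y c) = projC (S y) (cfr F x₀ (p y) c) := by
  rw [coProj_apply, cfr_cco hx]

theorem coProj_mul_coProj {x₀ : M} {y : Y} (hx : p y ∈ base F E x₀) :
    coProj F S x₀ y * coProj F S x₀ y = coProj F S x₀ y := by
  refine ContinuousLinearMap.ext fun c => ?_
  rw [mul_apply_eq_comp, coProj_apply (coProj F S x₀ y c), cfr_coProj hx,
    projC_eq_self (projC_mem _ _), coProj_apply]

theorem coProj_mul_rotF {x₀ : M} {y : Y} :
    coProj F S x₀ y * rotF F = rotF F * coProj F S x₀ y := by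
  refine ContinuousLinearMap.ext fun c => ?_
  rw [mul_apply_eq_comp, mul_apply_eq_comp, coProj_apply, cfr_rotF,
    projC_I_smul, cco_I_smul, coProj_apply]

theorem coProj_cco {x₀ : M} {y : Y} (hx : p y ∈ base F E x₀) (w : ℂ ⊗[ℝ] E (p y)) :
    coProj F S x₀ y (cco F x₀ (p y) w) = cco F x₀ (p y) (projC (S y) w) := by
  rw [coProj_apply, cfr_cco hx]

/-- Smooth maps into the Grassmannian bundle have smooth projectors in coordinates. -/
theorem contMDiffAt_coProj [FiniteDimensional ℝ EM] [T2Space M] [ContMDiffVectorBundle ∞ F E 𝓘(ℝ,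
    EM)]
    (hS : IsSmoothGr (EY := EY) (EM := EM) F S) {y₀ : Y} (hp : ContinuousAt p y₀) :
    ContMDiffAt 𝓘(ℝ, EY) 𝓘(ℝ, F × F →L[ℝ] F × F) ∞ (coProj F S (p y₀)) y₀ := by
  have hb := mem_base_self (E := E) F (p y₀)
  -- Smoothness of `S` is tested on global sections, so the local frame has to be cut off.
  obtain ⟨χ, hχ⟩ : ∃ χ : SmoothBumpFunction 𝓘(ℝ, EM) (p y₀), tsupport χ ⊆ base F E (p y₀) := by
    obtain ⟨χ, -, hχ⟩ := (SmoothBumpFunction.nhds_basis_tsupport (I := 𝓘(ℝ, EM)) (p y₀)).mem_iff.1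
      (base_mem_nhds F hb)
    exact ⟨χ, hχ⟩
  have key : ∀ b : F, ContMDiffAt 𝓘(ℝ, EY) 𝓘(ℝ, F × F) ∞
      (fun y => coProj F S (p y₀) y (b, 0)) y₀ := by
    intro b
    let t : ∀ x, E x := fun x => fr F (p y₀) x b
    have ht : ContMDiffOn 𝓘(ℝ, EM) (𝓘(ℝ, EM).prod 𝓘(ℝ, F)) ∞ (fun x => TotalSpace.mk' F x (t x))
        (base F E (p y₀)) := by
      intro x hx
      rw [(trivializationAt F E (p y₀)).contMDiffWithinAt_section _ hx]
      refine (contMDiffWithinAt_const (c := b)).congr (fun x' hx' => ?_) ?_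
      · rw [← co_eq F hx', co_fr F hx']
      · rw [← co_eq F hx, co_fr F hx]
    have hs : ContMDiff 𝓘(ℝ, EM) (𝓘(ℝ, EM).prod 𝓘(ℝ, F)) ∞
        (fun x => TotalSpace.mk' F x (((χ : M → ℝ) • t) x)) :=
      ContMDiffOn.smul_section_of_tsupport χ.contMDiff.contMDiffOn
        (trivializationAt F E (p y₀)).open_baseSet hχ ht
    obtain ⟨h1, h2⟩ := hS _ hs
    have h3 := (contMDiffAt_totalSpace.1 (h1.contMDiffAt (x := y₀))).2
    have h4 := (contMDiffAt_totalSpace.1 (h2.contMDiffAt (x := y₀))).2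
    refine (h3.prodMk_space h4).congr_of_eventuallyEq ?_
    filter_upwards [hp.eventually (base_mem_nhds F hb), hp.eventually χ.eventuallyEq_one]
      with y hy hy'
    have h5 : ((χ : M → ℝ) • t) (p y) = fr F (p y₀) (p y) b := by
      have : (χ : M → ℝ) (p y) • t (p y) = t (p y) := by rw [hy', Pi.one_apply, one_smul]
      exact this
    rw [← co_eq F hy, ← co_eq F hy, h5, coProj_apply, cfr_apply, map_zero, ← one_tmul_eq_mkC]
    rfl
  refine contMDiffAt_clm_of_apply fun c => ?_
  -- Global sections of `E` only reach real vectors; complex linearity of the projector gives the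
  -- others.
  have h : (fun y => coProj F S (p y₀) y c) = fun y =>
      coProj F S (p y₀) y (c.1, 0) + rotF F (coProj F S (p y₀) y (c.2, 0)) := by
    funext y
    have h1 := congrArg (fun L => L (c.2, (0 : F))) (coProj_mul_rotF (S := S) (x₀ := p y₀) (y := y))
    simp only [mul_apply_eq_comp] at h1
    rw [← h1, ← map_add, rotF_apply]
    simp
  rw [h]
  exact (key c.1).add ((rotF F).contMDiff.contMDiffAt.comp y₀ (key c.2))

end GrassmannCoordinates

/-! ### Differentials of maps into Grassmannian bundles, in coordinates -/

section GrassmannDifferential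

variable {EY : Type*} [NormedAddCommGroup EY] [NormedSpace ℝ EY]
  {Y : Type*} [TopologicalSpace Y] [ChartedSpace EY Y]
  {EM : Type*} [NormedAddCommGroup EM] [NormedSpace ℝ EM]
  {M : Type*} [TopologicalSpace M] [ChartedSpace EM M] [IsManifold 𝓘(ℝ, EM) ∞ M]
  {F : Type*} [NormedAddCommGroup F] [NormedSpace ℝ F] [FiniteDimensional ℝ F]
  {E : M → Type*} [TopologicalSpace (TotalSpace F E)]
  [∀ x, NormedAddCommGroup (E x)] [∀ x, InnerProductSpace ℝ (E x)]
  [∀ x, FiniteDimensional ℝ (E x)]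
  [FiberBundle F E] [VectorBundle ℝ F E]
  {p : Y → M}

theorem extendC_eq_cfr {x₀ x : M} (hx : x ∈ base F E x₀) (w : ℂ ⊗[ℝ] E x₀) :
    extendC F w x = cfr F x₀ x (cco F x₀ x₀ w) := by
  rw [extendC, extend_eq_fr F hx, extend_eq_fr F hx, cfr_apply, cco_apply]

theorem derivC_pullbackConn (D : (∀ x, E x) → ∀ x : M, TangentSpace 𝓘(ℝ, EM) x → E x)
    {s : ∀ y, ℂ ⊗[ℝ] E (p y)} {y : Y} (hp : ContinuousAt p y)
    (hs : MDifferentiableAt 𝓘(ℝ, EY) 𝓘(ℝ, F × F) (fun y' => cco F (p y) (p y') (s y')) y)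
    (v : TangentSpace 𝓘(ℝ, EY) y) :
    derivC (pullbackConn F D p) s y v =
      cfr F (p y) (p y) (mvfderiv 𝓘(ℝ, EY) (fun y' => cco F (p y) (p y') (s y')) y v)
      + mkC (D (FiberBundle.extend F (re (s y))) (p y) (mfderiv 𝓘(ℝ, EY) 𝓘(ℝ, EM) p y v))
        (D (FiberBundle.extend F (im (s y))) (p y) (mfderiv 𝓘(ℝ, EY) 𝓘(ℝ, EM) p y v)) := by
  have h1 := mvfderiv_clm (ContinuousLinearMap.fst ℝ F F) hs v
  have h2 := mvfderiv_clm (ContinuousLinearMap.snd ℝ F F) hs v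
  rw [derivC, pullbackConn, pullbackConn, trivDeriv_eq _ hp, trivDeriv_eq _ hp, ← mkC_add]
  exact congrArg₂ (· + ·) (congrArg₂ mkC (congrArg (fr F (p y) (p y)) h1)
    (congrArg (fr F (p y) (p y)) h2)) rfl

variable [ContMDiffVectorBundle 1 F E 𝓘(ℝ, EM)]

theorem derivC_trivDeriv {s : ∀ y, ℂ ⊗[ℝ] E (p y)} {x₀ : M} {y : Y} (hx : p y ∈ base F E x₀)
    (hp : MDifferentiableAt 𝓘(ℝ, EY) 𝓘(ℝ, EM) p y)
    (hs : MDifferentiableAt 𝓘(ℝ, EY) 𝓘(ℝ, F × F) (fun y' => cco F x₀ (p y') (s y')) y)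
    {v : TangentSpace 𝓘(ℝ, EY) y} (hv : v ∈ vert EY EM p y) :
    derivC (trivDeriv F p) s y v =
      cfr F x₀ (p y) (mvfderiv 𝓘(ℝ, EY) (fun y' => cco F x₀ (p y') (s y')) y v) := by
  have h1 := mvfderiv_clm (ContinuousLinearMap.fst ℝ F F) hs v
  have h2 := mvfderiv_clm (ContinuousLinearMap.snd ℝ F F) hs v
  have h3 := (ContinuousLinearMap.fst ℝ F F).differentiableAt.comp_mdifferentiableAt hs
  have h4 := (ContinuousLinearMap.snd ℝ F F).differentiableAt.comp_mdifferentiableAt hs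
  rw [derivC, trivDeriv_eq_of_mem_vert hx hp h3 hv, trivDeriv_eq_of_mem_vert hx hp h4 hv]
  exact congrArg₂ mkC (congrArg (fr F x₀ (p y)) h1) (congrArg (fr F x₀ (p y)) h2)

theorem mdifferentiableAt_cco_extendC {x₀ x : M} (hx : x ∈ base F E x₀) (w : ℂ ⊗[ℝ] E x) :
    MDifferentiableAt 𝓘(ℝ, EM) 𝓘(ℝ, F × F) (fun x' => cco F x₀ x' (extendC F w x')) x := by
  have h : ∀ v : E x, MDifferentiableAt 𝓘(ℝ, EM) 𝓘(ℝ, F)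
      (fun x' => co F x₀ x' (FiberBundle.extend F v x')) x := fun v =>
    (mdifferentiableAt_along_iff (p := fun x : M => x) hx mdifferentiableAt_id).1
      (FiberBundle.mdifferentiableAt_extend 𝓘(ℝ, EM) F v)
  have h1 := (h (re w)).prodMk_space (h (im w))
  simp only [extendC, cco_mkC]
  exact h1

variable {S : ∀ y, Submodule ℂ (ℂ ⊗[ℝ] E (p y))}

/-- The coordinates of the extension of `w` depend only on the point of `M`, so their vertical
derivative is zero and only the derivative of the projector matrix remains. -/
theorem grDeriv_vert {x₀ : M} {y : Y} (hx : p y ∈ base F E x₀)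
    (hp : MDifferentiableAt 𝓘(ℝ, EY) 𝓘(ℝ, EM) p y)
    (hQ : MDifferentiableAt 𝓘(ℝ, EY) 𝓘(ℝ, F × F →L[ℝ] F × F) (coProj F S x₀) y)
    {v : TangentSpace 𝓘(ℝ, EY) y} (hv : v ∈ vert EY EM p y) (w : ℂ ⊗[ℝ] E (p y)) :
    grDeriv F (trivDeriv F p) S y v w =
      cfr F x₀ (p y) (mvfderiv 𝓘(ℝ, EY) (coProj F S x₀) y v (cco F x₀ (p y) w)) := by
  have hc := mdifferentiableAt_cco_extendC (EM := EM) hx w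
  have hc' : MDifferentiableAt 𝓘(ℝ, EY) 𝓘(ℝ, F × F)
      (fun y' => cco F x₀ (p y') (extendC F w (p y'))) y := hc.comp y hp
  have hc0 : mvfderiv 𝓘(ℝ, EY) (fun y' => cco F x₀ (p y') (extendC F w (p y'))) y v = 0 := by
    rw [mvfderiv_comp_mfderiv hc hp, show mfderiv 𝓘(ℝ, EY) 𝓘(ℝ, EM) p y v = 0 from hv, map_zero]
  have h1 : (fun y' => cco F x₀ (p y') (projC (S y') (extendC F w (p y')))) =ᶠ[𝓝 y]
      fun y' => coProj F S x₀ y' (cco F x₀ (p y') (extendC F w (p y'))) := by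
    filter_upwards [hp.continuousAt.eventually (base_mem_nhds F hx)] with y' hy'
    rw [coProj_cco hy']
  have h2 := (hQ.clm_apply hc').congr_of_eventuallyEq h1
  rw [grDeriv, derivC_trivDeriv hx hp h2 hv, derivC_trivDeriv hx hp hc' hv, hc0, map_zero,
    map_zero, sub_zero, mvfderiv_congr h1, mvfderiv_clm_apply hQ hc' v]
  erw [hc0]
  rw [map_zero, add_zero, show extendC F w (p y) = w by
    rw [extendC, FiberBundle.extend_apply_self, FiberBundle.extend_apply_self, mkC_re_im]]

/-- Differentiating `s = P s` gives `D s = (D P) s + P (D s)`. If `D P` vanishes in the direction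
`v`, the result is in the image of `P`. -/
theorem derivC_mem (D : (∀ x, E x) → ∀ x : M, TangentSpace 𝓘(ℝ, EM) x → E x)
    {s : ∀ y, ℂ ⊗[ℝ] E (p y)} {y : Y} (hp : MDifferentiableAt 𝓘(ℝ, EY) 𝓘(ℝ, EM) p y)
    (hs : MDifferentiableAt 𝓘(ℝ, EY) 𝓘(ℝ, F × F) (fun y' => cco F (p y) (p y') (s y')) y)
    (hQ : MDifferentiableAt 𝓘(ℝ, EY) 𝓘(ℝ, F × F →L[ℝ] F × F) (coProj F S (p y)) y)
    {v : TangentSpace 𝓘(ℝ, EY) y} (hv : ∀ w, grDeriv F (pullbackConn F D p) S y v w = 0)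
    (hsS : ∀ᶠ y' in 𝓝 y, s y' ∈ S y') : derivC (pullbackConn F D p) s y v ∈ S y := by
  have hx := mem_base_self (E := E) F (p y)
  set w := s y with hw
  have hwS : projC (S y) w = w := projC_eq_self hsS.self_of_nhds
  have hext : extendC F w (p y) = w := by
    rw [extendC, FiberBundle.extend_apply_self, FiberBundle.extend_apply_self, mkC_re_im]
  have hc := mdifferentiableAt_cco_extendC (EM := EM) hx w
  have hc' : MDifferentiableAt 𝓘(ℝ, EY) 𝓘(ℝ, F × F)
      (fun y' => cco F (p y) (p y') (extendC F w (p y'))) y := hc.comp y hp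
  have hc0 : mvfderiv 𝓘(ℝ, EY) (fun y' => cco F (p y) (p y') (extendC F w (p y'))) y v = 0 := by
    rw [mvfderiv_congr (g := fun _ => cco F (p y) (p y) w) ?_, mvfderiv_const]
    · rfl
    · filter_upwards [hp.continuousAt.eventually (base_mem_nhds F hx)] with y' hy'
      rw [extendC_eq_cfr hy', cco_cfr hy']
  have h1 : (fun y' => cco F (p y) (p y') (projC (S y') (extendC F w (p y')))) =ᶠ[𝓝 y]
      fun y' => coProj F S (p y) y' (cco F (p y) (p y') (extendC F w (p y'))) := by
    filter_upwards [hp.continuousAt.eventually (base_mem_nhds F hx)] with y' hy'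
    rw [coProj_cco hy']
  have h2 := (hQ.clm_apply hc').congr_of_eventuallyEq h1
  have h3 : (fun y' => cco F (p y) (p y') (s y')) =ᶠ[𝓝 y]
      fun y' => coProj F S (p y) y' (cco F (p y) (p y') (s y')) := by
    filter_upwards [hp.continuousAt.eventually (base_mem_nhds F hx), hsS] with y' hy' hs'
    rw [coProj_cco hy', projC_eq_self hs']
  set dQ : F × F →L[ℝ] F × F := mvfderiv 𝓘(ℝ, EY) (coProj F S (p y)) y v with hdQ
  set ds : F × F := mvfderiv 𝓘(ℝ, EY) (fun y' => cco F (p y) (p y') (s y')) y v with hds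
  -- The relation `s = P s` differentiated in coordinates; the term with `dQ` together with the
  -- connection term is in `S y` by `h5` below.
  have h4 : ds = dQ (cco F (p y) (p y) w) + coProj F S (p y) y ds := by
    have h := mvfderiv_clm_apply hQ hs v
    rw [← mvfderiv_congr h3] at h
    exact h
  have h5 := hv w
  rw [grDeriv, derivC_pullbackConn D hp.continuousAt h2, derivC_pullbackConn D hp.continuousAt hc',
    hc0, map_zero, zero_add, mvfderiv_congr h1, mvfderiv_clm_apply hQ hc' v] at h5
  erw [hc0] at h5
  rw [map_zero, add_zero, hext, hwS, sub_eq_zero] at h5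
  rw [derivC_pullbackConn D hp.continuousAt hs, ← hds, ← hw, h4, map_add, cfr_coProj hx,
    add_right_comm]
  refine add_mem ?_ (projC_mem _ _)
  exact h5 ▸ projC_mem _ _

end GrassmannDifferential

theorem mvfderiv_comp_of_mem_vert {EY : Type*} [NormedAddCommGroup EY] [NormedSpace ℝ EY]
    {Y : Type*} [TopologicalSpace Y] [ChartedSpace EY Y]
    {EM : Type*} [NormedAddCommGroup EM] [NormedSpace ℝ EM]
    {M : Type*} [TopologicalSpace M] [ChartedSpace EM M]
    {G : Type*} [NormedAddCommGroup G] [NormedSpace ℝ G] {p : Y → M} {g : M → G} {y : Y}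
    (hg : MDifferentiableAt 𝓘(ℝ, EM) 𝓘(ℝ, G) g (p y))
    (hp : MDifferentiableAt 𝓘(ℝ, EY) 𝓘(ℝ, EM) p y) {v : TangentSpace 𝓘(ℝ, EY) y}
    (hv : v ∈ vert EY EM p y) : mvfderiv 𝓘(ℝ, EY) (fun y' => g (p y')) y v = 0 := by
  rw [mvfderiv_comp_mfderiv hg hp, show mfderiv 𝓘(ℝ, EY) 𝓘(ℝ, EM) p y v = 0 from hv, map_zero]

/-! ### The differential of the projector along the fibres -/

section GrassmannVertical

variable {EY : Type*} [NormedAddCommGroup EY] [NormedSpace ℝ EY]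
  {Y : Type*} [TopologicalSpace Y] [ChartedSpace EY Y]
  {EM : Type*} [NormedAddCommGroup EM] [NormedSpace ℝ EM] [FiniteDimensional ℝ EM]
  {M : Type*} [TopologicalSpace M] [ChartedSpace EM M] [IsManifold 𝓘(ℝ, EM) ∞ M]
  {F : Type*} [NormedAddCommGroup F] [NormedSpace ℝ F] [FiniteDimensional ℝ F]
  {E : M → Type*} [TopologicalSpace (TotalSpace F E)]
  [∀ x, NormedAddCommGroup (E x)] [∀ x, InnerProductSpace ℝ (E x)]
  [∀ x, FiniteDimensional ℝ (E x)]
  [FiberBundle F E] [VectorBundle ℝ F E]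
  {p : Y → M}

variable (F E) in
/-- The inner product of the complexification of `E` in the frame `cfr`. -/
def coGram (x₀ x : M) : F × F →L[ℝ] F × F →L[ℝ] ℝ :=
  ((innerₗ (ℂ ⊗[ℝ] E x)).compl₁₂ (cfr F x₀ x) (cfr F x₀ x)).toContinuousBilinearMap

theorem coGram_apply {x₀ x : M} (a b : F × F) :
    coGram F E x₀ x a b = inner ℝ (cfr F x₀ x a : ℂ ⊗[ℝ] E x) (cfr F x₀ x b) := rfl

theorem mdifferentiableAt_coGram [ContMDiffVectorBundle ∞ F E 𝓘(ℝ, EM)]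
    [IsContMDiffRiemannianBundle 𝓘(ℝ, EM) ∞ F E] {x₀ x : M} (hx : x ∈ base F E x₀) :
    MDifferentiableAt 𝓘(ℝ, EM) 𝓘(ℝ, F × F →L[ℝ] F × F →L[ℝ] ℝ) (coGram F E x₀) x := by
  have : ContMDiffVectorBundle 1 F E 𝓘(ℝ, EM) := ContMDiffVectorBundle.of_le (n := ∞) (by norm_cast)
  have hfr : ∀ c : F, MDifferentiableAt 𝓘(ℝ, EM) (𝓘(ℝ, EM).prod 𝓘(ℝ, F))
      (fun x => TotalSpace.mk' F x (fr F x₀ x c : E x)) x := fun c =>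
    mdifferentiableAt_fr (p := fun x : M => x) hx mdifferentiableAt_id mdifferentiableAt_const
  refine mdifferentiableAt_clm_of_apply fun a => mdifferentiableAt_clm_of_apply fun b => ?_
  simp only [coGram_apply, cfr_apply, inner_mkC]
  exact ((hfr a.1).inner_bundle (hfr b.1)).add ((hfr a.2).inner_bundle (hfr b.2))

variable {S : ∀ y, Submodule ℂ (ℂ ⊗[ℝ] E (p y))} {x₀ : M} {y : Y}

theorem coGram_coProj_left (hx : p y ∈ base F E x₀) (a b : F × F) :
    coGram F E x₀ (p y) (coProj F S x₀ y a) b = coGram F E x₀ (p y) a (coProj F S x₀ y b) := by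
  rw [coGram_apply, coGram_apply, cfr_coProj hx, cfr_coProj hx, inner_projC_left]

theorem coGram_rotF_left (x : M) (a b : F × F) :
    coGram F E x₀ x (rotF F a) b = -coGram F E x₀ x a (rotF F b) := by
  rw [coGram_apply, coGram_apply, cfr_rotF, cfr_rotF, inner_I_smul_left]

theorem eq_of_coGram {x : M} (hx : x ∈ base F E x₀) {a b : F × F}
    (h : ∀ c, coGram F E x₀ x a c = coGram F E x₀ x b c) : a = b := by
  have h1 : cfr F x₀ x a = (cfr F x₀ x b : ℂ ⊗[ℝ] E x) := by
    refine ext_inner_right ℝ fun w => ?_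
    rw [← cfr_cco hx w]
    exact h _
  rw [← cco_cfr (E := E) hx a, h1, cco_cfr hx]

variable (hx : p y ∈ base F E x₀)
  (hp : MDifferentiableAt 𝓘(ℝ, EY) 𝓘(ℝ, EM) p y)
  (hQ : MDifferentiableAt 𝓘(ℝ, EY) 𝓘(ℝ, F × F →L[ℝ] F × F) (coProj F S x₀) y)

include hx hp hQ

theorem mvfderiv_coProj_eq (v : TangentSpace 𝓘(ℝ, EY) y) :
    mvfderiv 𝓘(ℝ, EY) (coProj F S x₀) y v =
      mvfderiv 𝓘(ℝ, EY) (coProj F S x₀) y v * coProj F S x₀ y +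
      coProj F S x₀ y * mvfderiv 𝓘(ℝ, EY) (coProj F S x₀) y v := by
  have h1 : coProj F S x₀ =ᶠ[𝓝 y] fun y' => coProj F S x₀ y' * coProj F S x₀ y' := by
    filter_upwards [hp.continuousAt.eventually (base_mem_nhds F hx)] with y' hy'
    rw [coProj_mul_coProj hy']
  have h2 := mvfderiv_bilin (ContinuousLinearMap.mul ℝ (F × F →L[ℝ] F × F)) hQ hQ v
  exact (congrArg (fun L => L v) (mvfderiv_congr h1)).trans h2

omit hx hp in
theorem mvfderiv_coProj_mul_rotF (v : TangentSpace 𝓘(ℝ, EY) y) :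
    mvfderiv 𝓘(ℝ, EY) (coProj F S x₀) y v * rotF F =
      rotF F * mvfderiv 𝓘(ℝ, EY) (coProj F S x₀) y v := by
  have h1 := mvfderiv_clm ((ContinuousLinearMap.mul ℝ (F × F →L[ℝ] F × F)).flip (rotF F)) hQ v
  have h2 := mvfderiv_clm (ContinuousLinearMap.mul ℝ (F × F →L[ℝ] F × F) (rotF F)) hQ v
  refine h1.symm.trans (Eq.trans ?_ h2)
  exact congrArg (fun k => mvfderiv 𝓘(ℝ, EY) k y v) (funext fun y' => coProj_mul_rotF)

variable [ContMDiffVectorBundle ∞ F E 𝓘(ℝ, EM)] [IsContMDiffRiemannianBundle 𝓘(ℝ, EM) ∞ F E]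

set_option synthInstance.maxHeartbeats 200000 in
-- Self-adjointness of the projector is differentiated; the Gram form comes from `M`, so it is
-- constant to first order along `v`.
theorem coGram_mvfderiv_coProj {v : TangentSpace 𝓘(ℝ, EY) y} (hv : v ∈ vert EY EM p y)
    (a b : F × F) : coGram F E x₀ (p y) (mvfderiv 𝓘(ℝ, EY) (coProj F S x₀) y v a) b =
      coGram F E x₀ (p y) a (mvfderiv 𝓘(ℝ, EY) (coProj F S x₀) y v b) := by
  have hΓ := mdifferentiableAt_coGram (EM := EM) hx
  have hΓp : MDifferentiableAt 𝓘(ℝ, EY) 𝓘(ℝ, F × F →L[ℝ] F × F →L[ℝ] ℝ)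
      (fun y' => coGram F E x₀ (p y')) y := hΓ.comp y hp
  have hΓ0 : mvfderiv 𝓘(ℝ, EY) (fun y' => coGram F E x₀ (p y')) y v = 0 :=
    mvfderiv_comp_of_mem_vert hΓ hp hv
  have hc : ∀ c : F × F, MDifferentiableAt 𝓘(ℝ, EY) 𝓘(ℝ, F × F) (fun _ => c) y := fun c =>
    mdifferentiableAt_const
  have hQc : ∀ c : F × F, MDifferentiableAt 𝓘(ℝ, EY) 𝓘(ℝ, F × F) (fun y' => coProj F S x₀ y' c) y :=
    fun c => hQ.clm_apply (hc c)
  have h0 : ∀ c : F × F, mvfderiv 𝓘(ℝ, EY) (fun _ : Y => c) y v = 0 := fun c => by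
    rw [mvfderiv_const]; rfl
  have hdQ : ∀ c : F × F, mvfderiv 𝓘(ℝ, EY) (fun y' => coProj F S x₀ y' c) y v =
      mvfderiv 𝓘(ℝ, EY) (coProj F S x₀) y v c := fun c => by
    rw [mvfderiv_clm_apply hQ (hc c) v]
    erw [h0]
    rw [map_zero, add_zero]
  have h1 := mvfderiv_clm_apply (hΓp.clm_apply (hQc a)) (hc b) v
  have h2 := mvfderiv_clm_apply hΓp (hQc a) v
  have h3 := mvfderiv_clm_apply (hΓp.clm_apply (hc a)) (hQc b) v
  have h4 := mvfderiv_clm_apply hΓp (hc a) v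
  have h5 : (fun y' => coGram F E x₀ (p y') (coProj F S x₀ y' a) b) =ᶠ[𝓝 y]
      fun y' => coGram F E x₀ (p y') a (coProj F S x₀ y' b) := by
    filter_upwards [hp.continuousAt.eventually (base_mem_nhds F hx)] with y' hy'
    exact coGram_coProj_left hy' a b
  rw [mvfderiv_congr h5, h3, h2, h4] at h1
  erw [hΓ0, h0, h0, hdQ, hdQ] at h1
  simp only [_root_.zero_apply, map_zero, zero_add, add_zero] at h1
  exact h1.symm

/-- Holomorphy gives `dP(v) P = i dP(u) P`; its adjoint is `P dP(v) = -i P dP(u)`. Their sum is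
`dP(v)`, since `P² = P` gives `dP = dP P + P dP`. This is the complex structure of the Grassmannian
in terms of projectors. -/
theorem mvfderiv_coProj_of_holomorphic {u v : TangentSpace 𝓘(ℝ, EY) y} (hu : u ∈ vert EY EM p y)
    (hv : v ∈ vert EY EM p y) (h : ∀ w ∈ S y, grDeriv F (trivDeriv F p) S y v w
      = Complex.I • grDeriv F (trivDeriv F p) S y u w) :
    mvfderiv 𝓘(ℝ, EY) (coProj F S x₀) y v =
      rotF F * (mvfderiv 𝓘(ℝ, EY) (coProj F S x₀) y u * coProj F S x₀ y
        - coProj F S x₀ y * mvfderiv 𝓘(ℝ, EY) (coProj F S x₀) y u) := by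
  have : ContMDiffVectorBundle 1 F E 𝓘(ℝ, EM) := ContMDiffVectorBundle.of_le (n := ∞) (by norm_cast)
  have hru := mvfderiv_coProj_mul_rotF hQ u
  have hsu := coGram_mvfderiv_coProj hx hp hQ hu
  have hsv := coGram_mvfderiv_coProj hx hp hQ hv
  have hev := mvfderiv_coProj_eq hx hp hQ v
  have h1 : mvfderiv 𝓘(ℝ, EY) (coProj F S x₀) y v * coProj F S x₀ y =
      rotF F * (mvfderiv 𝓘(ℝ, EY) (coProj F S x₀) y u * coProj F S x₀ y) := by
    refine ContinuousLinearMap.ext fun c => ?_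
    have h2 := h (cfr F x₀ (p y) (coProj F S x₀ y c)) (by
      rw [cfr_coProj hx]; exact projC_mem _ _)
    rw [grDeriv_vert hx hp hQ hv, grDeriv_vert hx hp hQ hu, cco_cfr hx, ← cfr_rotF] at h2
    have h3 := congrArg (cco F x₀ (p y)) h2
    rwa [cco_cfr hx, cco_cfr hx] at h3
  generalize mvfderiv 𝓘(ℝ, EY) (coProj F S x₀) y u = A at *
  generalize mvfderiv 𝓘(ℝ, EY) (coProj F S x₀) y v = B at *
  -- The adjoint of `h1`: projector and differentials are self-adjoint, multiplication by `i` is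
  -- skew and commutes with them.
  have h2 : coProj F S x₀ y * B = -(rotF F * (coProj F S x₀ y * A)) := by
    refine ContinuousLinearMap.ext fun c => eq_of_coGram (E := E) hx fun d => ?_
    have h3 := congrArg (fun L => coGram F E x₀ (p y) c (L d)) h1
    have h4 := congrArg (fun L => L (coProj F S x₀ y d)) hru
    have h5 := congrArg (fun L => L d) (coProj_mul_rotF (F := F) (S := S) (x₀ := x₀) (y := y))
    simp only [mul_apply_eq_comp] at h3 h4 h5
    simp only [mul_apply_eq_comp, _root_.neg_apply, map_neg]
    rw [coGram_coProj_left hx, hsv, h3, coGram_rotF_left, coGram_coProj_left hx, hsu, neg_neg, h5,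
      h4]
  rw [mul_sub, sub_eq_add_neg, ← h1, ← h2]
  exact hev

end GrassmannVertical

/-! ### Traces of complex linear maps and the Grassmannian metric -/

section Trace

variable {F : Type*} [NormedAddCommGroup F] [NormedSpace ℝ F] [FiniteDimensional ℝ F]

/-- Commuting with `i` makes the two diagonal blocks of `T` equal. -/
theorem trace_eq_of_commute_rotF {T : F × F →L[ℝ] F × F} (hT : T * rotF F = rotF F * T) :
    LinearMap.trace ℝ (F × F) T.toLinearMap =
      2 * LinearMap.trace ℝ F (LinearMap.fst ℝ F F ∘ₗ T.toLinearMap ∘ₗ LinearMap.inl ℝ F F) := by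
  have h1 : T.toLinearMap = (T.toLinearMap ∘ₗ LinearMap.inl ℝ F F) ∘ₗ LinearMap.fst ℝ F F +
      (T.toLinearMap ∘ₗ LinearMap.inr ℝ F F) ∘ₗ LinearMap.snd ℝ F F := by
    refine LinearMap.ext fun c => ?_
    simp only [LinearMap.add_apply, LinearMap.comp_apply]
    rw [← map_add]
    congr 1
    ext <;> simp
  have h2 : LinearMap.snd ℝ F F ∘ₗ T.toLinearMap ∘ₗ LinearMap.inr ℝ F F =
      LinearMap.fst ℝ F F ∘ₗ T.toLinearMap ∘ₗ LinearMap.inl ℝ F F := by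
    refine LinearMap.ext fun b => ?_
    have h3 := congrArg (fun L => (L (b, (0 : F))).2) hT
    simpa [rotF_apply] using h3
  conv_lhs => rw [h1]
  rw [map_add, LinearMap.trace_comp_comm' (LinearMap.fst ℝ F F),
    LinearMap.trace_comp_comm' (LinearMap.snd ℝ F F), h2]
  ring

end Trace

section Metric

variable {EY : Type*} [NormedAddCommGroup EY] [NormedSpace ℝ EY]
  {Y : Type*} [TopologicalSpace Y] [ChartedSpace EY Y]
  {EM : Type*} [NormedAddCommGroup EM] [NormedSpace ℝ EM] [FiniteDimensional ℝ EM]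
  {M : Type*} [TopologicalSpace M] [ChartedSpace EM M] [IsManifold 𝓘(ℝ, EM) ∞ M]
  {F : Type*} [NormedAddCommGroup F] [NormedSpace ℝ F] [FiniteDimensional ℝ F]
  {E : M → Type*} [TopologicalSpace (TotalSpace F E)]
  [∀ x, NormedAddCommGroup (E x)] [∀ x, InnerProductSpace ℝ (E x)]
  [∀ x, FiniteDimensional ℝ (E x)]
  [FiberBundle F E] [VectorBundle ℝ F E]
  [ContMDiffVectorBundle ∞ F E 𝓘(ℝ, EM)] [IsContMDiffRiemannianBundle 𝓘(ℝ, EM) ∞ F E]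
  {p : Y → M} {S : ∀ y, Submodule ℂ (ℂ ⊗[ℝ] E (p y))} {x₀ : M} {y : Y}

/-- With `A`, `B` the differentials of the projector, `⟨A e, B e⟩ = ⟨e, A B e⟩`. The sum over a real
orthonormal basis is the trace of the real block of `A B`, which is half of its real trace. -/
theorem grMetric_eq_trace (hx : p y ∈ base F E x₀) (hp : MDifferentiableAt 𝓘(ℝ, EY) 𝓘(ℝ, EM) p y)
    (hQ : MDifferentiableAt 𝓘(ℝ, EY) 𝓘(ℝ, F × F →L[ℝ] F × F) (coProj F S x₀) y)
    {u v : TangentSpace 𝓘(ℝ, EY) y} (hu : u ∈ vert EY EM p y) (hv : v ∈ vert EY EM p y) :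
    grMetric F S y u v = 1 / 2 * LinearMap.trace ℝ (F × F)
      (mvfderiv 𝓘(ℝ, EY) (coProj F S x₀) y u * mvfderiv 𝓘(ℝ, EY) (coProj F S x₀) y v :
        F × F →L[ℝ] F × F).toLinearMap := by
  have : ContMDiffVectorBundle 1 F E 𝓘(ℝ, EM) := ContMDiffVectorBundle.of_le (n := ∞) (by norm_cast)
  have hru := mvfderiv_coProj_mul_rotF hQ u
  have hrv := mvfderiv_coProj_mul_rotF hQ v
  have hsu := coGram_mvfderiv_coProj hx hp hQ hu
  have hgu := grDeriv_vert hx hp hQ hu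
  have hgv := grDeriv_vert hx hp hQ hv
  rw [grMetric]
  simp only [hgu, hgv]
  generalize mvfderiv 𝓘(ℝ, EY) (coProj F S x₀) y u = A at *
  generalize mvfderiv 𝓘(ℝ, EY) (coProj F S x₀) y v = B at *
  have hT : (A * B) * rotF F = rotF F * (A * B) := by
    rw [mul_assoc, hrv, ← mul_assoc, hru, mul_assoc]
  rw [trace_eq_of_commute_rotF hT]
  set T : F →ₗ[ℝ] F := LinearMap.fst ℝ F F ∘ₗ (A * B).toLinearMap ∘ₗ LinearMap.inl ℝ F F with hTdef
  have h1 : T = (T ∘ₗ co F x₀ (p y)) ∘ₗ (fr F x₀ (p y) : F →ₗ[ℝ] E (p y)) := by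
    refine LinearMap.ext fun c => ?_
    simp only [LinearMap.comp_apply]
    rw [co_fr F hx]
  rw [h1, ← LinearMap.trace_comp_comm',
    LinearMap.trace_eq_sum_inner _ (stdOrthonormalBasis ℝ (E (p y)))]
  rw [← mul_assoc, one_div, inv_mul_cancel₀ two_ne_zero, one_mul]
  refine Finset.sum_congr rfl fun i _ => ?_
  set e := stdOrthonormalBasis ℝ (E (p y)) i
  have h2 := hsu (cco F x₀ (p y) ((1 : ℂ) ⊗ₜ[ℝ] e)) (B (cco F x₀ (p y) ((1 : ℂ) ⊗ₜ[ℝ] e)))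
  refine h2.trans ?_
  rw [coGram_apply, cfr_cco hx, one_tmul_eq_mkC, cfr_apply, inner_mkC, inner_zero_left, add_zero,
    cco_mkC, map_zero]
  rfl

end Metric

/-! ### The Kähler property of metrics induced by maps into spaces of projections -/

section Kaehler

variable {EY : Type*} [NormedAddCommGroup EY] [NormedSpace ℝ EY] [FiniteDimensional ℝ EY]
  {Y : Type*} [TopologicalSpace Y]
  [ChartedSpace EY Y] [IsManifold 𝓘(ℝ, EY) ∞ Y]
  [RiemannianBundle (fun y : Y => TangentSpace 𝓘(ℝ, EY) y)]
  [IsContMDiffRiemannianBundle 𝓘(ℝ, EY) ∞ EY (fun y : Y => TangentSpace 𝓘(ℝ, EY) y)]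
  {𝒜 : Type*} [NormedRing 𝒜] [NormedAlgebra ℝ 𝒜]
  {τ : 𝒜 →L[ℝ] ℝ} (hτ : ∀ a b, τ (a * b) = τ (b * a))
  {Q : Y → 𝒜} {y : Y} (hQ : ContMDiffAt 𝓘(ℝ, EY) 𝓘(ℝ, 𝒜) 2 Q y)
  {D : ∀ y : Y, Submodule ℝ (TangentSpace 𝓘(ℝ, EY) y)}
  (hD : ∀ᶠ y' in 𝓝 y, ∀ u ∈ D y', ∀ v ∈ D y',
    (inner ℝ u v : ℝ) = τ (mvfderiv 𝓘(ℝ, EY) Q y' u * mvfderiv 𝓘(ℝ, EY) Q y' v))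

/-- A vector field which is differentiable at `y` and, near `y`, takes values in `D`. -/
structure IsFieldIn (D : ∀ y : Y, Submodule ℝ (TangentSpace 𝓘(ℝ, EY) y))
    (U : ∀ y : Y, TangentSpace 𝓘(ℝ, EY) y) (y : Y) : Prop where
  mdiff : MDiffAt (T% U) y
  mem : ∀ᶠ y' in 𝓝 y, U y' ∈ D y'

variable (hbr : ∀ U V : ∀ y : Y, TangentSpace 𝓘(ℝ, EY) y, IsFieldIn D U y → IsFieldIn D V y →
    mlieBracket 𝓘(ℝ, EY) U V y ∈ D y)
  {U V W : ∀ y : Y, TangentSpace 𝓘(ℝ, EY) y}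

include hQ hD in
theorem mvfderiv_inner_of_metric (hU : IsFieldIn D U y) (hV : IsFieldIn D V y)
    (w : TangentSpace 𝓘(ℝ, EY) y) :
    mvfderiv 𝓘(ℝ, EY) (fun y' => (inner ℝ (U y') (V y') : ℝ)) y w =
      τ (mvfderiv 𝓘(ℝ, EY) (fun y' => mvfderiv 𝓘(ℝ, EY) Q y' (U y')) y w
          * mvfderiv 𝓘(ℝ, EY) Q y (V y))
      + τ (mvfderiv 𝓘(ℝ, EY) Q y (U y) *
          mvfderiv 𝓘(ℝ, EY) (fun y' => mvfderiv 𝓘(ℝ, EY) Q y' (V y')) y w) := by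
  have h1 : (fun y' => (inner ℝ (U y') (V y') : ℝ)) =ᶠ[𝓝 y] fun y' =>
      τ (mvfderiv 𝓘(ℝ, EY) Q y' (U y') * mvfderiv 𝓘(ℝ, EY) Q y' (V y')) := by
    filter_upwards [hD, hU.mem, hV.mem] with y' h hu hv
    exact h _ hu _ hv
  have h2 := mdifferentiableAt_mvfderiv_field hQ hU.mdiff
  have h3 := mdifferentiableAt_mvfderiv_field hQ hV.mdiff
  have h4 := mvfderiv_bilin (ContinuousLinearMap.mul ℝ 𝒜) h2 h3 w
  have h5 := mvfderiv_clm τ (mdifferentiableAt_bilin (ContinuousLinearMap.mul ℝ 𝒜) h2 h3) w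
  rw [mvfderiv_congr h1]
  refine h5.trans ((congrArg τ h4).trans ?_)
  rw [map_add]
  rfl

include hτ hQ hD hbr in
-- For a metric induced by a map into a flat space, the Levi-Civita derivative is the tangential
-- part of the flat one. In the Koszul formula the other second order terms cancel by cyclicity of
-- `τ`; involutivity of `D` at `y` allows the metric formula for the brackets.
theorem inner_leviCivita_of_metric (hU : IsFieldIn D U y) (hV : IsFieldIn D V y)
    (hW : IsFieldIn D W y) :
    (inner ℝ (leviCivita V y (U y)) (W y) : ℝ) =
      τ (mvfderiv 𝓘(ℝ, EY) (fun y' => mvfderiv 𝓘(ℝ, EY) Q y' (V y')) y (U y) *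
        mvfderiv 𝓘(ℝ, EY) Q y (W y)) := by
  have hDy := hD.self_of_nhds
  rw [inner_leviCivita hU.mdiff hV.mdiff hW.mdiff, koszul,
    mvfderiv_inner_of_metric hQ hD hV hW, mvfderiv_inner_of_metric hQ hD hU hW,
    mvfderiv_inner_of_metric hQ hD hU hV,
    hDy _ (hbr U V hU hV) _ hW.mem.self_of_nhds, hDy _ (hbr U W hU hW) _ hV.mem.self_of_nhds,
    hDy _ (hbr V W hV hW) _ hU.mem.self_of_nhds, mvfderiv_mlieBracket hQ hU.mdiff hV.mdiff,
    mvfderiv_mlieBracket hQ hU.mdiff hW.mdiff, mvfderiv_mlieBracket hQ hV.mdiff hW.mdiff]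
  simp only [sub_mul, map_sub]
  rw [hτ (mvfderiv 𝓘(ℝ, EY) Q y (V y)), hτ (mvfderiv 𝓘(ℝ, EY) Q y (U y)),
    hτ (mvfderiv 𝓘(ℝ, EY) Q y (U y))]
  ring

include hτ hQ hD hbr in
/-- If the metric is induced by a holomorphic map `Q` into a space of projections then
`[U, JU] = J (∇_U U + ∇_{JU} JU)`. -/
theorem inner_mlieBracket_of_kaehler {U' W' : ∀ y : Y, TangentSpace 𝓘(ℝ, EY) y} {i : 𝒜}
    (hiQ : Q y * i = i * Q y) (hiW : mvfderiv 𝓘(ℝ, EY) Q y (W y) * i = i * mvfderiv 𝓘(ℝ, EY) Q y (W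
        y))
    (hU : IsFieldIn D U y) (hU' : IsFieldIn D U' y)
    (hW : IsFieldIn D W y) (hW' : IsFieldIn D W' y)
    (h1 : ∀ᶠ y' in 𝓝 y, mvfderiv 𝓘(ℝ, EY) Q y' (U' y') =
      i * (mvfderiv 𝓘(ℝ, EY) Q y' (U y') * Q y' - Q y' * mvfderiv 𝓘(ℝ, EY) Q y' (U y')))
    (h2 : ∀ᶠ y' in 𝓝 y, -mvfderiv 𝓘(ℝ, EY) Q y' (U y') =
      i * (mvfderiv 𝓘(ℝ, EY) Q y' (U' y') * Q y' - Q y' * mvfderiv 𝓘(ℝ, EY) Q y' (U' y')))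
    (h3 : mvfderiv 𝓘(ℝ, EY) Q y (W' y) =
      i * (mvfderiv 𝓘(ℝ, EY) Q y (W y) * Q y - Q y * mvfderiv 𝓘(ℝ, EY) Q y (W y))) :
    (inner ℝ (mlieBracket 𝓘(ℝ, EY) U U' y) (W y) : ℝ) =
      -inner ℝ (leviCivita U y (U y) + leviCivita U' y (U' y)) (W' y) := by
  -- When `dQ(X') = j (dQ(X) Q - Q dQ(X))` is differentiated along `X`, the two products `dQ(X)
  -- dQ(X)` cancel.
  have key : ∀ X X' : ∀ y : Y, TangentSpace 𝓘(ℝ, EY) y, MDiffAt (T% X) y → MDiffAt (T% X') y →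
      ∀ j : 𝒜, (∀ᶠ y' in 𝓝 y, mvfderiv 𝓘(ℝ, EY) Q y' (X' y') =
      j * (mvfderiv 𝓘(ℝ, EY) Q y' (X y') * Q y' - Q y' * mvfderiv 𝓘(ℝ, EY) Q y' (X y'))) →
      mvfderiv 𝓘(ℝ, EY) (fun y' => mvfderiv 𝓘(ℝ, EY) Q y' (X' y')) y (X y) =
      j * (mvfderiv 𝓘(ℝ, EY) (fun y' => mvfderiv 𝓘(ℝ, EY) Q y' (X y')) y (X y) * Q y
        - Q y * mvfderiv 𝓘(ℝ, EY) (fun y' => mvfderiv 𝓘(ℝ, EY) Q y' (X y')) y (X y)) := by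
    intro X X' hX hX' j h
    have hq := mdifferentiableAt_mvfderiv_field hQ hX
    have hQ1 : MDifferentiableAt 𝓘(ℝ, EY) 𝓘(ℝ, 𝒜) Q y := hQ.mdifferentiableAt (by simp)
    have e1 := mdifferentiableAt_bilin (ContinuousLinearMap.mul ℝ 𝒜) hq hQ1
    have e2 := mdifferentiableAt_bilin (ContinuousLinearMap.mul ℝ 𝒜) hQ1 hq
    have e3 := mvfderiv_bilin (ContinuousLinearMap.mul ℝ 𝒜) hq hQ1 (X y)
    have e4 := mvfderiv_bilin (ContinuousLinearMap.mul ℝ 𝒜) hQ1 hq (X y)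
    have e5 := congrArg (fun L => L (X y)) (mvfderiv_sub (I := 𝓘(ℝ, EY)) e1 e2)
    have e6 := mvfderiv_clm (ContinuousLinearMap.mul ℝ 𝒜 j) (e1.sub e2) (X y)
    rw [mvfderiv_congr h]
    refine e6.trans ?_
    refine congrArg (fun a => j * a) (e5.trans ?_)
    refine (congrArg₂ (· - ·) e3 e4).trans ?_
    simp only [ContinuousLinearMap.mul_apply']
    abel
  have k1 := key U U' hU.mdiff hU'.mdiff i h1
  have k2 := key U' U hU'.mdiff hU.mdiff (-i) (h2.mono fun y' h => by
    rw [neg_mul, ← h, neg_neg])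
  have hDy := hD.self_of_nhds
  rw [hDy _ (hbr U U' hU hU') _ hW.mem.self_of_nhds, mvfderiv_mlieBracket hQ hU.mdiff hU'.mdiff,
    inner_add_left, inner_leviCivita_of_metric hτ hQ hD hbr hU hU hW',
    inner_leviCivita_of_metric hτ hQ hD hbr hU' hU' hW', ← map_add, ← add_mul, ← map_neg, k1, k2,
        h3]
  generalize mvfderiv 𝓘(ℝ, EY) Q y (W y) = w at *
  generalize mvfderiv 𝓘(ℝ, EY) (fun y' => mvfderiv 𝓘(ℝ, EY) Q y' (U y')) y (U y) = a at *
  generalize mvfderiv 𝓘(ℝ, EY) (fun y' => mvfderiv 𝓘(ℝ, EY) Q y' (U' y')) y (U' y) = b at *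
  generalize Q y = q at *
  -- Both sides are brought to a form in which they differ by cyclic permutations under `τ`; this
  -- uses that `i` commutes with `Q y` and `dQ(W)`.
  have e1 : (i * (a * q - q * a) - -i * (b * q - q * b)) * w =
      i * ((a + b) * (q * w)) - i * (q * ((a + b) * w)) := by noncomm_ring
  have e2 : -((a + b) * (i * (w * q - q * w))) =
      (a + b) * (q * w) * i - ((a + b) * w) * (i * q) := by
    have : i * (q * w) = q * w * i := by rw [mul_assoc, hiW, ← mul_assoc, ← mul_assoc, hiQ]
    have h' : i * (w * q) = w * (i * q) := by rw [← mul_assoc, ← hiW, mul_assoc]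
    rw [mul_sub, this, h']
    noncomm_ring
  rw [e1, e2, map_sub, map_sub, hτ i, ← mul_assoc i, hτ (i * q)]

end Kaehler

/-! ### Vector fields tangent to the fibres of a submersion -/

section VerticalFields

variable {EY : Type*} [NormedAddCommGroup EY] [NormedSpace ℝ EY] [FiniteDimensional ℝ EY]
  {Y : Type*} [TopologicalSpace Y]
  [ChartedSpace EY Y] [IsManifold 𝓘(ℝ, EY) ∞ Y]
  [RiemannianBundle (fun y : Y => TangentSpace 𝓘(ℝ, EY) y)]
  [IsContMDiffRiemannianBundle 𝓘(ℝ, EY) ∞ EY (fun y : Y => TangentSpace 𝓘(ℝ, EY) y)]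
  {EM : Type*} [NormedAddCommGroup EM] [NormedSpace ℝ EM] [FiniteDimensional ℝ EM]
  {M : Type*} [TopologicalSpace M] [ChartedSpace EM M] [IsManifold 𝓘(ℝ, EM) ∞ M]
  {p : Y → M} {U V : ∀ y : Y, TangentSpace 𝓘(ℝ, EY) y} {y : Y}

/-- Both fields annihilate `p` read in a chart near `y`, hence so does their bracket. -/
theorem mlieBracket_mem_vert (hp : IsSurjSubmersion EY EM p) (hU : IsFieldIn (vert EY EM p) U y)
    (hV : IsFieldIn (vert EY EM p) V y) : mlieBracket 𝓘(ℝ, EY) U V y ∈ vert EY EM p y := by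
  have hc := mem_chart_source EM (p y)
  have hnear : ∀ᶠ y' in 𝓝 y, p y' ∈ (chartAt EM (p y)).source :=
    hp.smooth.continuous.continuousAt.eventually (chart_source_mem_nhds EM (p y))
  have hg := (contMDiffAt_chart_comp hp.smooth hc).of_le (m := 2) (by norm_cast)
  have h1 := mvfderiv_mlieBracket hg hU.mdiff hV.mdiff
  have h0 : ∀ {W : ∀ y : Y, TangentSpace 𝓘(ℝ, EY) y}, (∀ᶠ y' in 𝓝 y, W y' ∈ vert EY EM p y') →
      ∀ u, mvfderiv 𝓘(ℝ, EY) (fun y' => mvfderiv 𝓘(ℝ, EY)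
        (fun y' => extChartAt 𝓘(ℝ, EM) (p y) (p y')) y' (W y')) y u = 0 := by
    intro W hW u
    rw [mvfderiv_congr (g := fun _ => (0 : EM)) ?_, mvfderiv_const]
    · rfl
    · filter_upwards [hnear, hW] with y' h2 h3
      rw [mvfderiv_chart_comp hp.smooth h2, mem_vert.1 h3, map_zero]
  rw [h0 hV.mem, h0 hU.mem, sub_zero, mvfderiv_chart_comp hp.smooth hc] at h1
  exact injective_mvfderiv_chart hc h1

theorem isFieldIn_extendIn_vert (hp : IsSurjSubmersion EY EM p) (v : TangentSpace 𝓘(ℝ, EY) y) :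
    IsFieldIn (vert EY EM p) (extendIn (vert EY EM p) v) y :=
  ⟨mdifferentiableAt_projT_vert hp (FiberBundle.mdifferentiableAt_extend ..),
    .of_forall fun _ => projT_mem _ _⟩

theorem isFieldIn_extendIn_hor (hp : IsSurjSubmersion EY EM p) (v : TangentSpace 𝓘(ℝ, EY) y) :
    IsFieldIn (hor EY EM p) (extendIn (hor EY EM p) v) y :=
  ⟨mdifferentiableAt_projT_hor hp (FiberBundle.mdifferentiableAt_extend ..),
    .of_forall fun _ => projT_mem _ _⟩

theorem extendIn_self {D : ∀ y : Y, Submodule ℝ (TangentSpace 𝓘(ℝ, EY) y)}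
    {v : TangentSpace 𝓘(ℝ, EY) y} (hv : v ∈ D y) : extendIn D v y = v := by
  rw [extendIn, FiberBundle.extend_apply_self]
  exact projT_eq_self hv

/-- The covariant derivatives of vector fields in orthogonal distributions. -/
theorem inner_leviCivita_of_orthogonal {D : ∀ y : Y, Submodule ℝ (TangentSpace 𝓘(ℝ, EY) y)}
    (hU : IsFieldIn D U y) (hV : IsFieldIn (fun y => (D y)ᗮ) V y) (w : TangentSpace 𝓘(ℝ, EY) y) :
    (inner ℝ (leviCivita U y w) (V y) : ℝ) = -inner ℝ (U y) (leviCivita V y w) := by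
  have h1 := mvfderiv_inner hU.mdiff hV.mdiff w
  rw [mvfderiv_congr (g := fun _ => (0 : ℝ)) ?_, mvfderiv_const] at h1
  · exact eq_neg_of_add_eq_zero_left h1.symm
  · filter_upwards [hU.mem, hV.mem] with y' h2 h3
    exact h3 _ h2

/-- Against a horizontal field, `∇_w U` pairs to `-⟨U, ∇_w H⟩`, which depends only on `U y`. So `U`
may be replaced by the particular extension in `secondFund`, whose normal derivative is zero by
hypothesis. -/
theorem leviCivita_mem_vert (hp : IsSurjSubmersion EY EM p)
    (hgeo : ∀ u ∈ vert EY EM p y, ∀ v ∈ vert EY EM p y, secondFund (vert EY EM p) y u v = 0)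
    (hU : IsFieldIn (vert EY EM p) U y) {w : TangentSpace 𝓘(ℝ, EY) y} (hw : w ∈ vert EY EM p y) :
    leviCivita U y w ∈ vert EY EM p y := by
  rw [← hor_orthogonal]
  intro h hh
  have hH := isFieldIn_extendIn_hor hp h
  have hUy := hU.mem.self_of_nhds
  have hU' := isFieldIn_extendIn_vert hp (U y)
  have h1 := inner_leviCivita_of_orthogonal hU hH w
  have h2 := inner_leviCivita_of_orthogonal hU' hH w
  have h3 := projT_eq_zero_iff.1 (hgeo w hw (U y) hUy)
  rw [extendIn_self (D := vert EY EM p) hUy, ← h1, extendIn_self (D := hor EY EM p) hh] at h2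
  rw [real_inner_comm, ← h2, real_inner_comm]
  exact h3 h hh

end VerticalFields

/-! ### The pointwise co-CR data and the Kähler property of the fibres -/

namespace RiemannianTwistorialStructure

section

variable {EY EM EZ F : Type*}
  [NormedAddCommGroup EY] [NormedSpace ℝ EY] [FiniteDimensional ℝ EY]
  [NormedAddCommGroup EM] [NormedSpace ℝ EM] [FiniteDimensional ℝ EM]
  [NormedAddCommGroup EZ] [NormedSpace ℂ EZ] [FiniteDimensional ℂ EZ]
  [NormedAddCommGroup F] [NormedSpace ℝ F] [FiniteDimensional ℝ F]
  {Y : Type*} [TopologicalSpace Y]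
  [ChartedSpace EY Y] [IsManifold 𝓘(ℝ, EY) ∞ Y]
  [RiemannianBundle (fun y : Y => TangentSpace 𝓘(ℝ, EY) y)]
  [IsContMDiffRiemannianBundle 𝓘(ℝ, EY) ∞ EY (fun y : Y => TangentSpace 𝓘(ℝ, EY) y)]
  {M : Type*} [TopologicalSpace M] [T2Space M]
  [ChartedSpace EM M] [IsManifold 𝓘(ℝ, EM) ∞ M]
  [RiemannianBundle (fun x : M => TangentSpace 𝓘(ℝ, EM) x)]
  [IsContMDiffRiemannianBundle 𝓘(ℝ, EM) ∞ EM (fun x : M => TangentSpace 𝓘(ℝ, EM) x)]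
  {Z : Type*} [TopologicalSpace Z]
  [ChartedSpace EZ Z] [IsManifold 𝓘(ℂ, EZ) ω Z]
  {E : M → Type*} [TopologicalSpace (TotalSpace F E)]
  [∀ x, NormedAddCommGroup (E x)] [∀ x, InnerProductSpace ℝ (E x)]
  [∀ x, FiniteDimensional ℝ (E x)] [FiberBundle F E] [VectorBundle ℝ F E]
  [ContMDiffVectorBundle ∞ F E 𝓘(ℝ, EM)] [IsContMDiffRiemannianBundle 𝓘(ℝ, EM) ∞ F E]
  {p : Y → M} {φ : Y → Z}
  (S : RiemannianTwistorialStructure EY EM EZ F E p φ)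

theorem coCRData (y : Y) : CoCRData (mfderiv 𝓘(ℝ, EY) 𝓘(ℝ, EZ) φ y).toLinearMap (mulI (φ y))
    (vert EY EM p y) (pullT01 EY (EZ := EZ) φ y)
    ((hor EY EM p y).baseChange ℂ ⊓ ((S.σ y).map ((S.ρ (p y)).baseChange ℂ)).comap
      ((mfderiv 𝓘(ℝ, EY) 𝓘(ℝ, EM) p y).toLinearMap.baseChange ℂ)) (vert01 EM EZ p φ y)
    (Jφ EZ φ y) where
  j_sq := mulI_mulI (φ y)
  mem_C a b := by
    rw [pullT01, T01, Submodule.mem_comap, baseChange_mkC, LinearMap.mem_ker, LinearMap.add_apply,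
      baseChange_mkC, LinearMap.smul_apply, LinearMap.id_apply, I_smul_mkC, mkC_add, mkC_eq_zero]
    -- The real part of the eigenvector equation already gives `dφ b = i dφ a`; the imaginary part
    -- is `i` times it.
    constructor
    · intro h
      exact (eq_of_sub_eq_zero (by rw [sub_eq_add_neg]; exact h.1)).symm
    · intro h
      exact ⟨by rw [h]; exact add_neg_cancel _, by
        rw [h, mulI_mulI]; exact neg_add_cancel _⟩
  C_eq := S.coCR y
  B_le := inf_le_left
  N_eq := rfl
  inf_ker := S.φ_immersion y
  j_mem := S.φ_holomorphic y
  coisotropic := S.coisotropic y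
  J_mem u := horLift_mem _ _ _
  A_J u := mfderiv_Jφ S.φ_submersion y u

include S in
theorem isFieldIn_Jφ {U : ∀ y : Y, TangentSpace 𝓘(ℝ, EY) y} {y : Y}
    (hU : IsFieldIn (vert EY EM p) U y) :
    IsFieldIn (vert EY EM p) (fun y => Jφ EZ φ y (U y)) y :=
  ⟨mdifferentiableAt_Jφ S.φ_submersion hU.mdiff, hU.mem.mono fun y' h => (S.coCRData y').J_vert h⟩

include S in
/-- The fibres of `p` are Kähler manifolds. -/
theorem mlieBracket_vert {U : ∀ y : Y, TangentSpace 𝓘(ℝ, EY) y} {y : Y}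
    (hU : IsFieldIn (vert EY EM p) U y) :
    mlieBracket 𝓘(ℝ, EY) U (fun y => Jφ EZ φ y (U y)) y =
      Jφ EZ φ y (leviCivita U y (U y)
        + leviCivita (fun y => Jφ EZ φ y (U y)) y (Jφ EZ φ y (U y))) := by
  obtain ⟨k, hk, hmet⟩ := S.fibre_metric
  have hU' := S.isFieldIn_Jφ hU
  have hp := S.p_submersion
  have hbr : ∀ U V : ∀ y : Y, TangentSpace 𝓘(ℝ, EY) y, IsFieldIn (vert EY EM p) U y →
      IsFieldIn (vert EY EM p) V y → mlieBracket 𝓘(ℝ, EY) U V y ∈ vert EY EM p y :=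
    fun U V hU hV => mlieBracket_mem_vert hp hU hV
  -- The fibre metric is induced through `ρ(σ)`, not through `σ` itself.
  let σ' : ∀ y, Submodule ℂ (ℂ ⊗[ℝ] TangentSpace 𝓘(ℝ, EM) (p y)) :=
    fun y => (S.σ y).map ((S.ρ (p y)).baseChange ℂ)
  let Q := coProj EM σ' (p y)
  have hQ : ContMDiffAt 𝓘(ℝ, EY) 𝓘(ℝ, EM × EM →L[ℝ] EM × EM) 2 Q y :=
    (contMDiffAt_coProj S.ρσ_isYStructure.smooth hp.smooth.continuous.continuousAt).of_le
      (by norm_cast)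
  have hbase : ∀ᶠ y' in 𝓝 y, p y' ∈ base EM (fun x : M => TangentSpace 𝓘(ℝ, EM) x) (p y) :=
    hp.smooth.continuous.continuousAt.eventually 
      (base_mem_nhds (E := fun x : M => TangentSpace 𝓘(ℝ, EM) x) EM (mem_base_self EM (p y)))
  have hpd : ∀ y', MDifferentiableAt 𝓘(ℝ, EY) 𝓘(ℝ, EM) p y' := fun y' =>
    (hp.smooth y').mdifferentiableAt (by simp)
  -- The factor 1/2 is the ratio of `grMetric` to the real trace, and `k` is the normalization of
  -- the fibre metric.
  let τ : (EM × EM →L[ℝ] EM × EM) →L[ℝ] ℝ := LinearMap.toContinuousLinearMap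
    ((k * (1 / 2)) • (LinearMap.trace ℝ (EM × EM) ∘ₗ ContinuousLinearMap.coeLM ℝ))
  have hτ0 : ∀ a, τ a = k * (1 / 2 * LinearMap.trace ℝ (EM × EM) a.toLinearMap) := fun a =>
    mul_assoc _ _ _
  have hτ : ∀ a b, τ (a * b) = τ (b * a) := fun a b => by
    rw [hτ0, hτ0]
    exact congrArg (fun t => k * (1 / 2 * t)) (LinearMap.trace_comp_comm' _ _)
  have hD : ∀ᶠ y' in 𝓝 y, ∀ u ∈ vert EY EM p y', ∀ v ∈ vert EY EM p y',
      (inner ℝ u v : ℝ) = τ (mvfderiv 𝓘(ℝ, EY) Q y' u * mvfderiv 𝓘(ℝ, EY) Q y' v) := by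
    filter_upwards [hbase, eventually_mdifferentiableAt hQ] with y' h1 h2 u hu v hv
    rw [hmet y' u hu v hv, hτ0]
    exact congrArg (fun t => k * t) (grMetric_eq_trace h1 (hpd y') h2 hu hv)
  have hrel : ∀ᶠ y' in 𝓝 y, ∀ u ∈ vert EY EM p y', mvfderiv 𝓘(ℝ, EY) Q y' (Jφ EZ φ y' u) =
      rotF EM * (mvfderiv 𝓘(ℝ, EY) Q y' u * Q y' - Q y' * mvfderiv 𝓘(ℝ, EY) Q y' u) := by
    filter_upwards [hbase, eventually_mdifferentiableAt hQ] with y' h1 h2 u hu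
    have hv := (S.coCRData y').J_vert hu
    exact mvfderiv_coProj_of_holomorphic h1 (hpd y') h2 hu hv
      (S.ρσ_isYStructure.holomorphic y' u hu _ hv ((S.coCRData y').A_J u))
  have hvert := (S.coCRData y).le_orthogonal_ker
  have hUy := hU.mem.self_of_nhds
  have hsum : leviCivita U y (U y)
      + leviCivita (fun y => Jφ EZ φ y (U y)) y (Jφ EZ φ y (U y)) ∈ vert EY EM p y :=
    add_mem (leviCivita_mem_vert hp (S.p_geodesic y) hU hUy)
      (leviCivita_mem_vert hp (S.p_geodesic y) hU' hU'.mem.self_of_nhds)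
  have key : ∀ w ∈ vert EY EM p y,
      (inner ℝ (mlieBracket 𝓘(ℝ, EY) U (fun y => Jφ EZ φ y (U y)) y) w : ℝ) =
      inner ℝ (Jφ EZ φ y (leviCivita U y (U y)
        + leviCivita (fun y => Jφ EZ φ y (U y)) y (Jφ EZ φ y (U y)))) w := by
    intro w hw
    have hW := isFieldIn_extendIn_vert hp w
    have hWy : extendIn (vert EY EM p) w y = w := extendIn_self hw
    have h1 := inner_mlieBracket_of_kaehler hτ hQ hD hbr (W := extendIn (vert EY EM p) w)
      (i := rotF EM) coProj_mul_rotF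
      (mvfderiv_coProj_mul_rotF (hQ.mdifferentiableAt (by simp)) _) hU hU' hW
      (S.isFieldIn_Jφ hW) ?_ ?_ ?_
    · rw [(S.coCRData y).inner_J_left (hvert hsum) (hvert hw)]
      simp only [hWy] at h1
      exact h1
    · filter_upwards [hrel, hU.mem] with y' h2 h3
      exact h2 _ h3
    · filter_upwards [hrel, hU.mem, hU'.mem] with y' h2 h3 h4
      rw [← h2 _ h4, (S.coCRData y').J_J ((S.coCRData y').le_orthogonal_ker h3), map_neg]
    · exact hrel.self_of_nhds _ hW.mem.self_of_nhds
  -- Both sides are vertical, so their difference is itself an admissible test vector.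
  have h1 := sub_mem (hbr _ _ hU hU') ((S.coCRData y).J_vert hsum)
  have h2 := key _ h1
  rw [← sub_eq_zero, ← inner_sub_left] at h2
  exact sub_eq_zero.1 (inner_self_eq_zero.1 h2)

end

end RiemannianTwistorialStructure

/-! ### Horizontal fields, parallelism of `σ` and the covariant derivative -/

namespace RiemannianTwistorialStructure

section

variable {EY EM EZ F : Type*}
  [NormedAddCommGroup EY] [NormedSpace ℝ EY] [FiniteDimensional ℝ EY]
  [NormedAddCommGroup EM] [NormedSpace ℝ EM] [FiniteDimensional ℝ EM]
  [NormedAddCommGroup EZ] [NormedSpace ℂ EZ] [FiniteDimensional ℂ EZ]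
  [NormedAddCommGroup F] [NormedSpace ℝ F] [FiniteDimensional ℝ F]
  {Y : Type*} [TopologicalSpace Y]
  [ChartedSpace EY Y] [IsManifold 𝓘(ℝ, EY) ∞ Y]
  [RiemannianBundle (fun y : Y => TangentSpace 𝓘(ℝ, EY) y)]
  [IsContMDiffRiemannianBundle 𝓘(ℝ, EY) ∞ EY (fun y : Y => TangentSpace 𝓘(ℝ, EY) y)]
  {M : Type*} [TopologicalSpace M] [T2Space M]
  [ChartedSpace EM M] [IsManifold 𝓘(ℝ, EM) ∞ M]
  [RiemannianBundle (fun x : M => TangentSpace 𝓘(ℝ, EM) x)]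
  [IsContMDiffRiemannianBundle 𝓘(ℝ, EM) ∞ EM (fun x : M => TangentSpace 𝓘(ℝ, EM) x)]
  {Z : Type*} [TopologicalSpace Z]
  [ChartedSpace EZ Z] [IsManifold 𝓘(ℂ, EZ) ω Z]
  {E : M → Type*} [TopologicalSpace (TotalSpace F E)]
  [∀ x, NormedAddCommGroup (E x)] [∀ x, InnerProductSpace ℝ (E x)]
  [∀ x, FiniteDimensional ℝ (E x)] [FiberBundle F E] [VectorBundle ℝ F E]
  [ContMDiffVectorBundle ∞ F E 𝓘(ℝ, EM)] [IsContMDiffRiemannianBundle 𝓘(ℝ, EM) ∞ F E]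
  {p : Y → M} {φ : Y → Z}
  (S : RiemannianTwistorialStructure EY EM EZ F E p φ)

/-- The vector field `JU`. -/
def Jfield (EZ : Type*) [NormedAddCommGroup EZ] [NormedSpace ℂ EZ]
    {Z : Type*} [TopologicalSpace Z] [ChartedSpace EZ Z] (φ : Y → Z)
    (U : ∀ y : Y, TangentSpace 𝓘(ℝ, EY) y) (y : Y) : TangentSpace 𝓘(ℝ, EY) y :=
  Jφ EZ φ y (U y)

theorem mkC_horLift_mem {y : Y} {c d : E (p y)} (h : mkC c d ∈ S.σ y) :
    mkC (horLift (EY := EY) p y (S.ρ (p y) c)) (horLift (EY := EY) p y (S.ρ (p y) d)) ∈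
      (hor EY EM p y).baseChange ℂ ⊓ ((S.σ y).map ((S.ρ (p y)).baseChange ℂ)).comap
        ((mfderiv 𝓘(ℝ, EY) 𝓘(ℝ, EM) p y).toLinearMap.baseChange ℂ) := by
  refine ⟨mkC_mem_baseChange.2 ⟨horLift_mem _ _ _, horLift_mem _ _ _⟩, mkC c d, h, ?_⟩
  rw [baseChange_mkC, baseChange_mkC]
  exact (congrArg₂ mkC (mfderiv_horLift S.p_submersion y _)
    (mfderiv_horLift S.p_submersion y _)).symm

theorem mfderiv_horLift_of_mem {y : Y} {c d : E (p y)} (h : mkC c d ∈ S.σ y) :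
    mfderiv 𝓘(ℝ, EY) 𝓘(ℝ, EZ) φ y (horLift p y (S.ρ (p y) d)) =
      mulI (φ y) (mfderiv 𝓘(ℝ, EY) 𝓘(ℝ, EZ) φ y (horLift p y (S.ρ (p y) c))) :=
  (S.coCRData y).A_of_mem_B (S.mkC_horLift_mem h)

/-- The `(0,1)`-vectors of `ℋ ∩ 𝒦` belong to `σ`. -/
theorem mkC_ι_mem {y : Y} {u : TangentSpace 𝓘(ℝ, EY) y} (hu : u ∈ hor EY EM p y ⊓ hor EY EZ φ y) :
    mkC (S.ι (p y) (mfderiv 𝓘(ℝ, EY) 𝓘(ℝ, EM) p y u))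
      (S.ι (p y) (mfderiv 𝓘(ℝ, EY) 𝓘(ℝ, EM) p y (Jφ EZ φ y u))) ∈ S.σ y := by
  refine S.σ_isYStructure.coisotropic y (mkC_mem_orthogonal.2 fun c d hcd => ?_)
  have hJ := (S.coCRData y).J_hor hu
  have h1 := S.mkC_horLift_mem hcd
  have h2 := mkC_mem_orthogonal.1 ((S.coCRData y).mkC_J_mem_orthogonal hu.2) _ _
    (S.coCR y ▸ Submodule.mem_sup_left h1)
  -- The map `ι ∘ dp` is adjoint to the horizontal lift of `ρ`. This carries orthogonality to ℬ in
  -- TY over to orthogonality to `σ` in `E`.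
  have h3 : ∀ (w : TangentSpace 𝓘(ℝ, EY) y) (e : E (p y)),
      (inner ℝ (S.ι (p y) (mfderiv 𝓘(ℝ, EY) 𝓘(ℝ, EM) p y w)) e : ℝ) =
      inner ℝ w (horLift p y (S.ρ (p y) e)) := by
    intro w e
    rw [S.inner_ι, ← S.inner_mfderiv y w (horLift_mem p y _), mfderiv_horLift S.p_submersion]
  rw [h3, h3, h3, h3]
  exact h2

/-- The section of `E^ℂ` given by `U + iJU` takes values in `σ`, and `σ` is parallel in horizontal
directions. -/
theorem derivSec_mem {U : ∀ y : Y, TangentSpace 𝓘(ℝ, EY) y} {y : Y}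
    (hU : IsFieldIn (fun y => hor EY EM p y ⊓ hor EY EZ φ y) U y)
    {v : TangentSpace 𝓘(ℝ, EY) y} (hv : v ∈ hor EY EM p y) :
    mkC (S.derivSec U y v) (S.derivSec (Jfield EZ φ U) y v) ∈ S.σ y := by
  have : ContMDiffVectorBundle 1 F E 𝓘(ℝ, EM) := ContMDiffVectorBundle.of_le (n := ∞) (by norm_cast)
  have hp : MDifferentiableAt 𝓘(ℝ, EY) 𝓘(ℝ, EM) p y :=
    (S.p_submersion.smooth y).mdifferentiableAt (by simp)
  have hx := mem_base_self (E := E) F (p y)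
  have hQ := (contMDiffAt_coProj (y₀ := y) S.σ_isYStructure.smooth
    S.p_submersion.smooth.continuous.continuousAt).mdifferentiableAt (by simp)
  have h1 := (mdifferentiableAt_along_iff hx hp).1 (S.mdifferentiableAt_sec hU.mdiff)
  have h2 := (mdifferentiableAt_along_iff hx hp).1 (S.mdifferentiableAt_sec
    (mdifferentiableAt_Jφ S.φ_submersion hU.mdiff))
  have h3 : MDifferentiableAt 𝓘(ℝ, EY) 𝓘(ℝ, F × F) (fun y' => cco F (p y) (p y')
      (mkC (S.sec U y') (S.sec (Jfield EZ φ U) y'))) y := by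
    simp only [cco_mkC]
    exact h1.prodMk_space h2
  have h4 := derivC_mem (S := S.σ) (fun s x v => S.conn s x v) hp h3 hQ
    (S.hor_induced y v hv) (hU.mem.mono fun y' h => S.mkC_ι_mem h)
  simp only [derivC, re_mkC, im_mkC] at h4
  exact h4

include S in
-- For `W` vertical the Koszul formula leaves `-W|U|² - 2⟨[U,W],U⟩`. Both terms are expressed by the
-- derivative of the section of `U` along `W` and cancel; the torsion drops out because `dp W = 0`.
theorem inner_leviCivita_self_vert {U : ∀ y : Y, TangentSpace 𝓘(ℝ, EY) y} {y : Y}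
    (hU : IsFieldIn (hor EY EM p) U y) {w : TangentSpace 𝓘(ℝ, EY) y} (hw : w ∈ vert EY EM p y) :
    (inner ℝ (leviCivita U y (U y)) w : ℝ) = 0 := by
  have hW := isFieldIn_extendIn_vert S.p_submersion w
  have hWy : extendIn (vert EY EM p) w y = w := extendIn_self hw
  have h0 : ∀ u, mvfderiv 𝓘(ℝ, EY)
      (fun y' => (inner ℝ (extendIn (vert EY EM p) w y') (U y') : ℝ)) y u = 0 := by
    intro u
    rw [mvfderiv_congr (g := fun _ => (0 : ℝ)) ?_, mvfderiv_const]
    · rfl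
    · filter_upwards [hU.mem, hW.mem] with y' h2 h3
      exact h2 _ h3
  have hsec : S.sec (extendIn (vert EY EM p) w) y = 0 := by
    rw [sec, hWy, mem_vert.1 hw, map_zero]
  have h1 := S.mvfderiv_inner_sec (U := U) hU.mdiff hW.mdiff hU.mem
  rw [h0, hsec, inner_zero_left, add_zero] at h1
  have h2 := S.mvfderiv_inner_sec (U := extendIn (vert EY EM p) w) hU.mdiff hU.mdiff hU.mem
  have h3 := S.torsionY_eq hU.mdiff hW.mdiff
  have h4 : (inner ℝ (S.torsionY y (U y) (extendIn (vert EY EM p) w y)) (S.sec U y) : ℝ) = 0 := by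
    refine (S.torsion_antisymm _ _ _ _).trans ?_
    rw [hWy, mem_vert.1 hw, map_zero, inner_zero_right, neg_zero]
  have h5 := (congrArg (fun e => (inner ℝ e (S.sec U y) : ℝ)) h3).trans h4
  simp only [inner_sub_left] at h5
  have h6 := S.inner_sec y (mlieBracket 𝓘(ℝ, EY) U (extendIn (vert EY EM p) w) y)
    hU.mem.self_of_nhds
  have h7 := inner_leviCivita hU.mdiff hU.mdiff hW.mdiff
  rw [koszul, mvfderiv_inner_comm U (extendIn (vert EY EM p) w), h0, h2] at h7
  simp only [mlieBracket_self, Pi.zero_apply, inner_zero_left] at h7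
  rw [real_inner_comm (S.derivSec U y _) (S.sec U y)] at h7
  simp only [sec] at h5 h6 h7 h1
  rw [hWy] at h7 h5
  linarith

end

end RiemannianTwistorialStructure

/-! ### The Hessian on a pair `U`, `JU`, and the integrability tensor -/

section HessianPair

variable {EY : Type*} [NormedAddCommGroup EY] [NormedSpace ℝ EY] [FiniteDimensional ℝ EY]
  {Y : Type*} [TopologicalSpace Y]
  [ChartedSpace EY Y] [IsManifold 𝓘(ℝ, EY) ∞ Y]
  [RiemannianBundle (fun y : Y => TangentSpace 𝓘(ℝ, EY) y)]
  [IsContMDiffRiemannianBundle 𝓘(ℝ, EY) ∞ EY (fun y : Y => TangentSpace 𝓘(ℝ, EY) y)]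
  {U U' : ∀ y : Y, TangentSpace 𝓘(ℝ, EY) y} {y : Y}

/-- From `U'g = i Ug` follow `U(Ug) = -i U(U'g)` and `U'(U'g) = i U'(Ug)`, so the second order terms
combine into a bracket. -/
theorem hess_add_hess {G : Type*} [NormedAddCommGroup G] [NormedSpace ℂ G] {g : Y → G}
    (hg : ContMDiffAt 𝓘(ℝ, EY) 𝓘(ℝ, G) 2 g y) (hU : MDiffAt (T% U) y) (hU' : MDiffAt (T% U') y)
    (h : ∀ᶠ y' in 𝓝 y, mvfderiv 𝓘(ℝ, EY) g y' (U' y') =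
      Complex.I • mvfderiv 𝓘(ℝ, EY) g y' (U y')) :
    hess g U y (U y) + hess g U' y (U' y) =
      -(Complex.I • mvfderiv 𝓘(ℝ, EY) g y (mlieBracket 𝓘(ℝ, EY) U U' y))
      - mvfderiv 𝓘(ℝ, EY) g y (leviCivita U y (U y) + leviCivita U' y (U' y)) := by
  have h1 : ∀ u, mvfderiv 𝓘(ℝ, EY) (fun y' => mvfderiv 𝓘(ℝ, EY) g y' (U' y')) y u =
      Complex.I • mvfderiv 𝓘(ℝ, EY) (fun y' => mvfderiv 𝓘(ℝ, EY) g y' (U y')) y u := by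
    intro u
    rw [mvfderiv_congr h]
    exact mvfderiv_clm ((Complex.I • ContinuousLinearMap.id ℂ G).restrictScalars ℝ)
      (mdifferentiableAt_mvfderiv_field hg hU) u
  rw [mvfderiv_mlieBracket hg hU hU', hess, hess, h1, h1, smul_sub, smul_smul, Complex.I_mul_I,
    map_add, neg_one_smul]
  abel

variable {EM : Type*} [NormedAddCommGroup EM] [NormedSpace ℝ EM] [FiniteDimensional ℝ EM]
  {M : Type*} [TopologicalSpace M] [ChartedSpace EM M] [IsManifold 𝓘(ℝ, EM) ∞ M]
  {p : Y → M}

/-- The integrability tensor can be computed with any horizontal extensions. -/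
theorem integrabilityTensor_eq (hp : IsSurjSubmersion EY EM p) (hU : IsFieldIn (hor EY EM p) U y)
    (hU' : IsFieldIn (hor EY EM p) U' y) :
    integrabilityTensor (hor EY EM p) y (U y) (U' y) =
      projT (vert EY EM p y) (mlieBracket 𝓘(ℝ, EY) U U' y) := by
  -- Against a vertical `w`, the bracket is expressed by derivatives of a vertical extension of `w`,
  -- in which only the values of `X` and `X'` at `y` occur.
  have key : ∀ {X X' : ∀ y : Y, TangentSpace 𝓘(ℝ, EY) y}, IsFieldIn (hor EY EM p) X y →
      IsFieldIn (hor EY EM p) X' y → ∀ w ∈ vert EY EM p y,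
      (inner ℝ w (mlieBracket 𝓘(ℝ, EY) X X' y) : ℝ) =
        -inner ℝ (leviCivita (extendIn (vert EY EM p) w) y (X y)) (X' y)
        + inner ℝ (leviCivita (extendIn (vert EY EM p) w) y (X' y)) (X y) := by
    intro X X' hX hX' w hw
    have hW := isFieldIn_extendIn_vert hp w
    rw [inner_leviCivita_of_orthogonal hW hX, inner_leviCivita_of_orthogonal hW hX',
      ← leviCivita_torsion hX.mdiff hX'.mdiff, extendIn_self (D := vert EY EM p) hw,
      inner_sub_right]
    ring
  have hE := isFieldIn_extendIn_hor hp (U y)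
  have hE' := isFieldIn_extendIn_hor hp (U' y)
  rw [integrabilityTensor, hor_orthogonal]
  refine (projT_eq_of_mem (projT_mem _ _) fun w hw => ?_).symm
  have h1 := key hU hU' w hw
  have h2 := key hE hE' w hw
  rw [extendIn_self (D := hor EY EM p) hU.mem.self_of_nhds,
    extendIn_self (D := hor EY EM p) hU'.mem.self_of_nhds, ← h1] at h2
  have h3 := sub_projT_mem (vert EY EM p y)
    (mlieBracket 𝓘(ℝ, EY) (extendIn (hor EY EM p) (U y)) (extendIn (hor EY EM p) (U' y)) y) w hw
  rw [inner_sub_right] at h3 ⊢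
  rw [← h2]
  exact h3

end HessianPair

/-! ### The Hessian on ℋ ∩ 𝒦, on ker dp and on ker dφ -/

namespace RiemannianTwistorialStructure

section

variable {EY EM EZ F : Type*}
  [NormedAddCommGroup EY] [NormedSpace ℝ EY] [FiniteDimensional ℝ EY]
  [NormedAddCommGroup EM] [NormedSpace ℝ EM] [FiniteDimensional ℝ EM]
  [NormedAddCommGroup EZ] [NormedSpace ℂ EZ] [FiniteDimensional ℂ EZ]
  [NormedAddCommGroup F] [NormedSpace ℝ F] [FiniteDimensional ℝ F]
  {Y : Type*} [TopologicalSpace Y]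
  [ChartedSpace EY Y] [IsManifold 𝓘(ℝ, EY) ∞ Y]
  [RiemannianBundle (fun y : Y => TangentSpace 𝓘(ℝ, EY) y)]
  [IsContMDiffRiemannianBundle 𝓘(ℝ, EY) ∞ EY (fun y : Y => TangentSpace 𝓘(ℝ, EY) y)]
  {M : Type*} [TopologicalSpace M] [T2Space M]
  [ChartedSpace EM M] [IsManifold 𝓘(ℝ, EM) ∞ M]
  [RiemannianBundle (fun x : M => TangentSpace 𝓘(ℝ, EM) x)]
  [IsContMDiffRiemannianBundle 𝓘(ℝ, EM) ∞ EM (fun x : M => TangentSpace 𝓘(ℝ, EM) x)]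
  {Z : Type*} [TopologicalSpace Z]
  [ChartedSpace EZ Z] [IsManifold 𝓘(ℂ, EZ) ω Z]
  {E : M → Type*} [TopologicalSpace (TotalSpace F E)]
  [∀ x, NormedAddCommGroup (E x)] [∀ x, InnerProductSpace ℝ (E x)]
  [∀ x, FiniteDimensional ℝ (E x)] [FiberBundle F E] [VectorBundle ℝ F E]
  [ContMDiffVectorBundle ∞ F E 𝓘(ℝ, EM)] [IsContMDiffRiemannianBundle 𝓘(ℝ, EM) ∞ F E]
  {p : Y → M} {φ : Y → Z}
  (S : RiemannianTwistorialStructure EY EM EZ F E p φ)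

include S

theorem isFieldIn_Jfield {U : ∀ y : Y, TangentSpace 𝓘(ℝ, EY) y} {y : Y}
    (hU : IsFieldIn (fun y => hor EY EM p y ⊓ hor EY EZ φ y) U y) :
    IsFieldIn (fun y => hor EY EM p y ⊓ hor EY EZ φ y) (Jfield EZ φ U) y :=
  ⟨mdifferentiableAt_Jφ S.φ_submersion hU.mdiff, hU.mem.mono fun y' h => (S.coCRData y').J_hor h⟩

/-- Project first to ℋ and then to 𝒦. The second projection subtracts an element of ker dφ, which
lies in ℋ, so the result stays in ℋ. -/
theorem exists_field {y : Y} {u : TangentSpace 𝓘(ℝ, EY) y}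
    (hu : u ∈ hor EY EM p y ⊓ hor EY EZ φ y) : ∃ U : ∀ y : Y, TangentSpace 𝓘(ℝ, EY) y,
      IsFieldIn (fun y => hor EY EM p y ⊓ hor EY EZ φ y) U y ∧ U y = u := by
  have : FiniteDimensional ℝ EZ := FiniteDimensional.complexToReal EZ
  have h1 := isFieldIn_extendIn_hor S.p_submersion u
  refine ⟨fun y => projT (hor EY EZ φ y) (extendIn (hor EY EM p) u y),
    ⟨mdifferentiableAt_projT_hor S.φ_submersion h1.mdiff, h1.mem.mono fun y' h => ⟨?_, projT_mem _
        _⟩⟩,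
    ?_⟩
  · have h2 := sub_projT_mem (hor EY EZ φ y') (extendIn (hor EY EM p) u y')
    rw [hor_orthogonal] at h2
    have h3 : extendIn (hor EY EM p) u y' - projT (hor EY EZ φ y') (extendIn (hor EY EM p) u y') ∈
        hor EY EM p y' := (S.coCRData y').ker_le h2
    simpa using sub_mem h h3
  · simp only [extendIn_self (D := hor EY EM p) hu.1]
    exact projT_eq_self hu.2

variable {G : Type*} [NormedAddCommGroup G] [NormedSpace ℂ G] {g : Y → G} {y : Y}

theorem mvfderiv_of_ker
    (hJ : ∀ u, mvfderiv 𝓘(ℝ, EY) g y (Jφ EZ φ y u) = Complex.I • mvfderiv 𝓘(ℝ, EY) g y u)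
    {u : TangentSpace 𝓘(ℝ, EY) y} (hu : u ∈ vert EY EZ φ y) : mvfderiv 𝓘(ℝ, EY) g y u = 0 := by
  have h1 := hJ u
  rw [(S.coCRData y).J_ker hu, map_zero] at h1
  exact (smul_eq_zero.1 h1.symm).resolve_left Complex.I_ne_zero

/-- `dg` vanishes on ker dφ, so the relation for `J` extends to every vector `c` with the right
image under `dφ`. -/
theorem mvfderiv_of_mulI
    (hJ : ∀ u, mvfderiv 𝓘(ℝ, EY) g y (Jφ EZ φ y u) = Complex.I • mvfderiv 𝓘(ℝ, EY) g y u)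
    {a c : TangentSpace 𝓘(ℝ, EY) y} (h : mfderiv 𝓘(ℝ, EY) 𝓘(ℝ, EZ) φ y c =
      mulI (φ y) (mfderiv 𝓘(ℝ, EY) 𝓘(ℝ, EZ) φ y a)) :
    mvfderiv 𝓘(ℝ, EY) g y c = Complex.I • mvfderiv 𝓘(ℝ, EY) g y a := by
  have h1 : c - Jφ EZ φ y a ∈ vert EY EZ φ y := by
    rw [mem_vert, map_sub, h, mfderiv_Jφ S.φ_submersion, sub_self]
  have h2 := S.mvfderiv_of_ker hJ h1
  rw [map_sub, sub_eq_zero] at h2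
  rw [h2, hJ]

/-- The vertical part vanishes, and the torsion correction to the horizontal part is `T(U,U) = 0`.
-/
theorem leviCivita_eq_horLift {U : ∀ y : Y, TangentSpace 𝓘(ℝ, EY) y}
    (hU : IsFieldIn (hor EY EM p) U y) :
    leviCivita U y (U y) = horLift p y (S.ρ (p y) (S.derivSec U y (U y))) := by
  have h0 : leviCivita U y (U y) ∈ hor EY EM p y := by
    intro w hw
    rw [real_inner_comm]
    exact S.inner_leviCivita_self_vert hU hw
  have key : ∀ d ∈ hor EY EM p y, (inner ℝ (leviCivita U y (U y)) d : ℝ) =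
      inner ℝ (horLift (EY := EY) p y (S.ρ (p y) (S.derivSec U y (U y)))) d := by
    intro d hd
    have hX := isFieldIn_extendIn_hor S.p_submersion d
    have hXy : extendIn (hor EY EM p) d y = d := extendIn_self hd
    have h1 := S.inner_leviCivita_hor hU.mdiff hU.mdiff hX.mdiff hU.mem hU.mem hX.mem
    have h2 : S.torsionY y (U y) (U y) = 0 := by
      have h3 := S.torsionY_swap y (U y) (U y)
      rw [eq_neg_iff_add_eq_zero, ← two_smul ℝ] at h3
      exact (smul_eq_zero.1 h3).resolve_left two_ne_zero
    rw [h2, inner_zero_left, mul_zero, sub_zero, hXy, sec, hXy,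
      real_inner_comm _ (S.derivSec U y (U y)), S.inner_ι,
      real_inner_comm _ (mfderiv _ _ _ _ _)] at h1
    rw [h1, ← S.inner_mfderiv y _ hd, mfderiv_horLift S.p_submersion]
  have h1 := sub_mem h0 (horLift_mem (EY := EY) p y (S.ρ (p y) (S.derivSec U y (U y))))
  have h2 := key _ h1
  rw [← sub_eq_zero, ← inner_sub_left] at h2
  exact sub_eq_zero.1 (inner_self_eq_zero.1 h2)

/-- The lifts of α and β satisfy `dg(lift β) = i dg(lift α)`, so in `hess_add_hess` their
contributions cancel and only I^ℋ - T survives. -/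
theorem hess_add_hess_hor (hg : ContMDiffAt 𝓘(ℝ, EY) 𝓘(ℝ, G) 2 g y)
    (hJ : ∀ᶠ y' in 𝓝 y, ∀ u, mvfderiv 𝓘(ℝ, EY) g y' (Jφ EZ φ y' u) =
      Complex.I • mvfderiv 𝓘(ℝ, EY) g y' u) {U : ∀ y : Y, TangentSpace 𝓘(ℝ, EY) y}
    (hU : IsFieldIn (fun y => hor EY EM p y ⊓ hor EY EZ φ y) U y) :
    hess g U y (U y) + hess g (Jfield EZ φ U) y (Jfield EZ φ U y) =
      -(Complex.I • mvfderiv 𝓘(ℝ, EY) g y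
        (integrabilityTensor (hor EY EM p) y (U y) (Jfield EZ φ U y)
          - S.torsionH y (U y) (Jfield EZ φ U y))) := by
  have hU' := S.isFieldIn_Jfield hU
  have hUh : IsFieldIn (hor EY EM p) U y := ⟨hU.mdiff, hU.mem.mono fun _ h => h.1⟩
  have hUh' : IsFieldIn (hor EY EM p) (Jfield EZ φ U) y := ⟨hU'.mdiff, hU'.mem.mono fun _ h => h.1⟩
  set U' := Jfield EZ φ U with hU'def
  set u := U y with hu
  set u' := U' y with hu'
  set α := S.derivSec U y u + S.derivSec U' y u' with hα
  set β := S.derivSec U' y u - S.derivSec U y u' with hβ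
  -- `α + iβ` is the derivative of the section of `U + iJU` along the complex vector `u - iu'`.
  have hσ : mkC α β ∈ S.σ y := by
    have h1 := S.derivSec_mem hU hUh.mem.self_of_nhds
    have h2 := (S.σ y).smul_mem Complex.I (S.derivSec_mem hU hUh'.mem.self_of_nhds)
    rw [I_smul_mkC] at h2
    have h3 := sub_mem h1 h2
    rw [mkC_sub, sub_neg_eq_add] at h3
    exact h3
  have ha : leviCivita U y u + leviCivita U' y u' = horLift p y (S.ρ (p y) α) := by
    rw [S.leviCivita_eq_horLift hUh, S.leviCivita_eq_horLift hUh']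
    refine eq_of_mem_hor (add_mem (horLift_mem _ _ _) (horLift_mem _ _ _)) (horLift_mem _ _ _) ?_
    rw [map_add, mfderiv_horLift S.p_submersion, mfderiv_horLift S.p_submersion,
      mfderiv_horLift S.p_submersion, hα, map_add]
  -- By the structure equation the horizontal part of the bracket is the lift of `ρ β` minus T; its
  -- vertical part is I^ℋ.
  have hb : mlieBracket 𝓘(ℝ, EY) U U' y = integrabilityTensor (hor EY EM p) y u u'
      - S.torsionH y u u' + horLift p y (S.ρ (p y) β) := by
    have h1 := congrArg (S.ρ (p y)) (S.torsionY_eq hU.mdiff hU'.mdiff)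
    rw [map_sub, S.ρ_ι] at h1
    have h2 : projT (vert EY EM p y) (mlieBracket 𝓘(ℝ, EY) U U' y) =
        mlieBracket 𝓘(ℝ, EY) U U' y - (horLift p y (S.ρ (p y) β) - S.torsionH y u u') := by
      refine projT_eq_of_mem ?_ ?_
      · rw [mem_vert, map_sub, map_sub, mfderiv_horLift S.p_submersion, torsionH,
          mfderiv_horLift S.p_submersion]
        refine (congrArg (fun t => _ - (_ - t)) h1.symm).trans ?_
        rw [hβ]
        abel
      · rw [sub_sub_cancel]
        exact sub_mem (horLift_mem _ _ _) (horLift_mem _ _ _)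
    rw [integrabilityTensor_eq S.p_submersion hUh hUh', h2]
    abel
  have h1 := S.mvfderiv_of_mulI hJ.self_of_nhds (S.mfderiv_horLift_of_mem hσ)
  rw [hess_add_hess hg hU.mdiff hU'.mdiff (hJ.mono fun y' h => h _), ha, hb, map_add, h1, smul_add,
    smul_smul, Complex.I_mul_I, neg_one_smul]
  abel

theorem hess_add_hess_vert (hg : ContMDiffAt 𝓘(ℝ, EY) 𝓘(ℝ, G) 2 g y)
    (hJ : ∀ᶠ y' in 𝓝 y, ∀ u, mvfderiv 𝓘(ℝ, EY) g y' (Jφ EZ φ y' u) =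
      Complex.I • mvfderiv 𝓘(ℝ, EY) g y' u) {U : ∀ y : Y, TangentSpace 𝓘(ℝ, EY) y}
    (hU : IsFieldIn (vert EY EM p) U y) :
    hess g U y (U y) + hess g (Jfield EZ φ U) y (Jfield EZ φ U y) = 0 := by
  have h1 := S.mlieBracket_vert hU
  have h2 := S.isFieldIn_Jφ hU
  refine (hess_add_hess hg hU.mdiff h2.mdiff (hJ.mono fun y' h => h _)).trans ?_
  have h3 := congrArg (fun w => Complex.I • mvfderiv 𝓘(ℝ, EY) g y w) h1
  simp only [hJ.self_of_nhds, smul_smul, Complex.I_mul_I, neg_one_smul] at h3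
  exact sub_eq_zero.2 (neg_eq_iff_eq_neg.2 h3)

/-- `dg` kills ker dφ near `y`, so only `-dg(∇_v v)` is left, and it sees only the normal part. The
sum is `-dg` of the mean curvature. -/
theorem sum_hess_ker (hmin : HasMinimalFibres EY EZ φ)
    (hJ : ∀ᶠ y' in 𝓝 y, ∀ u, mvfderiv 𝓘(ℝ, EY) g y' (Jφ EZ φ y' u) =
      Complex.I • mvfderiv 𝓘(ℝ, EY) g y' u) :
    ∑ i, hess g (extendIn (vert EY EZ φ) (stdOrthonormalBasis ℝ (vert EY EZ φ y) i : TangentSpace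
        𝓘(ℝ, EY) y)) y
      (stdOrthonormalBasis ℝ (vert EY EZ φ y) i : TangentSpace 𝓘(ℝ, EY) y) = 0 := by
  have h1 : ∀ i, hess g (extendIn (vert EY EZ φ) (stdOrthonormalBasis ℝ (vert EY EZ φ y) i :
      TangentSpace 𝓘(ℝ, EY) y)) y
      (stdOrthonormalBasis ℝ (vert EY EZ φ y) i : TangentSpace 𝓘(ℝ, EY) y) =
      -mvfderiv 𝓘(ℝ, EY) g y (secondFund (vert EY EZ φ) y
        (stdOrthonormalBasis ℝ (vert EY EZ φ y) i : TangentSpace 𝓘(ℝ, EY) y)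
        (stdOrthonormalBasis ℝ (vert EY EZ φ y) i : TangentSpace 𝓘(ℝ, EY) y)) := by
    intro i
    set v : TangentSpace 𝓘(ℝ, EY) y := (stdOrthonormalBasis ℝ (vert EY EZ φ y) i : TangentSpace 𝓘(ℝ,
        EY) y)
    have h2 : mvfderiv 𝓘(ℝ, EY) (fun y' => mvfderiv 𝓘(ℝ, EY) g y'
        (extendIn (vert EY EZ φ) v y')) y v = 0 := by
      rw [mvfderiv_congr (g := fun _ => (0 : G)) ?_, mvfderiv_const]
      · rfl
      · filter_upwards [hJ] with y' h
        exact S.mvfderiv_of_ker h (projT_mem _ _)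
    have h3 := sub_projT_mem (vert EY EZ φ y)ᗮ (leviCivita (extendIn (vert EY EZ φ) v) y v)
    rw [Submodule.orthogonal_orthogonal] at h3
    have h4 := S.mvfderiv_of_ker hJ.self_of_nhds h3
    rw [map_sub, sub_eq_zero] at h4
    rw [hess, h2, zero_sub, secondFund, h4]
  simp only [h1]
  rw [Finset.sum_neg_distrib, ← map_sum, hmin y, map_zero, neg_zero]

end

end RiemannianTwistorialStructure

/-! ### The trace of the Hessian -/

namespace RiemannianTwistorialStructure

section

variable {EY EM EZ F : Type*}
  [NormedAddCommGroup EY] [NormedSpace ℝ EY] [FiniteDimensional ℝ EY]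
  [NormedAddCommGroup EM] [NormedSpace ℝ EM] [FiniteDimensional ℝ EM]
  [NormedAddCommGroup EZ] [NormedSpace ℂ EZ] [FiniteDimensional ℂ EZ]
  [NormedAddCommGroup F] [NormedSpace ℝ F] [FiniteDimensional ℝ F]
  {Y : Type*} [TopologicalSpace Y]
  [ChartedSpace EY Y] [IsManifold 𝓘(ℝ, EY) ∞ Y]
  [RiemannianBundle (fun y : Y => TangentSpace 𝓘(ℝ, EY) y)]
  [IsContMDiffRiemannianBundle 𝓘(ℝ, EY) ∞ EY (fun y : Y => TangentSpace 𝓘(ℝ, EY) y)]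
  {M : Type*} [TopologicalSpace M] [T2Space M]
  [ChartedSpace EM M] [IsManifold 𝓘(ℝ, EM) ∞ M]
  [RiemannianBundle (fun x : M => TangentSpace 𝓘(ℝ, EM) x)]
  [IsContMDiffRiemannianBundle 𝓘(ℝ, EM) ∞ EM (fun x : M => TangentSpace 𝓘(ℝ, EM) x)]
  {Z : Type*} [TopologicalSpace Z]
  [ChartedSpace EZ Z] [IsManifold 𝓘(ℂ, EZ) ω Z]
  {E : M → Type*} [TopologicalSpace (TotalSpace F E)]
  [∀ x, NormedAddCommGroup (E x)] [∀ x, InnerProductSpace ℝ (E x)]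
  [∀ x, FiniteDimensional ℝ (E x)] [FiberBundle F E] [VectorBundle ℝ F E]
  [ContMDiffVectorBundle ∞ F E 𝓘(ℝ, EM)] [IsContMDiffRiemannianBundle 𝓘(ℝ, EM) ∞ F E]
  {p : Y → M} {φ : Y → Z}
  (S : RiemannianTwistorialStructure EY EM EZ F E p φ)

include S

/-- The complex structure `J` as a linear map. -/
theorem exists_linearMap_J (y : Y) : ∃ J : TangentSpace 𝓘(ℝ, EY) y →ₗ[ℝ] TangentSpace 𝓘(ℝ, EY) y,
    ∀ u, J u = Jφ EZ φ y u :=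
  ⟨⟨⟨Jφ EZ φ y, (S.coCRData y).J_add⟩, (S.coCRData y).J_smul⟩, fun _ => rfl⟩

/-- `J` takes an orthonormal basis of `N` to another Parseval frame, so the trace is the mean of the
two sums. This is the origin of the factor 1/2 in the Laplacian. -/
theorem sum_rotate {G : Type*} [AddCommGroup G] [Module ℝ G] {y : Y}
    {N : Submodule ℝ (TangentSpace 𝓘(ℝ, EY) y)} (hN : N ≤ hor EY EZ φ y)
    (hJN : ∀ u ∈ N, Jφ EZ φ y u ∈ N)
    (B : TangentSpace 𝓘(ℝ, EY) y →ₗ[ℝ] TangentSpace 𝓘(ℝ, EY) y →ₗ[ℝ] G) :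
    ∑ i, B (stdOrthonormalBasis ℝ N i) (stdOrthonormalBasis ℝ N i) =
      (1 / 2 : ℝ) • ∑ i, (B (stdOrthonormalBasis ℝ N i) (stdOrthonormalBasis ℝ N i) +
        B (Jφ EZ φ y (stdOrthonormalBasis ℝ N i)) (Jφ EZ φ y (stdOrthonormalBasis ℝ N i))) := by
  obtain ⟨J, hJ⟩ := S.exists_linearMap_J y
  have h1 := OrthonormalBasis.isParseval_coe (stdOrthonormalBasis ℝ N)
  have h2 := h1.rotate J (fun u hu => hJ u ▸ hJN u hu)
    (fun u hu => by rw [hJ, hJ]; exact (S.coCRData y).J_J (hN hu))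
    (fun u hu v hv => by rw [hJ, hJ]; exact (S.coCRData y).inner_J_left (hN hu) (hN hv))
  have h3 := h1.sum_diag_eq h2 B
  simp only [hJ] at h3
  rw [Finset.sum_add_distrib, ← h3, ← two_smul ℝ, smul_smul]
  norm_num

/-- The three subspaces are mutually orthogonal, because ker dφ ⊆ ℋ, and span the tangent space. -/
theorem sum_diag_eq {G : Type*} [AddCommGroup G] [Module ℝ G] (y : Y)
    (B : TangentSpace 𝓘(ℝ, EY) y →ₗ[ℝ] TangentSpace 𝓘(ℝ, EY) y →ₗ[ℝ] G) :
    ∑ i, B (stdOrthonormalBasis ℝ (TangentSpace 𝓘(ℝ, EY) y) i)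
        (stdOrthonormalBasis ℝ (TangentSpace 𝓘(ℝ, EY) y) i) =
      ∑ i, B (stdOrthonormalBasis ℝ (vert EY EZ φ y) i) (stdOrthonormalBasis ℝ (vert EY EZ φ y) i)
      + ∑ i, B (stdOrthonormalBasis ℝ (vert EY EM p y) i) (stdOrthonormalBasis ℝ (vert EY EM p y) i)
      + ∑ i, B (stdOrthonormalBasis ℝ (hor EY EM p y ⊓ hor EY EZ φ y : Submodule ℝ _) i)
        (stdOrthonormalBasis ℝ (hor EY EM p y ⊓ hor EY EZ φ y : Submodule ℝ _) i) := by
  have h1 := OrthonormalBasis.isParseval_coe (stdOrthonormalBasis ℝ (vert EY EZ φ y))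
  have h2 := OrthonormalBasis.isParseval_coe (stdOrthonormalBasis ℝ (vert EY EM p y))
  have h3 := OrthonormalBasis.isParseval_coe (stdOrthonormalBasis ℝ (hor EY EM p y ⊓ hor EY EZ φ y :
      Submodule ℝ _))
  have h4 : vert EY EZ φ y ⟂ vert EY EM p y :=
    (Submodule.isOrtho_iff_le.2 (S.coCRData y).le_orthogonal_ker).symm
  have h5 : hor EY EM p y ⊓ hor EY EZ φ y = (vert EY EZ φ y ⊔ vert EY EM p y)ᗮ := by
    rw [sup_comm]
    exact Submodule.inf_orthogonal _ _
  have h6 : vert EY EZ φ y ⊔ vert EY EM p y ⟂ hor EY EM p y ⊓ hor EY EZ φ y := by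
    rw [h5]
    exact Submodule.isOrtho_orthogonal_right _
  have h7 : vert EY EZ φ y ⊔ vert EY EM p y ⊔ hor EY EM p y ⊓ hor EY EZ φ y = ⊤ := by
    rw [h5]
    have : CompleteSpace (vert EY EZ φ y ⊔ vert EY EM p y : Submodule ℝ _) :=
      FiniteDimensional.complete ℝ _
    exact Submodule.sup_orthogonal_of_hasOrthogonalProjection
  have h8 := (h1.sumElim h2 h4).sumElim h3 h6
  rw [h7] at h8
  rw [(OrthonormalBasis.isParseval (stdOrthonormalBasis ℝ (TangentSpace 𝓘(ℝ, EY) y))).sum_diag_eq h8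
      B]
  simp only [Fintype.sum_sum_type, Sum.elim_inl, Sum.elim_inr]

theorem sum_hess (hmin : HasMinimalFibres EY EZ φ)
    {G : Type*} [NormedAddCommGroup G] [NormedSpace ℂ G] {g : Y → G} {y : Y}
    (hg : ContMDiffAt 𝓘(ℝ, EY) 𝓘(ℝ, G) 2 g y)
    (hJ : ∀ᶠ y' in 𝓝 y, ∀ u, mvfderiv 𝓘(ℝ, EY) g y' (Jφ EZ φ y' u) =
      Complex.I • mvfderiv 𝓘(ℝ, EY) g y' u) :
    ∑ i, hess g (FiberBundle.extend EY (stdOrthonormalBasis ℝ (TangentSpace 𝓘(ℝ, EY) y) i)) y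
        (stdOrthonormalBasis ℝ (TangentSpace 𝓘(ℝ, EY) y) i) =
      -((1 / 2 : ℝ) • Complex.I • mvfderiv 𝓘(ℝ, EY) g y
        (∑ i, (integrabilityTensor (hor EY EM p) y
          (stdOrthonormalBasis ℝ (hor EY EM p y ⊓ hor EY EZ φ y : Submodule ℝ _) i)
          (Jφ EZ φ y (stdOrthonormalBasis ℝ (hor EY EM p y ⊓ hor EY EZ φ y : Submodule ℝ _) i))
        - S.torsionH y
          (stdOrthonormalBasis ℝ (hor EY EM p y ⊓ hor EY EZ φ y : Submodule ℝ _) i)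
          (Jφ EZ φ y
            (stdOrthonormalBasis ℝ (hor EY EM p y ⊓ hor EY EZ φ y : Submodule ℝ _) i))))) := by
  have : FiniteDimensional ℝ EZ := FiniteDimensional.complexToReal EZ
  obtain ⟨B, hB⟩ := exists_hessian hg
  have h0 : ∀ v : TangentSpace 𝓘(ℝ, EY) y, hess g (FiberBundle.extend EY v) y v = B v v := by
    intro v
    rw [← hB _ (FiberBundle.mdifferentiableAt_extend ..), FiberBundle.extend_apply_self]
  have h1 : ∑ i, B (stdOrthonormalBasis ℝ (vert EY EZ φ y) i)
      (stdOrthonormalBasis ℝ (vert EY EZ φ y) i) = 0 := by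
    rw [← S.sum_hess_ker hmin hJ]
    refine Finset.sum_congr rfl fun i _ => ?_
    rw [← hB _ (isFieldIn_extendIn_vert S.φ_submersion _).mdiff,
      extendIn_self (D := vert EY EZ φ) (Subtype.mem _)]
  have h2 : ∀ v ∈ vert EY EM p y, B v v + B (Jφ EZ φ y v) (Jφ EZ φ y v) = 0 := by
    intro v hv
    have hU := isFieldIn_extendIn_vert S.p_submersion v
    have hUy : extendIn (vert EY EM p) v y = v := extendIn_self hv
    have h4 := S.hess_add_hess_vert hg hJ hU
    have h5 := hB (Jfield EZ φ (extendIn (vert EY EM p) v)) (S.isFieldIn_Jφ hU).mdiff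
    rw [← hB _ hU.mdiff, ← h5, Jfield, hUy] at h4
    exact h4
  have h3 : ∀ v ∈ hor EY EM p y ⊓ hor EY EZ φ y, B v v + B (Jφ EZ φ y v) (Jφ EZ φ y v) =
      -(Complex.I • mvfderiv 𝓘(ℝ, EY) g y (integrabilityTensor (hor EY EM p) y v (Jφ EZ φ y v)
        - S.torsionH y v (Jφ EZ φ y v))) := by
    intro v hv
    obtain ⟨U, hU, hUy⟩ := S.exists_field hv
    have h4 := S.hess_add_hess_hor hg hJ hU
    rw [← hB _ hU.mdiff, ← hB _ (S.isFieldIn_Jfield hU).mdiff, Jfield, hUy] at h4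
    exact h4
  simp only [h0]
  rw [S.sum_diag_eq y B, h1, zero_add, S.sum_rotate (S.coCRData y).le_orthogonal_ker
    (fun u hu => (S.coCRData y).J_vert hu), S.sum_rotate (N := hor EY EM p y ⊓ hor EY EZ φ y)
        inf_le_right
    (fun u hu => (S.coCRData y).J_hor hu), Finset.sum_eq_zero fun i _ => h2 _ (Subtype.mem _),
    smul_zero, zero_add, Finset.sum_congr rfl fun i _ => h3 _ (Subtype.mem _),
    Finset.sum_neg_distrib, smul_neg, map_sum, ← Finset.smul_sum]

end

end RiemannianTwistorialStructure

/-! ### Holomorphic functions of several variables are smooth -/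

section Osgood

variable {E : Type*} [NormedAddCommGroup E] [NormedSpace ℂ E] [FiniteDimensional ℂ E]
  {G : Type*} [NormedAddCommGroup G] [NormedSpace ℂ G]

open Metric in
-- Cauchy's estimate is applied to `f(· + h) - f`, which is uniformly small by uniform continuity of
-- `f`.
theorem continuousOn_fderiv_of_differentiableOn {f : E → G} {W : Set E} (hW : IsOpen W)
    (hf : DifferentiableOn ℂ f W) : ContinuousOn (fderiv ℂ f) W := by
  have : ProperSpace E := FiniteDimensional.proper ℂ E
  intro x hx
  refine ContinuousAt.continuousWithinAt ?_
  obtain ⟨R, hR, hRW⟩ := nhds_basis_closedBall.mem_iff.1 (hW.mem_nhds hx)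
  have huc : UniformContinuousOn f (closedBall x R) :=
    (isCompact_closedBall x R).uniformContinuousOn_of_continuous (hf.continuousOn.mono hRW)
  rw [Metric.continuousAt_iff]
  intro ε hε
  have hr : 0 < R / 4 := by positivity
  -- With this bound on a ball of radius `R / 4` the difference maps into a ball of radius `ε / 2 *
  -- (R / 4)` around its central value, so its derivative has norm at most `ε / 2`.
  obtain ⟨δ, hδ, hδf⟩ := Metric.uniformContinuousOn_iff.1 huc (ε / 4 * (R / 4)) (by positivity)
  refine ⟨min δ (R / 4), by positivity, fun {z} hz => ?_⟩
  have hz1 : dist z x < δ := hz.trans_le (min_le_left _ _)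
  have hz2 : dist z x < R / 4 := hz.trans_le (min_le_right _ _)
  set h := z - x with hh
  have hnorm : ‖h‖ = dist z x := (dist_eq_norm z x).symm
  let g : E → G := fun w => f (w + h) - f w
  have hmem1 : ∀ w ∈ ball x (R / 4), w ∈ closedBall x R := fun w hw => by
    rw [mem_ball] at hw
    rw [mem_closedBall]
    linarith
  have hmem2 : ∀ w ∈ ball x (R / 4), w + h ∈ closedBall x R := fun w hw => by
    rw [mem_ball] at hw
    rw [mem_closedBall]
    have : dist (w + h) x ≤ dist (w + h) w + dist w x := dist_triangle _ _ _
    rw [dist_self_add_left, hnorm] at this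
    linarith
  have hd1 : ∀ w ∈ ball x (R / 4), DifferentiableAt ℂ f w := fun w hw =>
    hf.differentiableAt (hW.mem_nhds (hRW (hmem1 w hw)))
  have hd2 : ∀ w ∈ ball x (R / 4), DifferentiableAt ℂ (fun w => f (w + h)) w := fun w hw =>
    (hf.differentiableAt (hW.mem_nhds (hRW (hmem2 w hw)))).comp w
      (differentiableAt_id.add_const h)
  have hg : DifferentiableOn ℂ g (ball x (R / 4)) := fun w hw =>
    ((hd2 w hw).sub (hd1 w hw)).differentiableWithinAt
  have hgb : ∀ w ∈ ball x (R / 4), ‖g w‖ < ε / 4 * (R / 4) := fun w hw => by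
    have := hδf _ (hmem2 w hw) _ (hmem1 w hw) (by rw [dist_self_add_left, hnorm]; exact hz1)
    rwa [dist_eq_norm] at this
  have hxb : x ∈ ball x (R / 4) := mem_ball_self hr
  have hmaps : Set.MapsTo g (ball x (R / 4)) (ball (g x) (ε / 2 * (R / 4))) := by
    intro w hw
    rw [mem_ball, dist_eq_norm]
    have := norm_sub_le (g w) (g x)
    linarith [hgb w hw, hgb x hxb]
  have key := Complex.norm_fderiv_le_div_of_mapsTo_ball hg
    (hmaps.mono_right ball_subset_closedBall) hr
  have h1 : fderiv ℂ g x = fderiv ℂ f z - fderiv ℂ f x := by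
    have h2 := fderiv_sub (hd2 x hxb) (hd1 x hxb)
    refine h2.trans ?_
    rw [fderiv_comp_add_right, hh, add_sub_cancel]
  rw [dist_eq_norm, ← h1]
  refine key.trans_lt ?_
  rw [mul_div_assoc, div_self hr.ne']
  linarith

open Metric in
-- Cauchy's formula on the complex line `ζ ↦ x + ζ v` writes the directional derivative as an
-- integral of `f` over the unit circle, which is differentiated in `x` under the integral sign.
theorem differentiableAt_fderiv_apply [CompleteSpace G] {f : E → G} {W : Set E} (hW : IsOpen W)
    (hf : DifferentiableOn ℂ f W) {x₀ : E} (hx₀ : x₀ ∈ W) (v : E) :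
    DifferentiableAt ℂ (fun x => fderiv ℂ f x v) x₀ := by
  have : ProperSpace E := FiniteDimensional.proper ℂ E
  have hf' := continuousOn_fderiv_of_differentiableOn hW hf
  obtain ⟨R', hR', hRW'⟩ := nhds_basis_closedBall.mem_iff.1 (hW.mem_nhds hx₀)
  obtain ⟨R, hR, hRR⟩ : ∃ R, 0 < R ∧ R' = 2 * R := ⟨R' / 2, by positivity, by ring⟩
  subst hRR
  obtain ⟨C, hC⟩ := (isCompact_closedBall x₀ (2 * R)).exists_bound_of_continuousOn (hf'.mono hRW')
  have small : ∀ v : E, ‖v‖ ≤ R → DifferentiableAt ℂ (fun x => fderiv ℂ f x v) x₀ := by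
    intro v hv
    have hmem : ∀ x ∈ ball x₀ R, ∀ ζ : ℂ, ‖ζ‖ ≤ 1 → x + ζ • v ∈ closedBall x₀ (2 * R) := by
      intro x hx ζ hζ
      rw [mem_ball] at hx
      rw [mem_closedBall]
      have h1 : dist (x + ζ • v) x₀ ≤ dist (x + ζ • v) x + dist x x₀ := dist_triangle _ _ _
      rw [dist_self_add_left, norm_smul] at h1
      have h2 : ‖ζ‖ * ‖v‖ ≤ 1 * R := mul_le_mul hζ hv (norm_nonneg _) zero_le_one
      linarith
    have hcm : ∀ θ : ℝ, ‖circleMap 0 1 θ‖ ≤ 1 := fun θ => by simp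
    -- The weight of Cauchy's formula for the derivative at the centre. It has modulus one, so the
    -- bound `C` on the derivative of `f` also dominates the integrand.
    let a : ℝ → ℂ := fun θ => deriv (circleMap 0 1) θ * ((circleMap 0 1 θ - 0) ^ 2)⁻¹
    have hne : ∀ θ : ℝ, (circleMap 0 1 θ - 0) ^ 2 ≠ 0 := fun θ => by
      rw [sub_zero]
      exact pow_ne_zero _ (circleMap_ne_center one_ne_zero)
    have ha : Continuous a := by
      refine Continuous.mul ?_ (Continuous.inv₀ (((continuous_circleMap 0 1).sub
          continuous_const).pow 2) hne)
      have h : deriv (circleMap 0 1) = fun θ => circleMap 0 1 θ * Complex.I :=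
        funext fun θ => deriv_circleMap 0 1 θ
      rw [h]
      exact (continuous_circleMap 0 1).mul continuous_const
    have han : ∀ θ, ‖a θ‖ = 1 := fun θ => by simp [a, deriv_circleMap]
    have hline : ∀ x, Continuous fun θ : ℝ => x + circleMap 0 1 θ • v := fun x =>
      continuous_const.add ((continuous_circleMap 0 1).smul continuous_const)
    have hcont : ∀ x ∈ ball x₀ R, Continuous fun θ : ℝ => a θ • f (x + circleMap 0 1 θ • v) :=
      fun x hx => ha.smul (hf.continuousOn.comp_continuous (hline x)
        fun θ => hRW' (hmem x hx _ (hcm θ)))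
    have hcont' : Continuous fun θ : ℝ => a θ • fderiv ℂ f (x₀ + circleMap 0 1 θ • v) :=
      ha.smul (hf'.comp_continuous (hline x₀)
        fun θ => hRW' (hmem x₀ (mem_ball_self hR) _ (hcm θ)))
    have hI := intervalIntegral.hasFDerivAt_integral_of_dominated_of_fderiv_le (𝕜 := ℂ)
      (μ := MeasureTheory.volume) (a := 0) (b := 2 * Real.pi)
      (F := fun x θ => a θ • f (x + circleMap 0 1 θ • v))
      (F' := fun x θ => a θ • fderiv ℂ f (x + circleMap 0 1 θ • v)) (bound := fun _ => C)
      (ball_mem_nhds x₀ hR)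
      (by
        filter_upwards [ball_mem_nhds x₀ hR] with x hx
        exact (hcont x hx).aestronglyMeasurable)
      ((hcont x₀ (mem_ball_self hR)).intervalIntegrable _ _)
      hcont'.aestronglyMeasurable
      (.of_forall fun θ _ x hx => by
        rw [norm_smul, han, one_mul]
        exact hC _ (hmem x hx _ (hcm θ)))
      intervalIntegrable_const
      (.of_forall fun θ _ x hx => by
        have h1 := (hf.differentiableAt (hW.mem_nhds (hRW' (hmem x hx _ (hcm θ))))).hasFDerivAt
        have h2 := h1.comp x ((hasFDerivAt_id x).add_const (circleMap 0 1 θ • v))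
        exact h2.const_smul (a θ))
    have hd := hI.differentiableAt.const_smul ((2 * Real.pi * Complex.I : ℂ)⁻¹)
    refine hd.congr_of_eventuallyEq ?_
    filter_upwards [ball_mem_nhds x₀ hR] with x hx
    let ℓ : ℂ → E := fun ζ => x + ζ • v
    have hℓ : Differentiable ℂ ℓ := (differentiable_id.smul_const v).const_add x
    have hU : IsOpen (ℓ ⁻¹' W) := hW.preimage hℓ.continuous
    have h1 := Complex.two_pi_I_inv_smul_circleIntegral_sub_sq_inv_smul_of_differentiable hU
      (c := 0) (w₀ := 0) (R := 1) (f := f ∘ ℓ)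
      (fun ζ hζ => hRW' (hmem x hx ζ (by simpa using hζ)))
      (hf.comp hℓ.differentiableOn fun ζ hζ => hζ) (mem_ball_self one_pos)
    have h2 : HasDerivAt ℓ v 0 := by
      have h := ((hasDerivAt_id (0 : ℂ)).smul_const v).const_add x
      rw [one_smul] at h
      exact h
    have h3 : ℓ 0 = x := by simp [ℓ]
    have hxW : x ∈ W := by
      have := hRW' (hmem x hx 0 (by simp))
      simpa using this
    have h4 : HasFDerivAt f (fderiv ℂ f x) (ℓ 0) := by
      rw [h3]
      exact (hf.differentiableAt (hW.mem_nhds hxW)).hasFDerivAt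
    rw [(h4.comp_hasDerivAt (0 : ℂ) h2).deriv] at h1
    rw [← h1, circleIntegral]
    simp only [Pi.smul_apply]
    congr 1
    refine intervalIntegral.integral_congr fun θ _ => ?_
    simp only [a, mul_smul]
    rfl
  by_cases hv : v = 0
  · subst hv
    simp only [map_zero]
    exact differentiableAt_const _
  -- A general vector is rescaled to length `R`, so that the unit disc of its complex line stays in
  -- the compact ball.
  · have hv' : ‖v‖ ≠ 0 := norm_ne_zero_iff.2 hv
    have h1 := (small (((R / ‖v‖ : ℝ) : ℂ) • v) (by
      rw [norm_smul, Complex.norm_real, Real.norm_of_nonneg (by positivity),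
        div_mul_cancel₀ _ hv'])).const_smul (((‖v‖ / R : ℝ) : ℂ))
    refine h1.congr_of_eventuallyEq (.of_forall fun x => ?_)
    simp only [Pi.smul_apply, map_smul, smul_smul]
    rw [← Complex.ofReal_mul, div_mul_div_cancel₀ hR.ne', div_self hv', Complex.ofReal_one,
        one_smul]

theorem differentiableOn_fderiv [CompleteSpace G] {f : E → G} {W : Set E} (hW : IsOpen W)
    (hf : DifferentiableOn ℂ f W) : DifferentiableOn ℂ (fderiv ℂ f) W := by
  intro x hx
  refine DifferentiableAt.differentiableWithinAt ?_
  let b := Module.finBasis ℂ E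
  have h : fderiv ℂ f = fun y => ∑ i, ContinuousLinearMap.smulRightL ℂ E G
      (LinearMap.toContinuousLinearMap (b.coord i)) (fderiv ℂ f y (b i)) := by
    ext y v
    conv_lhs => rw [← b.sum_repr v, map_sum]
    simp [_root_.sum_apply, map_smul, Module.Basis.coord_apply]
  rw [h]
  exact DifferentiableAt.fun_sum fun i _ =>
    (ContinuousLinearMap.differentiableAt _).comp x (differentiableAt_fderiv_apply hW hf hx (b i))

theorem contDiffOn_two_of_differentiableOn [CompleteSpace G] {f : E → G} {W : Set E}
    (hW : IsOpen W) (hf : DifferentiableOn ℂ f W) : ContDiffOn ℂ 2 f W := by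
  have h1 := differentiableOn_fderiv hW hf
  have h2 := differentiableOn_fderiv hW h1
  have h3 : ContDiffOn ℂ (0 + 1) (fderiv ℂ f) W :=
    (contDiffOn_succ_iff_fderiv_of_isOpen hW).2 ⟨h1, by simp, contDiffOn_zero.2 h2.continuousOn⟩
  have h4 : ContDiffOn ℂ (0 + 1 + 1) f W :=
    (contDiffOn_succ_iff_fderiv_of_isOpen hW).2 ⟨hf, by simp, h3⟩
  rwa [zero_add, one_add_one_eq_two] at h4

end Osgood

/-! ### Regularity of holomorphic functions on a complex manifold -/

section

variable {EZ : Type*} [NormedAddCommGroup EZ] [NormedSpace ℂ EZ] [FiniteDimensional ℂ EZ]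
  {Z : Type*} [TopologicalSpace Z] [ChartedSpace EZ Z] [IsManifold 𝓘(ℂ, EZ) ω Z]
  {G : Type*} [NormedAddCommGroup G] [NormedSpace ℂ G] [CompleteSpace G]

theorem contMDiffAt_of_mdifferentiableOn {f : Z → G} {U : Set Z} (hU : IsOpen U)
    (hf : MDifferentiableOn 𝓘(ℂ, EZ) 𝓘(ℂ, G) f U) {z : Z} (hz : z ∈ U) :
    ContMDiffAt 𝓘(ℝ, EZ) 𝓘(ℝ, G) 2 f z := by
  have : IsManifold 𝓘(ℂ, EZ) 1 Z := IsManifold.of_le (n := ω) le_top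
  have hd : ∀ z' ∈ U, MDifferentiableAt 𝓘(ℂ, EZ) 𝓘(ℂ, G) f z' := fun z' hz' =>
    (hf z' hz').mdifferentiableAt (hU.mem_nhds hz')
  set e := extChartAt 𝓘(ℂ, EZ) z with he
  have hW : IsOpen (e.target ∩ e.symm ⁻¹' U) :=
    (continuousOn_extChartAt_symm z).isOpen_inter_preimage (isOpen_extChartAt_target z) hU
  have h1 : DifferentiableOn ℂ (f ∘ e.symm) (e.target ∩ e.symm ⁻¹' U) := by
    intro w hw
    refine DifferentiableAt.differentiableWithinAt ?_
    rw [← mdifferentiableAt_iff_differentiableAt]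
    refine MDifferentiableAt.comp w (hd _ hw.2) ?_
    have := mdifferentiableWithinAt_extChartAt_symm (I := 𝓘(ℂ, EZ)) (x := z) hw.1
    rwa [modelWithCornersSelf_coe, Set.range_id, mdifferentiableWithinAt_univ] at this
  have h2 : ContDiffAt ℂ 2 (f ∘ e.symm) (e z) :=
    (contDiffOn_two_of_differentiableOn hW h1).contDiffAt
      (hW.mem_nhds ⟨mem_extChartAt_target z, by
        rw [Set.mem_preimage, he, extChartAt_to_inv]; exact hz⟩)
  rw [contMDiffAt_iff]
  refine ⟨(hd z hz).continuousAt, ?_⟩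
  rw [modelWithCornersSelf_coe, Set.range_id, contDiffWithinAt_univ]
  exact h2.restrict_scalars ℝ

theorem mdifferentiableOn_chart_complex (z : Z) :
    MDifferentiableOn 𝓘(ℂ, EZ) 𝓘(ℂ, EZ) (extChartAt 𝓘(ℝ, EZ) z) (chartAt EZ z).source :=
  fun _ h => (mdifferentiableAt_chart_complex h).mdifferentiableWithinAt

end

/-! ### The Laplacian of `f ∘ φ` and the equivalence of (i) and (ii) -/

namespace RiemannianTwistorialStructure

section

variable {EY EM EZ F : Type*}
  [NormedAddCommGroup EY] [NormedSpace ℝ EY] [FiniteDimensional ℝ EY]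
  [NormedAddCommGroup EM] [NormedSpace ℝ EM] [FiniteDimensional ℝ EM]
  [NormedAddCommGroup EZ] [NormedSpace ℂ EZ] [FiniteDimensional ℂ EZ]
  [NormedAddCommGroup F] [NormedSpace ℝ F] [FiniteDimensional ℝ F]
  {Y : Type*} [TopologicalSpace Y]
  [ChartedSpace EY Y] [IsManifold 𝓘(ℝ, EY) ∞ Y]
  [RiemannianBundle (fun y : Y => TangentSpace 𝓘(ℝ, EY) y)]
  [IsContMDiffRiemannianBundle 𝓘(ℝ, EY) ∞ EY (fun y : Y => TangentSpace 𝓘(ℝ, EY) y)]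
  {M : Type*} [TopologicalSpace M] [T2Space M]
  [ChartedSpace EM M] [IsManifold 𝓘(ℝ, EM) ∞ M]
  [RiemannianBundle (fun x : M => TangentSpace 𝓘(ℝ, EM) x)]
  [IsContMDiffRiemannianBundle 𝓘(ℝ, EM) ∞ EM (fun x : M => TangentSpace 𝓘(ℝ, EM) x)]
  {Z : Type*} [TopologicalSpace Z]
  [ChartedSpace EZ Z] [IsManifold 𝓘(ℂ, EZ) ω Z]
  {E : M → Type*} [TopologicalSpace (TotalSpace F E)]
  [∀ x, NormedAddCommGroup (E x)] [∀ x, InnerProductSpace ℝ (E x)]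
  [∀ x, FiniteDimensional ℝ (E x)] [FiberBundle F E] [VectorBundle ℝ F E]
  [ContMDiffVectorBundle ∞ F E 𝓘(ℝ, EM)] [IsContMDiffRiemannianBundle 𝓘(ℝ, EM) ∞ F E]
  {p : Y → M} {φ : Y → Z}
  (S : RiemannianTwistorialStructure EY EM EZ F E p φ)

/-- The trace of `I^ℋ - T` with respect to the Kähler form of `ℋ ∩ 𝒦`. -/
def traceIT (y : Y) : TangentSpace 𝓘(ℝ, EY) y :=
  ∑ i, (integrabilityTensor (hor EY EM p) y
      (stdOrthonormalBasis ℝ (hor EY EM p y ⊓ hor EY EZ φ y : Submodule ℝ _) i)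
      (Jφ EZ φ y (stdOrthonormalBasis ℝ (hor EY EM p y ⊓ hor EY EZ φ y : Submodule ℝ _) i))
    - S.torsionH y
      (stdOrthonormalBasis ℝ (hor EY EM p y ⊓ hor EY EZ φ y : Submodule ℝ _) i)
      (Jφ EZ φ y (stdOrthonormalBasis ℝ (hor EY EM p y ⊓ hor EY EZ φ y : Submodule ℝ _) i)))

include S in
-- The part of `b` removed by the projection is in ker dp ⊕ ker dφ and is horizontal. Since ker dφ
-- is horizontal too, its component in ker dp is zero.
theorem mfderiv_projT {y : Y} {b : TangentSpace 𝓘(ℝ, EY) y} (hb : b ∈ hor EY EM p y) :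
    mfderiv 𝓘(ℝ, EY) 𝓘(ℝ, EZ) φ y (projT (hor EY EM p y ⊓ hor EY EZ φ y) b) =
      mfderiv 𝓘(ℝ, EY) 𝓘(ℝ, EZ) φ y b := by
  set D := hor EY EM p y ⊓ hor EY EZ φ y with hD
  have h1 : D = (vert EY EM p y ⊔ vert EY EZ φ y)ᗮ := Submodule.inf_orthogonal _ _
  have h2 : b - projT D b ∈ vert EY EM p y ⊔ vert EY EZ φ y := by
    have := sub_projT_mem D b
    rw [h1, Submodule.orthogonal_orthogonal, ← h1] at this
    exact this
  obtain ⟨v, hv, n, hn, hvn⟩ := Submodule.mem_sup.1 h2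
  have h3 : b - projT D b ∈ hor EY EM p y := sub_mem hb (projT_mem D b).1
  have h4 : v ∈ hor EY EM p y := by
    rw [← hvn] at h3
    have := sub_mem h3 ((S.coCRData y).ker_le hn)
    rwa [add_sub_cancel_right] at this
  have h5 : v = 0 := by
    have : v ∈ vert EY EM p y ⊓ (vert EY EM p y)ᗮ := ⟨hv, h4⟩
    rwa [Submodule.inf_orthogonal_eq_bot, Submodule.mem_bot] at this
  rw [h5, zero_add] at hvn
  have h6 : mfderiv 𝓘(ℝ, EY) 𝓘(ℝ, EZ) φ y (b - projT D b) = 0 := by rw [← hvn]; exact hn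
  rw [map_sub, sub_eq_zero] at h6
  exact h6.symm

/-- With `a` the trace of I^ℋ and `c` the projected trace of T, the two conditions are `a - c = 0`,
because `dφ` is injective on 𝒦, and `a + c = 0`. As `a` is vertical and `c` horizontal, each says
that both are zero. -/
theorem mfderiv_traceIT_eq_zero_iff (y : Y) :
    mfderiv 𝓘(ℝ, EY) 𝓘(ℝ, EZ) φ y (S.traceIT y) = 0 ↔ S.traceω y = 0 := by
  let e := fun i => (stdOrthonormalBasis ℝ (hor EY EM p y ⊓ hor EY EZ φ y : Submodule ℝ _) i :
    TangentSpace 𝓘(ℝ, EY) y)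
  set a := ∑ i, integrabilityTensor (hor EY EM p) y (e i) (Jφ EZ φ y (e i)) with ha
  set b := ∑ i, S.torsionH y (e i) (Jφ EZ φ y (e i)) with hb
  have ha' : a ∈ vert EY EM p y := sum_mem fun i _ => by
    rw [← hor_orthogonal]
    exact projT_mem _ _
  have hb' : b ∈ hor EY EM p y := sum_mem fun i _ => horLift_mem _ _ _
  set c := projT (hor EY EM p y ⊓ hor EY EZ φ y) b with hc
  have hc' : c ∈ hor EY EM p y ⊓ hor EY EZ φ y := projT_mem _ _
  have h1 : S.traceIT y = a - b := Finset.sum_sub_distrib ..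
  have h2 : S.traceω y = a + c := by
    have h3 : c = ∑ i, projT (hor EY EM p y ⊓ hor EY EZ φ y)
      (S.torsionH y (e i) (Jφ EZ φ y (e i))) := map_sum _ _ _
    rw [h3]
    exact Finset.sum_add_distrib
  have h3 : mfderiv 𝓘(ℝ, EY) 𝓘(ℝ, EZ) φ y (S.traceIT y) =
      mfderiv 𝓘(ℝ, EY) 𝓘(ℝ, EZ) φ y (a - c) := by
    rw [h1, map_sub, map_sub, hc, S.mfderiv_projT hb']
  have key : ∀ r : TangentSpace 𝓘(ℝ, EY) y, r ∈ hor EY EM p y → a + r = 0 → r = 0 := by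
    intro r hr har
    have : r ∈ vert EY EM p y ⊓ (vert EY EM p y)ᗮ :=
      ⟨by rw [eq_neg_of_add_eq_zero_right har]; exact neg_mem ha', hr⟩
    rwa [Submodule.inf_orthogonal_eq_bot, Submodule.mem_bot] at this
  rw [h2, h3]
  constructor
  · intro h
    have h4 : a - c = 0 := eq_of_mem_hor
      (sub_mem ((S.coCRData y).le_orthogonal_ker ha') hc'.2) (zero_mem _) (h.trans (map_zero
          _).symm)
    rw [sub_eq_add_neg] at h4
    have h5 := neg_eq_zero.1 (key _ (neg_mem hc'.1) h4)
    rw [h5, neg_zero] at h4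
    rw [h5, h4]
  · intro h
    have h5 := key _ hc'.1 h
    rw [h5, add_zero] at h
    rw [h5, h, sub_zero, map_zero]

/-- The Laplacian of the pull back of a holomorphic function. -/
theorem sum_hess_comp (hmin : HasMinimalFibres EY EZ φ)
    {G : Type*} [NormedAddCommGroup G] [NormedSpace ℂ G] [CompleteSpace G] {f : Z → G} {U : Set Z}
    (hU : IsOpen U) (hf : MDifferentiableOn 𝓘(ℂ, EZ) 𝓘(ℂ, G) f U) {y : Y} (hy : φ y ∈ U) :
    ∑ i, hess (fun y' => f (φ y'))
        (FiberBundle.extend EY (stdOrthonormalBasis ℝ (TangentSpace 𝓘(ℝ, EY) y) i)) y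
        (stdOrthonormalBasis ℝ (TangentSpace 𝓘(ℝ, EY) y) i) =
      -((1 / 2 : ℝ) • Complex.I • mvfderiv 𝓘(ℝ, EZ) f (φ y)
        (mfderiv 𝓘(ℝ, EY) 𝓘(ℝ, EZ) φ y (S.traceIT y))) := by
  have hφ := S.φ_submersion.smooth
  have hφd : MDifferentiable 𝓘(ℝ, EY) 𝓘(ℝ, EZ) φ := hφ.mdifferentiable (by simp)
  have hfC := fun z (hz : z ∈ U) => contMDiffAt_of_mdifferentiableOn hU hf hz
  have hg : ContMDiffAt 𝓘(ℝ, EY) 𝓘(ℝ, G) 2 (fun y' => f (φ y')) y :=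
    (hfC _ hy).comp y ((hφ y).of_le (by norm_cast))
  have hfd : ∀ z ∈ U, MDifferentiableAt 𝓘(ℝ, EZ) 𝓘(ℝ, G) f z := fun z hz =>
    (hfC z hz).mdifferentiableAt (by simp)
  rw [S.sum_hess hmin hg, ← mvfderiv_comp_mfderiv (hfd _ hy) (hφd y)]
  · rfl
  · filter_upwards [hφ.continuous.continuousAt.preimage_mem_nhds (hU.mem_nhds hy)] with y' hy' u
    rw [mvfderiv_comp_mfderiv (hfd _ hy') (hφd y'), mvfderiv_comp_mfderiv (hfd _ hy') (hφd y'),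
      mfderiv_Jφ S.φ_submersion,
      mvfderiv_mulI ((hf _ hy').mdifferentiableAt (hU.mem_nhds hy'))]

/-- For the direct implication it suffices to use the local functions `ℓ ∘ chart`, with `ℓ` a
complex linear functional: they separate tangent vectors at the point. -/
theorem pullsBackHolomorphicToHarmonic_iff (hmin : HasMinimalFibres EY EZ φ) :
    PullsBackHolomorphicToHarmonic EY EZ φ ↔ ∀ y, S.traceω y = 0 := by
  constructor
  · intro h y
    rw [← S.mfderiv_traceIT_eq_zero_iff]
    refine injective_mvfderiv_chart (mem_chart_source EZ (φ y)) ?_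
    have : CompleteSpace EZ := FiniteDimensional.complete ℂ EZ
    set w := mfderiv 𝓘(ℝ, EY) 𝓘(ℝ, EZ) φ y (S.traceIT y)
    have hfd : MDifferentiableAt 𝓘(ℝ, EZ) 𝓘(ℝ, EZ) (extChartAt 𝓘(ℝ, EZ) (φ y)) (φ y) :=
      mdifferentiableAt_extChartAt' (mem_chart_source EZ (φ y))
    refine SeparatingDual.eq_zero_of_forall_dual_eq_zero (R := ℂ) (V := EZ) fun ℓ => ?_
    have hℓ : MDifferentiableOn 𝓘(ℂ, EZ) 𝓘(ℂ, ℂ) (fun z => ℓ (extChartAt 𝓘(ℝ, EZ) (φ y) z))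
        (chartAt EZ (φ y)).source := fun z hz =>
      (ℓ.differentiableAt.comp_mdifferentiableAt (f := extChartAt 𝓘(ℝ, EZ) (φ y))
        (mdifferentiableAt_chart_complex hz)).mdifferentiableWithinAt
    have h1 := h _ _ (chartAt EZ (φ y)).open_source hℓ y (mem_chart_source EZ (φ y))
    have h2 := (S.sum_hess_comp hmin (chartAt EZ (φ y)).open_source hℓ
      (mem_chart_source EZ (φ y))).symm.trans h1
    rw [neg_eq_zero, smul_eq_zero, smul_eq_zero] at h2
    have h3 := (h2.resolve_left (by norm_num)).resolve_left Complex.I_ne_zero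
    exact (mvfderiv_clm (ℓ.restrictScalars ℝ) hfd w).symm.trans h3
  · intro h U f hU hf y hy
    refine (S.sum_hess_comp hmin hU hf hy).trans ?_
    rw [(S.mfderiv_traceIT_eq_zero_iff y).2 (h y)]
    simp

end

end RiemannianTwistorialStructure

/-! ### Christoffel forms in charts -/

section

variable {EM : Type*} [NormedAddCommGroup EM] [NormedSpace ℝ EM] [FiniteDimensional ℝ EM]
  {M : Type*} [TopologicalSpace M] [ChartedSpace EM M] [IsManifold 𝓘(ℝ, EM) ∞ M]

theorem trivializationAt_apply_snd {x z : M} (hz : z ∈ (chartAt EM x).source)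
    (w : TangentSpace 𝓘(ℝ, EM) z) :
    (trivializationAt EM (TangentSpace 𝓘(ℝ, EM)) x ⟨z, w⟩).2 =
      mvfderiv 𝓘(ℝ, EM) (extChartAt 𝓘(ℝ, EM) x) z w := by
  have h := comps_eq_mvfderiv (FiberBundle.extend EM w) hz
  rwa [comps, FiberBundle.extend_apply_self] at h

theorem mvfderiv_chart_extend {x z : M} (hz : z ∈ (chartAt EM x).source)
    (w : TangentSpace 𝓘(ℝ, EM) x) :
    mvfderiv 𝓘(ℝ, EM) (extChartAt 𝓘(ℝ, EM) x) z (FiberBundle.extend EM w z) = w := by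
  rw [← trivializationAt_apply_snd hz, extend_eq_symm]
  exact congrArg Prod.snd ((trivializationAt EM (TangentSpace 𝓘(ℝ, EM)) x).apply_mk_symm
    (by simpa using hz) w)

theorem eventually_extend_eq {x : M} {w : TangentSpace 𝓘(ℝ, EM) x}
    {X : ∀ x : M, TangentSpace 𝓘(ℝ, EM) x}
    (hX : ∀ z ∈ (chartAt EM x).source, mvfderiv 𝓘(ℝ, EM) (extChartAt 𝓘(ℝ, EM) x) z (X z) = w) :
    ∀ᶠ z in 𝓝 x, FiberBundle.extend EM w z = X z := by
  filter_upwards [chart_source_mem_nhds EM x] with z hz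
  refine sub_eq_zero.1 (injective_mvfderiv_chart hz ?_)
  rw [map_sub, mvfderiv_chart_extend hz, hX z hz]
  exact sub_self (show EM from w)

theorem trivDeriv_mfderiv {EY : Type*} [NormedAddCommGroup EY] [NormedSpace ℝ EY]
    [FiniteDimensional ℝ EY] {Y : Type*} [TopologicalSpace Y] [ChartedSpace EY Y]
    [IsManifold 𝓘(ℝ, EY) ∞ Y] [RiemannianBundle (fun y : Y => TangentSpace 𝓘(ℝ, EY) y)]
    [IsContMDiffRiemannianBundle 𝓘(ℝ, EY) ∞ EY (fun y : Y => TangentSpace 𝓘(ℝ, EY) y)] {p : Y → M}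
    (hp : ContMDiff 𝓘(ℝ, EY) 𝓘(ℝ, EM) ∞ p) (V : ∀ y : Y, TangentSpace 𝓘(ℝ, EY) y) (y : Y)
    (v : TangentSpace 𝓘(ℝ, EY) y) :
    trivDeriv EM p (fun y' => mfderiv 𝓘(ℝ, EY) 𝓘(ℝ, EM) p y' (V y')) y v =
      mvfderiv 𝓘(ℝ, EY) (fun y' => mvfderiv 𝓘(ℝ, EY)
          (fun y'' => extChartAt 𝓘(ℝ, EM) (p y) (p y'')) y' (V y')) y v := by
  have h1 : (fun y' => (trivializationAt EM (TangentSpace 𝓘(ℝ, EM)) (p y)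
      ⟨p y', mfderiv 𝓘(ℝ, EY) 𝓘(ℝ, EM) p y' (V y')⟩).2) =ᶠ[𝓝 y] fun y' => mvfderiv 𝓘(ℝ, EY)
          (fun y'' => extChartAt 𝓘(ℝ, EM) (p y) (p y'')) y' (V y') := by
    filter_upwards [hp.continuous.continuousAt.eventually (chart_source_mem_nhds EM (p y))]
      with y' hy'
    rw [trivializationAt_apply_snd hy', mvfderiv_chart_comp hp hy']
  rw [trivDeriv, mvfderiv_congr h1]
  have h2 := symm_mvfderiv_chart (mem_chart_source EM (p y)) (show TangentSpace 𝓘(ℝ, EM) (p y) from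
    mvfderiv 𝓘(ℝ, EY) (fun y' => mvfderiv 𝓘(ℝ, EY)
          (fun y'' => extChartAt 𝓘(ℝ, EM) (p y) (p y'')) y' (V y')) y v)
  rwa [mvfderiv_extChartAt_self] at h2

variable [RiemannianBundle (fun x : M => TangentSpace 𝓘(ℝ, EM) x)]
  [IsContMDiffRiemannianBundle 𝓘(ℝ, EM) ∞ EM (fun x : M => TangentSpace 𝓘(ℝ, EM) x)]

/-- The Christoffel symbol of the Levi-Civita connection in the preferred chart at a point. -/
theorem exists_christoffel (x : M) :
    ∃ Γ : TangentSpace 𝓘(ℝ, EM) x →ₗ[ℝ] TangentSpace 𝓘(ℝ, EM) x →ₗ[ℝ] TangentSpace 𝓘(ℝ, EM) x,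
      (∀ a b, Γ a b = leviCivita (FiberBundle.extend EM b) x a) ∧ ∀ a b, Γ a b = Γ b a := by
  have hd := fun b : TangentSpace 𝓘(ℝ, EM) x => FiberBundle.mdifferentiableAt_extend 𝓘(ℝ, EM) EM b
  refine ⟨LinearMap.mk₂ ℝ (fun a b => leviCivita (FiberBundle.extend EM b) x a)
    (fun a a' b => leviCivita_add_dir (hd b) a a') (fun r a b => leviCivita_smul_dir (hd b) r a)
    (fun a b b' => ?_) (fun r a b => ?_), fun _ _ => rfl, fun a b => ?_⟩
  · rw [← leviCivita_add (hd b) (hd b')]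
    refine leviCivita_congr (eventually_extend_eq fun z hz => ?_) a
    rw [Pi.add_apply, map_add, mvfderiv_chart_extend hz, mvfderiv_chart_extend hz]
    rfl
  · have h := leviCivita_smul (f := fun _ : M => r) (mdifferentiableAt_const (c := r)) (hd b) a
    rw [mvfderiv_const] at h
    refine (leviCivita_congr (eventually_extend_eq fun z hz => ?_) a).trans (h.trans ?_)
    · rw [Pi.smul_apply', map_smul, mvfderiv_chart_extend hz]
      rfl
    · simp
  · have h := leviCivita_torsion (hd a) (hd b)
    rw [mlieBracket_extend, FiberBundle.extend_apply_self, FiberBundle.extend_apply_self,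
      sub_eq_zero] at h
    exact h

/-- Holomorphic charts make the extension of `ib` equal to `i` times the extension of `b`; then the
complex structure is parallel. -/
theorem leviCivita_extend_mulI {EZ : Type*} [NormedAddCommGroup EZ] [NormedSpace ℂ EZ]
    [FiniteDimensional ℝ EZ] {Z : Type*} [TopologicalSpace Z] [ChartedSpace EZ Z]
    [IsManifold 𝓘(ℂ, EZ) ω Z] [RiemannianBundle (fun z : Z => TangentSpace 𝓘(ℝ, EZ) z)]
    [IsContMDiffRiemannianBundle 𝓘(ℝ, EZ) ∞ EZ (fun z : Z => TangentSpace 𝓘(ℝ, EZ) z)]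
    (hZ : IsKaehler EZ Z) {z : Z} (a b : TangentSpace 𝓘(ℝ, EZ) z) :
    leviCivita (FiberBundle.extend EZ (mulI z b)) z a =
      mulI z (leviCivita (FiberBundle.extend EZ b) z a) := by
  rw [← hZ.parallel _ z (FiberBundle.contMDiffAt_extend 𝓘(ℝ, EZ) EZ b) a]
  refine leviCivita_congr (eventually_extend_eq fun z' hz' => ?_) a
  rw [mvfderiv_chart_mulI hz', mvfderiv_chart_extend hz']
  rfl

end

/-! ### Harmonicity of `φ` for Kähler metrics on `Z` -/

namespace RiemannianTwistorialStructure

section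

variable {EY EM EZ F : Type*}
  [NormedAddCommGroup EY] [NormedSpace ℝ EY] [FiniteDimensional ℝ EY]
  [NormedAddCommGroup EM] [NormedSpace ℝ EM] [FiniteDimensional ℝ EM]
  [NormedAddCommGroup EZ] [NormedSpace ℂ EZ] [FiniteDimensional ℂ EZ]
  [NormedAddCommGroup F] [NormedSpace ℝ F] [FiniteDimensional ℝ F]
  {Y : Type*} [TopologicalSpace Y]
  [ChartedSpace EY Y] [IsManifold 𝓘(ℝ, EY) ∞ Y]
  [RiemannianBundle (fun y : Y => TangentSpace 𝓘(ℝ, EY) y)]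
  [IsContMDiffRiemannianBundle 𝓘(ℝ, EY) ∞ EY (fun y : Y => TangentSpace 𝓘(ℝ, EY) y)]
  {M : Type*} [TopologicalSpace M] [T2Space M]
  [ChartedSpace EM M] [IsManifold 𝓘(ℝ, EM) ∞ M]
  [RiemannianBundle (fun x : M => TangentSpace 𝓘(ℝ, EM) x)]
  [IsContMDiffRiemannianBundle 𝓘(ℝ, EM) ∞ EM (fun x : M => TangentSpace 𝓘(ℝ, EM) x)]
  {Z : Type*} [TopologicalSpace Z]
  [ChartedSpace EZ Z] [IsManifold 𝓘(ℂ, EZ) ω Z]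
  {E : M → Type*} [TopologicalSpace (TotalSpace F E)]
  [∀ x, NormedAddCommGroup (E x)] [∀ x, InnerProductSpace ℝ (E x)]
  [∀ x, FiniteDimensional ℝ (E x)] [FiberBundle F E] [VectorBundle ℝ F E]
  [ContMDiffVectorBundle ∞ F E 𝓘(ℝ, EM)] [IsContMDiffRiemannianBundle 𝓘(ℝ, EM) ∞ F E]
  {p : Y → M} {φ : Y → Z}
  (S : RiemannianTwistorialStructure EY EM EZ F E p φ)

include S in
theorem sum_eq_zero_of_rotate {G : Type*} [AddCommGroup G] [Module ℝ G] {y : Y}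
    (B : TangentSpace 𝓘(ℝ, EY) y →ₗ[ℝ] TangentSpace 𝓘(ℝ, EY) y →ₗ[ℝ] G)
    (hker : ∀ u ∈ vert EY EZ φ y, B u u = 0)
    (hJ : ∀ u, B u u + B (Jφ EZ φ y u) (Jφ EZ φ y u) = 0) :
    ∑ i, B (stdOrthonormalBasis ℝ (TangentSpace 𝓘(ℝ, EY) y) i)
        (stdOrthonormalBasis ℝ (TangentSpace 𝓘(ℝ, EY) y) i) = 0 := by
  rw [S.sum_diag_eq y B, S.sum_rotate (S.coCRData y).le_orthogonal_ker
    (fun u hu => (S.coCRData y).J_vert hu), S.sum_rotate (N := hor EY EM p y ⊓ hor EY EZ φ y)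
    inf_le_right (fun u hu => (S.coCRData y).J_hor hu),
    Finset.sum_eq_zero fun i _ => hker _ (Subtype.mem _), Finset.sum_eq_zero fun i _ => hJ _,
    Finset.sum_eq_zero fun i _ => hJ _]
  simp

/-- In the chart at `φ y` the tension is the Laplacian of the vector valued holomorphic function
`chart`, composed with `φ`, plus the trace of the Christoffel form on `dφ`. The first vanishes by
the Laplacian formula, the second by the Kähler property. -/
theorem tension_eq_zero [RiemannianBundle (fun z : Z => TangentSpace 𝓘(ℝ, EZ) z)]
    [IsContMDiffRiemannianBundle 𝓘(ℝ, EZ) ∞ EZ (fun z : Z => TangentSpace 𝓘(ℝ, EZ) z)]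
    (hmin : HasMinimalFibres EY EZ φ) (hZ : IsKaehler EZ Z) {y : Y} (hy : S.traceω y = 0) :
    tension (EY := EY) (EM := EZ) φ y = 0 := by
  have : CompleteSpace EZ := FiniteDimensional.complete ℂ EZ
  have hφ := S.φ_submersion.smooth
  let e := fun i => stdOrthonormalBasis ℝ (TangentSpace 𝓘(ℝ, EY) y) i
  obtain ⟨Γ, hΓ, hΓs⟩ := exists_christoffel (EM := EZ) (φ y)
  let A := (mfderiv 𝓘(ℝ, EY) 𝓘(ℝ, EZ) φ y).toLinearMap
  have hA : ∀ u, A u = mfderiv 𝓘(ℝ, EY) 𝓘(ℝ, EZ) φ y u := fun _ => rfl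
  have hterm : ∀ i, pullbackConn EZ (leviCivita (M := Z)) φ
      (fun y' : Y => mfderiv 𝓘(ℝ, EY) 𝓘(ℝ, EZ) φ y' (FiberBundle.extend EY (e i) y')) y (e i)
      - mfderiv 𝓘(ℝ, EY) 𝓘(ℝ, EZ) φ y (leviCivita (FiberBundle.extend EY (e i)) y (e i)) =
      (show TangentSpace 𝓘(ℝ, EZ) (φ y) from hess (fun y' => extChartAt 𝓘(ℝ, EZ) (φ y) (φ y'))
        (FiberBundle.extend EY (e i)) y (e i)) + Γ (A (e i)) (A (e i)) := by
    intro i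
    have h1 : mvfderiv 𝓘(ℝ, EY) (fun y' => extChartAt 𝓘(ℝ, EZ) (φ y) (φ y')) y
        (leviCivita (FiberBundle.extend EY (e i)) y (e i)) = mfderiv 𝓘(ℝ, EY) 𝓘(ℝ, EZ) φ y
        (leviCivita (FiberBundle.extend EY (e i)) y (e i)) := by
      rw [mvfderiv_chart_comp hφ (mem_chart_source EZ (φ y))]
      exact mvfderiv_extChartAt_self _ _
    rw [pullbackConn, trivDeriv_mfderiv hφ, hΓ, ← h1, FiberBundle.extend_apply_self, hA]
    exact add_sub_right_comm _ _ _
  have h1 : ∑ i, hess (fun y' => extChartAt 𝓘(ℝ, EZ) (φ y) (φ y'))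
      (FiberBundle.extend EY (e i)) y (e i) = 0 := by
    rw [S.sum_hess_comp hmin (chartAt EZ (φ y)).open_source (mdifferentiableOn_chart_complex (φ y))
      (mem_chart_source EZ (φ y)), (S.mfderiv_traceIT_eq_zero_iff y).2 hy]
    simp
  have h2 : ∑ i, Γ (A (e i)) (A (e i)) = 0 := by
    refine S.sum_eq_zero_of_rotate (Γ.compl₁₂ A A) (fun u hu => ?_) (fun u => ?_)
    · have : A u = 0 := hu
      rw [LinearMap.compl₁₂_apply, this, map_zero]
    -- Complex linearity in one slot and symmetry give complex bilinearity, so `Γ(iw, iw) = -Γ(w,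
    -- w)`.
    · have hI : ∀ a b, Γ a (mulI (φ y) b) = mulI (φ y) (Γ a b) := fun a b => by
        rw [hΓ, hΓ, leviCivita_extend_mulI hZ]
      rw [LinearMap.compl₁₂_apply, LinearMap.compl₁₂_apply, hA (Jφ EZ φ y u),
        mfderiv_Jφ S.φ_submersion, hI, hΓs _ (mfderiv 𝓘(ℝ, EY) 𝓘(ℝ, EZ) φ y u), hI, mulI_mulI, hA,
            add_neg_cancel]
  refine (Finset.sum_congr rfl fun i _ => hterm i).trans ?_
  rw [Finset.sum_add_distrib, h2, add_zero]
  exact h1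

end

end RiemannianTwistorialStructure

end Twistorial

open Twistorial in
theorem theorem3p4
    {EY EM EZ F : Type*}
    [NormedAddCommGroup EY] [NormedSpace ℝ EY] [FiniteDimensional ℝ EY]
    [NormedAddCommGroup EM] [NormedSpace ℝ EM] [FiniteDimensional ℝ EM]
    [NormedAddCommGroup EZ] [NormedSpace ℂ EZ] [FiniteDimensional ℂ EZ]
    [NormedAddCommGroup F] [NormedSpace ℝ F] [FiniteDimensional ℝ F]
    {Y : Type*} [TopologicalSpace Y] [T2Space Y] [SecondCountableTopology Y]
    [ChartedSpace EY Y] [IsManifold 𝓘(ℝ, EY) ∞ Y]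
    [RiemannianBundle (fun y : Y => TangentSpace 𝓘(ℝ, EY) y)]
    [IsContMDiffRiemannianBundle 𝓘(ℝ, EY) ∞ EY (fun y : Y => TangentSpace 𝓘(ℝ, EY) y)]
    {M : Type*} [TopologicalSpace M] [T2Space M] [SecondCountableTopology M]
    [ChartedSpace EM M] [IsManifold 𝓘(ℝ, EM) ∞ M]
    [RiemannianBundle (fun x : M => TangentSpace 𝓘(ℝ, EM) x)]
    [IsContMDiffRiemannianBundle 𝓘(ℝ, EM) ∞ EM (fun x : M => TangentSpace 𝓘(ℝ, EM) x)]
    {Z : Type*} [TopologicalSpace Z] [T2Space Z] [SecondCountableTopology Z]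
    [ChartedSpace EZ Z] [IsManifold 𝓘(ℂ, EZ) ω Z]
    (E : M → Type*) [TopologicalSpace (TotalSpace F E)]
    [∀ x, NormedAddCommGroup (E x)] [∀ x, InnerProductSpace ℝ (E x)]
    [∀ x, FiniteDimensional ℝ (E x)] [FiberBundle F E] [VectorBundle ℝ F E]
    [ContMDiffVectorBundle ∞ F E 𝓘(ℝ, EM)] [IsContMDiffRiemannianBundle 𝓘(ℝ, EM) ∞ F E]
    (p : Y → M) (φ : Y → Z)
    (S : RiemannianTwistorialStructure EY EM EZ F E p φ)
    (hmin : HasMinimalFibres EY EZ φ) :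
    (PullsBackHolomorphicToHarmonic EY EZ φ ↔ ∀ y, S.traceω y = 0) ∧
    ((∀ y, S.traceω y = 0) →
      ∀ [RiemannianBundle (fun z : Z => TangentSpace 𝓘(ℝ, EZ) z)]
        [IsContMDiffRiemannianBundle 𝓘(ℝ, EZ) ∞ EZ (fun z : Z => TangentSpace 𝓘(ℝ, EZ) z)],
        IsKaehler EZ Z →
          ∀ y, tension (EY := EY) (EM := EZ) φ y = 0) := by
  exact ⟨S.pullsBackHolomorphicToHarmonic_iff hmin,
    fun h _ _ hZ y => S.tension_eq_zero hmin hZ (h y)⟩
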